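/- Let $(N,I,J,K,g)$ be a compact hyperkähler manifold of real dimension $4n$ (without boundary; $I,J,K$ are complex structures satisfying the quaternionic relations, skew for $g$ and parallel for the Levi-Civita connection), and let $\psi:N\to N$ be a hyperkähler isometry, i.e. a diffeomorphism with $\psi^*g=g$ whose differential commutes with $I,J,K$. Let $N_\psi=(N\times\mathbb R)/\mathbb Z$ be the mapping torus, where $k\cdot(p,t)=(\psi^k(p),t+k)$. Then $N_\psi\times S^3$ admits a generalized hyperkähler structure: a Riemannian metric $G$ and two hypercomplex structures $(B_1,B_2,B_3)$ and $(B_1',B_2',B_3')$ such that 1. each $B_a$ and each $B'_a$ is skew for $G$, and $((B_a),G)$ and $((B'_a),G)$ are both HKT: the three Hermitian structures $(B_a,G)$ have one common Bismut connection (the Hermitian connection with totally skew-symmetric torsion), and so do the three structures $(B'_a,G)$; 2. the torsion $3$-forms $H(u,v,w)=G(T(u,v),w)$ and $H'(u,v,w)=G(T'(u,v),w)$ of these two Bismut connections satisfy $H=-H'$ and $dH=dH'=0$ (so both HKT structures are strong). Moreover the structure can be chosen as follows. Let $\pi:N\times(\mathbb H\setminus\{0\})\to N_\psi\times S^3$,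 $\pi(p,x)=\big([p,\log_2|x|],\,x/|x|\big)$, which is the quotient map for the $\mathbb Z$-action $k\cdot(p,x)=(\psi^k(p),2^kx)$. For $v,v'\in T_pN$ and $w,w'\in T_x(\mathbb H\setminus\{0\})=\mathbb H$, with $(A_1,A_2,A_3)=(I,J,K)$ and $(e_1,e_2,e_3)=(i,j,k)$, $$G\big(d\pi(v,w),d\pi(v',w')\big)=g(v,v')+\frac{\langle w,w'\rangle}{|x|^2},$$ $$B_a\,d\pi(v,w)=d\pi(A_av,\;e_a w),\qquad B'_a\,d\pi(v,w)=d\pi(A_av,\;w\,\overline{e_a}).$$ That is, the first structure is induced by left multiplication by $i,j,k$ on $\mathbb H\setminus\{0\}$ and the second one by right multiplication by $\bar i,\bar j,\bar k$; both are invariant under the $\mathbb Z$-action and descend to the quotient. -/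

import Mathlib

open scoped Manifold ContDiff Quaternion
open Bundle

noncomputable section

namespace HKT

/-! ### Tensor fields on a manifold without boundary -/

section Tensors

variable {E : Type*} [NormedAddCommGroup E] [NormedSpace ℝ E]
  {H : Type*} [TopologicalSpace H] (I : ModelWithCorners ℝ E H)
  (M : Type*) [TopologicalSpace M] [ChartedSpace H M]

/-- Fields of endomorphisms of the tangent spaces of `M`. -/
abbrev EndField : Type _ := (x : M) → TangentSpace I x →L[ℝ] TangentSpace I x

/-- Differential `k`-forms on `M`, with no regularity imposed. -/
abbrev FormField (k : ℕ) : Type _ := (x : M) → TangentSpace I x [⋀^Fin k]→L[ℝ] ℝ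

/-- Smooth Riemannian metrics on `M`. -/
abbrev SmoothMetric [IsManifold I ∞ M] : Type _ :=
  ContMDiffRiemannianMetric I ∞ E (TangentSpace I : M → Type _)

/-- Affine connections on `M`, that is, covariant derivatives on the tangent bundle.
The value `∇ Y x v` is what is usually written `∇_v Y` at `x`. -/
abbrev Connection [IsManifold I ∞ M] : Type _ :=
  CovariantDerivative I E (TangentSpace I : M → Type _)

variable {I M}

/-- The endomorphism field `A` is smooth. -/
def IsSmoothEndField [IsManifold I ∞ M] (A : EndField I M) : Prop :=
  ContMDiff I (I.prod 𝓘(ℝ, E →L[ℝ] E)) ∞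
    (fun x ↦ TotalSpace.mk' (E →L[ℝ] E)
      (E := fun y : M ↦ TangentSpace I y →L[ℝ] TangentSpace I y) x (A x))

/-- `A` is a complex structure on `M`: a smooth almost complex structure which is induced by an
atlas of holomorphic charts. Around every point there is a smooth chart whose differential carries
`A` to a constant complex structure `J` of the model vector space. -/
structure IsComplexStructure [IsManifold I ∞ M] (A : EndField I M) : Prop where
  smooth : IsSmoothEndField A
  sq : ∀ x v, A x (A x v) = -v
  integrable : ∀ x : M, ∃ (J : E →L[ℝ] E) (φ : OpenPartialHomeomorph M E),
    (∀ v, J (J v) = -v) ∧ x ∈ φ.source ∧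
    ContMDiffOn I 𝓘(ℝ, E) ∞ φ φ.source ∧ ContMDiffOn 𝓘(ℝ, E) I ∞ φ.symm φ.target ∧
    ∀ y ∈ φ.source, ∀ v : TangentSpace I y,
      (mfderiv I 𝓘(ℝ, E) φ y (A y v) : E) = J (mfderiv I 𝓘(ℝ, E) φ y v)

/-- The representation on the model vector space of a form in the preferred chart at `x₀`. -/
def formInChart {k : ℕ} (θ : FormField I M k) (x₀ : M) (y : E) : E [⋀^Fin k]→L[ℝ] ℝ :=
  (θ ((extChartAt I x₀).symm y)).compContinuousLinearMap
    (mfderiv 𝓘(ℝ, E) I (extChartAt I x₀).symm y)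

/-- The form `θ` is smooth: all its chart representations are. -/
def IsSmoothForm {k : ℕ} (θ : FormField I M k) : Prop :=
  ∀ x₀ : M, ContDiffOn ℝ ∞ (formInChart θ x₀) (extChartAt I x₀).target

/-- The exterior derivative of a form on `M`, computed in the preferred chart at each point. -/
def extD {k : ℕ} (θ : FormField I M k) : FormField I M (k + 1) := fun x ↦
  (extDeriv (formInChart θ x) (extChartAt I x x)).compContinuousLinearMap
    (mfderiv I 𝓘(ℝ, E) (extChartAt I x) x)

/-- The form `θ` is smooth and closed, `dθ = 0`. -/
def IsClosedForm {k : ℕ} (θ : FormField I M k) : Prop :=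
  IsSmoothForm θ ∧ ∀ x, extD θ x = 0

end Tensors

/-! ### Hyperhermitian, hyperkähler, HKT and generalized hyperkähler structures -/

section Structures

variable {E : Type*} [NormedAddCommGroup E] [NormedSpace ℝ E]
  {H : Type*} [TopologicalSpace H] {I : ModelWithCorners ℝ E H}
  {M : Type*} [TopologicalSpace M] [ChartedSpace H M] [IsManifold I ∞ M]

/-- A triple `(A 0, A 1, A 2) = (I, J, K)` of complex structures on `M` satisfying the relations
of the imaginary quaternions (`I² = J² = K² = -1` is part of `IsComplexStructure`). -/
structure IsHypercomplex (A : Fin 3 → EndField I M) : Prop where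
  complex : ∀ a, IsComplexStructure (A a)
  mul : ∀ x v, A 0 x (A 1 x v) = A 2 x v
  mul_swap : ∀ x v, A 1 x (A 0 x v) = -A 2 x v

/-- A hypercomplex structure together with a Riemannian metric for which it is skew. -/
structure IsHyperhermitian (g : SmoothMetric I M) (A : Fin 3 → EndField I M) : Prop where
  hypercomplex : IsHypercomplex A
  skew : ∀ a x u v, g.inner x (A a x u) v = -g.inner x u (A a x v)

/-- The connection `D` is metric: `D g = 0`. -/
def IsMetricConnection (g : SmoothMetric I M) (D : Connection I M) : Prop :=
  ∀ (x : M) (Y Z : (y : M) → TangentSpace I y),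
    MDifferentiableAt I I.tangent (fun y ↦ (Y y : TangentBundle I M)) x →
    MDifferentiableAt I I.tangent (fun y ↦ (Z y : TangentBundle I M)) x →
    ∀ v : TangentSpace I x,
      (mfderiv I 𝓘(ℝ, ℝ) (fun y ↦ g.inner y (Y y) (Z y)) x v : ℝ) =
        g.inner x (D Y x v) (Z x) + g.inner x (Y x) (D Z x v)

/-- The endomorphism field `A` is parallel: `D A = 0`. -/
def IsParallelEnd (A : EndField I M) (D : Connection I M) : Prop :=
  ∀ (x : M) (Y : (y : M) → TangentSpace I y),
    MDifferentiableAt I I.tangent (fun y ↦ (Y y : TangentBundle I M)) x →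
    ∀ v : TangentSpace I x, D (fun y ↦ A y (Y y)) x v = A x (D Y x v)

variable [FiniteDimensional ℝ E] [CompleteSpace E]

/-- `D` is the Bismut connection of the Hermitian structure `(A, g)` and the `3`-form `T` is its
torsion: `D` is Hermitian (`D g = 0`, `D A = 0`) and its torsion is totally skew-symmetric, given
by `T(u, v, w) = g(T^D(u, v), w)`. Such a connection is unique (and is automatically smooth). -/
structure IsBismutConnection (g : SmoothMetric I M) (A : EndField I M) (D : Connection I M)
    (T : FormField I M 3) : Prop where
  metric : IsMetricConnection g D
  parallel : IsParallelEnd A D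
  torsion_eq : ∀ (x : M) (u v w : TangentSpace I x),
    T x ![u, v, w] = g.inner x (D.torsion x u v) w

/-- `(A, g)` is a hyperkähler structure: a hyperhermitian structure whose three complex structures
are parallel for the Levi-Civita connection, i.e. for the torsion-free metric connection. -/
structure IsHyperkahler (g : SmoothMetric I M) (A : Fin 3 → EndField I M) : Prop where
  hyperhermitian : IsHyperhermitian g A
  parallel : ∃ D : Connection I M, D.torsion = 0 ∧ IsMetricConnection g D ∧
    ∀ a, IsParallelEnd (A a) D

/-- `(A, g)` is an HKT structure with Bismut torsion `T`: a hyperhermitian structure whose three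
Hermitian structures have the same Bismut connection, and `T` is the torsion of the latter. -/
structure IsHKT (g : SmoothMetric I M) (A : Fin 3 → EndField I M) (T : FormField I M 3) :
    Prop where
  hyperhermitian : IsHyperhermitian g A
  bismut : ∃ D : Connection I M, ∀ a, IsBismutConnection g (A a) D T

/-- A strong HKT structure with Bismut torsion `T`: the torsion is closed. -/
structure IsStrongHKT (g : SmoothMetric I M) (A : Fin 3 → EndField I M) (T : FormField I M 3) :
    Prop where
  hkt : IsHKT g A T
  closed : IsClosedForm T

/-- `(A, A', g)` is a generalized hyperkähler structure: two strong HKT structures `(A, g)` and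
`(A', g)` with the same metric and opposite Bismut torsions. -/
def IsGeneralizedHyperkahler (g : SmoothMetric I M) (A A' : Fin 3 → EndField I M) : Prop :=
  ∃ T T' : FormField I M 3, IsStrongHKT g A T ∧ IsStrongHKT g A' T' ∧ ∀ x, T x = -T' x

end Structures

/-- The diffeomorphism `ψ` is a hyperkähler isometry: it preserves the metric `g` and is
holomorphic for each of the three complex structures. -/
structure IsHyperkahlerIsometry {E : Type*} [NormedAddCommGroup E] [NormedSpace ℝ E]
    {H : Type*} [TopologicalSpace H] {I : ModelWithCorners ℝ E H}
    {N : Type*} [TopologicalSpace N] [ChartedSpace H N] [IsManifold I ∞ N]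
    (g : SmoothMetric I N) (A : Fin 3 → EndField I N) (ψ : N ≃ₘ^∞⟮I, I⟯ N) : Prop where
  isometry : ∀ (p : N) (u v : TangentSpace I p),
    g.inner (ψ p) (mfderiv I I ψ p u) (mfderiv I I ψ p v) = g.inner p u v
  holomorphic : ∀ (a : Fin 3) (p : N) (u : TangentSpace I p),
    mfderiv I I ψ p (A a p u) = A a (ψ p) (mfderiv I I ψ p u)

/-! ### Mapping tori -/

/-- The charted space structure pushed forward along a local homeomorphism is smooth, as soon as
points with the same image are related by smooth maps compatible with the projection. -/
theorem isManifold_of_isLocalHomeomorph {E : Type*} [NormedAddCommGroup E] [NormedSpace ℝ E]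
    {H : Type*} [TopologicalSpace H] {J : ModelWithCorners ℝ E H}
    {M : Type*} [TopologicalSpace M] [ChartedSpace H M] [IsManifold J ∞ M]
    {X : Type*} [TopologicalSpace X] [ChartedSpace H X] {pr : M → X} (hpr : IsLocalHomeomorph pr)
    (hdeck : ∀ z w, pr z = pr w → ∃ d : M → M, ContMDiff J J ∞ d ∧ d z = w ∧ ∀ m, pr (d m) = pr m)
    (hatlas : ∀ e ∈ atlas H X, ∃ z, e = (hpr.localInverseAt z).trans (chartAt H z)) :
    IsManifold J ∞ X := by
  apply isManifold_of_contDiffOn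
  intro e e' he he'
  have key : ContMDiffOn J J ∞ (e.symm ≫ₕ e') (e.symm ≫ₕ e').source := by
    obtain ⟨z, rfl⟩ := hatlas e he
    obtain ⟨z', rfl⟩ := hatlas e' he'
    intro y hy
    simp only [OpenPartialHomeomorph.trans_source, OpenPartialHomeomorph.symm_source,
      Set.mem_inter_iff, Set.mem_preimage,
      OpenPartialHomeomorph.trans_symm_eq_symm_trans_symm, OpenPartialHomeomorph.coe_trans,
      Function.comp_apply, IsLocalHomeomorph.localInverseAt_symm] at hy
    obtain ⟨⟨hy1, hy2⟩, hy3, hy4⟩ := hy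
    set m := (chartAt H z).symm y with hm
    set w := hpr.localInverseAt z' (pr m) with hw
    have hprw : pr w = pr m := hpr.apply_localInverseAt_of_mem hy3
    obtain ⟨d, hd, hdm, hdpr⟩ := hdeck m w hprw.symm
    have hwt : w ∈ (hpr.localInverseAt z').target := (hpr.localInverseAt z').map_source hy3
    have hsm : ContMDiffAt J J ∞ (chartAt H z).symm y :=
      (contMDiffOn_chart_symm (I := J) (n := ∞) y hy1).contMDiffAt
        ((chartAt H z).open_target.mem_nhds hy1)
    have hch : ContMDiffAt J J ∞ (chartAt H z') w :=
      (contMDiffOn_chart (I := J) (n := ∞) w hy4).contMDiffAt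
        ((chartAt H z').open_source.mem_nhds hy4)
    have hcomp : ContMDiffAt J J ∞ (fun x ↦ chartAt H z' (d ((chartAt H z).symm x))) y := by
      have h1 : ContMDiffAt J J ∞ (fun x ↦ d ((chartAt H z).symm x)) y :=
        (hd.contMDiffAt (x := m)).comp y hsm
      have hch' : ContMDiffAt J J ∞ (chartAt H z') (d ((chartAt H z).symm y)) := by
        rw [← hm, hdm]; exact hch
      exact hch'.comp y h1
    refine ContMDiffAt.contMDiffWithinAt (hcomp.congr_of_eventuallyEq ?_)
    have hev : ∀ᶠ x in nhds y, d ((chartAt H z).symm x) ∈ (hpr.localInverseAt z').target := by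
      have hc : ContinuousAt (fun x ↦ d ((chartAt H z).symm x)) y :=
        ((hd.contMDiffAt (x := m)).comp y hsm).continuousAt
      refine hc.eventually_mem ((hpr.localInverseAt z').open_target.mem_nhds ?_)
      rw [← hm, hdm]
      exact hwt
    filter_upwards [hev] with x hx
    have h2 : hpr.localInverseAt z' (pr ((chartAt H z).symm x)) = d ((chartAt H z).symm x) := by
      rw [← hdpr]
      have h3 := (hpr.localInverseAt z').right_inv hx
      rwa [IsLocalHomeomorph.localInverseAt_symm] at h3
    simp [h2]
  have h := fun x y ↦ (contMDiffOn_iff.1 key).2 x y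
  rcases isEmpty_or_nonempty H with hH | ⟨⟨x⟩⟩
  · intro y hy
    exact (hH.false (J.symm y)).elim
  · have h' := h x x
    simp only [extChartAt, chartAt_self_eq, mfld_simps] at h'
    convert! h' using 1
    simp only [mfld_simps]
    rw [Set.inter_comm]

section MappingTorus

variable {E : Type*} [NormedAddCommGroup E] [NormedSpace ℝ E]
  {H : Type*} [TopologicalSpace H] {I : ModelWithCorners ℝ E H}
  {N : Type*} [TopologicalSpace N] [ChartedSpace H N]

/-- The manifold `N × ℝ`, to be equipped with the action of `ℤ` defined by `ψ`. -/
def TorusCover (_ψ : N ≃ₘ^∞⟮I, I⟯ N) : Type _ := N × ℝ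

variable (ψ : N ≃ₘ^∞⟮I, I⟯ N)

instance : TopologicalSpace (TorusCover ψ) := inferInstanceAs (TopologicalSpace (N × ℝ))

instance : ChartedSpace (ModelProd H ℝ) (TorusCover ψ) :=
  inferInstanceAs (ChartedSpace (ModelProd H ℝ) (N × ℝ))

instance [IsManifold I ∞ N] : IsManifold (I.prod 𝓘(ℝ, ℝ)) ∞ (TorusCover ψ) :=
  inferInstanceAs (IsManifold (I.prod 𝓘(ℝ, ℝ)) ∞ (N × ℝ))

instance [T2Space N] : T2Space (TorusCover ψ) := inferInstanceAs (T2Space (N × ℝ))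

instance [LocallyCompactSpace N] : LocallyCompactSpace (TorusCover ψ) :=
  inferInstanceAs (LocallyCompactSpace (N × ℝ))

/-- The action `k · (p, t) = (ψ^k p, t + k)` of `ℤ` on `N × ℝ`. -/
instance : AddAction ℤ (TorusCover ψ) where
  vadd k z := ((ψ.toEquiv ^ k : Equiv.Perm N) z.1, z.2 + k)
  zero_vadd z := by
    change (((ψ.toEquiv ^ (0 : ℤ) : Equiv.Perm N) z.1, z.2 + ((0 : ℤ) : ℝ)) : N × ℝ) = z
    simp only [zpow_zero, Equiv.Perm.coe_one, id_eq, Int.cast_zero, add_zero]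
    rfl
  add_vadd k l z := by
    change (((ψ.toEquiv ^ (k + l) : Equiv.Perm N) z.1, z.2 + ((k + l : ℤ) : ℝ)) : N × ℝ) =
      ((ψ.toEquiv ^ k : Equiv.Perm N) ((ψ.toEquiv ^ l : Equiv.Perm N) z.1), z.2 + l + k)
    rw [zpow_add, Equiv.Perm.mul_apply]
    push_cast
    rw [add_comm (k : ℝ), add_assoc]

theorem vadd_def (k : ℤ) (z : TorusCover ψ) :
    k +ᵥ z = (((ψ.toEquiv ^ k : Equiv.Perm N) z.1, z.2 + k) : N × ℝ) := rfl

theorem contMDiff_zpow (k : ℤ) : ContMDiff I I ∞ ((ψ.toEquiv ^ k : Equiv.Perm N) : N → N) := by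
  have hpos : ∀ m : ℕ, ContMDiff I I ∞ ((ψ.toEquiv ^ m : Equiv.Perm N) : N → N) := by
    intro m
    induction m with
    | zero => exact contMDiff_id
    | succ m ih => rw [pow_succ]; exact ih.comp ψ.contMDiff
  have hneg : ∀ m : ℕ, ContMDiff I I ∞ (((ψ.toEquiv⁻¹) ^ m : Equiv.Perm N) : N → N) := by
    intro m
    induction m with
    | zero => exact contMDiff_id
    | succ m ih => rw [pow_succ]; exact ih.comp ψ.symm.contMDiff
  cases k with
  | ofNat m => simpa using hpos m
  | negSucc m => rw [zpow_negSucc, ← inv_pow]; exact hneg _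

theorem contMDiff_vadd (k : ℤ) :
    ContMDiff (I.prod 𝓘(ℝ, ℝ)) (I.prod 𝓘(ℝ, ℝ)) ∞ (fun z : TorusCover ψ ↦ k +ᵥ z) := by
  have h1 : ContMDiff (I.prod 𝓘(ℝ, ℝ)) (I.prod 𝓘(ℝ, ℝ)) ∞
      (fun z : N × ℝ ↦ (((ψ.toEquiv ^ k : Equiv.Perm N) z.1, z.2 + k) : N × ℝ)) := by
    refine ((contMDiff_zpow ψ k).comp contMDiff_fst).prodMk ?_
    have h2 : ContMDiff 𝓘(ℝ, ℝ) 𝓘(ℝ, ℝ) ∞ (fun t : ℝ ↦ t + (k : ℝ)) :=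
      (contDiff_id.add contDiff_const).contMDiff
    exact h2.comp contMDiff_snd
  exact h1

instance : ContinuousConstVAdd ℤ (TorusCover ψ) :=
  ⟨fun k ↦ (contMDiff_vadd ψ k).continuous⟩

instance : IsCancelVAdd ℤ (TorusCover ψ) where
  left_cancel' k z w h := by simpa using h
  right_cancel' k l z h := by
    have h2 := congrArg (fun w : N × ℝ ↦ w.2) h
    simpa [vadd_def] using h2

instance : ProperlyDiscontinuousVAdd ℤ (TorusCover ψ) where
  finite_disjoint_inter_image {K L} hK hL := by
    have hK' : IsCompact (Prod.snd '' (K : Set (N × ℝ))) := hK.image continuous_snd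
    have hL' : IsCompact (Prod.snd '' (L : Set (N × ℝ))) := hL.image continuous_snd
    obtain ⟨a, ha⟩ := hK'.isBounded.exists_norm_le
    obtain ⟨b, hb⟩ := hL'.isBounded.exists_norm_le
    refine (Set.finite_Icc (-⌈a + b⌉) ⌈a + b⌉).subset ?_
    rintro k ⟨w, ⟨z, hz, rfl⟩, hw⟩
    have h1 := ha _ ⟨z, hz, rfl⟩
    have h2 : ‖z.2 + (k : ℝ)‖ ≤ b := hb _ ⟨_, hw, rfl⟩
    rw [Real.norm_eq_abs, abs_le] at h1 h2
    have h3 := Int.le_ceil (a + b)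
    constructor <;> (have : (k : ℝ) ≤ a + b ∧ -(a + b) ≤ (k : ℝ) := by constructor <;> linarith)
    · have h4 : ((-⌈a + b⌉ : ℤ) : ℝ) ≤ k := by push_cast; linarith
      exact_mod_cast h4
    · have h4 : (k : ℝ) ≤ (⌈a + b⌉ : ℤ) := by linarith
      exact_mod_cast h4

/-- The mapping torus `N_ψ = (N × ℝ) / ℤ`, where `k · (p, t) = (ψ^k p, t + k)`. -/
abbrev MappingTorus : Type _ := AddAction.orbitRel.Quotient ℤ (TorusCover ψ)

section Quotient

variable [T2Space N] [LocallyCompactSpace N]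

theorem isLocalHomeomorph_mk : IsLocalHomeomorph
    (Quotient.mk _ : TorusCover ψ → MappingTorus ψ) :=
  (isAddQuotientCoveringMap_quotientMk_of_properlyDiscontinuousVAdd
    (G := ℤ) (E := TorusCover ψ)).isCoveringMap.isLocalHomeomorph

theorem atlas_mappingTorus {e : OpenPartialHomeomorph (MappingTorus ψ) (ModelProd H ℝ)}
    (he : e ∈ atlas (ModelProd H ℝ) (MappingTorus ψ)) : ∃ z : TorusCover ψ,
      e = ((isLocalHomeomorph_mk ψ).localInverseAt z).trans (chartAt (ModelProd H ℝ) z) := by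
  obtain ⟨q, rfl⟩ := he
  exact ⟨_, rfl⟩

instance [IsManifold I ∞ N] : IsManifold (I.prod 𝓘(ℝ, ℝ)) ∞ (MappingTorus ψ) := by
  refine isManifold_of_isLocalHomeomorph (isLocalHomeomorph_mk ψ) ?_
    (fun e he ↦ atlas_mappingTorus ψ he)
  intro z w h
  obtain ⟨k, hk⟩ : w ∈ AddAction.orbit ℤ z := AddAction.orbitRel_apply.1 (Quotient.exact h.symm)
  exact ⟨_, contMDiff_vadd ψ k, hk, fun m ↦ Quotient.sound ⟨k, rfl⟩⟩

end Quotient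

/-- The projection `N × ℝ → N_ψ`. -/
def MappingTorus.mk (p : N) (t : ℝ) : MappingTorus ψ :=
  Quotient.mk (AddAction.orbitRel ℤ (TorusCover ψ)) ((p, t) : N × ℝ)

end MappingTorus

/-! ### The quaternions without the origin -/

instance : Fact (Module.finrank ℝ ℍ[ℝ] = 3 + 1) := ⟨Quaternion.finrank_eq_four⟩

/-- The `3`-sphere, as the unit sphere of the quaternions. -/
abbrev S3 : Type := Metric.sphere (0 : ℍ[ℝ]) 1

/-- The open subset `ℍ ∖ {0}` of `ℍ`. -/
def puncturedQuaternions : TopologicalSpace.Opens ℍ[ℝ] := ⟨{0}ᶜ, isOpen_compl_singleton⟩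

/-- The imaginary units `i, j, k`. -/
def imUnit : Fin 3 → ℍ[ℝ] := ![⟨0, 1, 0, 0⟩, ⟨0, 0, 1, 0⟩, ⟨0, 0, 0, 1⟩]

/-- The radial projection `x ↦ x / |x|` of `ℍ ∖ {0}` onto the `3`-sphere. -/
def radialProj (x : puncturedQuaternions) : S3 :=
  ⟨‖(x : ℍ[ℝ])‖⁻¹ • (x : ℍ[ℝ]), by
    have hx : (x : ℍ[ℝ]) ≠ 0 := x.2
    rw [mem_sphere_zero_iff_norm, norm_smul, norm_inv, norm_norm, inv_mul_cancel₀]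
    exact norm_ne_zero_iff.2 hx⟩

/-- The projection `N × (ℍ ∖ {0}) → N_ψ × S³`, `(p, x) ↦ ([p, log₂ |x|], x / |x|)`. It is the
quotient map for the action `k · (p, x) = (ψ^k p, 2^k x)` of `ℤ`. -/
def torusProj {E : Type*} [NormedAddCommGroup E] [NormedSpace ℝ E]
    {H : Type*} [TopologicalSpace H] {I : ModelWithCorners ℝ E H}
    {N : Type*} [TopologicalSpace N] [ChartedSpace H N] (ψ : N ≃ₘ^∞⟮I, I⟯ N)
    (z : N × puncturedQuaternions) : MappingTorus ψ × S3 :=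
  (MappingTorus.mk ψ z.1 (Real.logb 2 ‖(z.2 : ℍ[ℝ])‖), radialProj z.2)

/-- The differential of `torusProj` at `(p, x)`, applied to the tangent vector `(v, w)`. -/
def dTorusProj {E : Type*} [NormedAddCommGroup E] [NormedSpace ℝ E]
    {H : Type*} [TopologicalSpace H] {I : ModelWithCorners ℝ E H}
    {N : Type*} [TopologicalSpace N] [T2Space N] [LocallyCompactSpace N] [ChartedSpace H N]
    (ψ : N ≃ₘ^∞⟮I, I⟯ N) (p : N) (x : puncturedQuaternions) (v : TangentSpace I p) (w : ℍ[ℝ]) :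
    TangentSpace ((I.prod 𝓘(ℝ, ℝ)).prod (𝓡 3)) (torusProj ψ (p, x)) :=
  mfderiv (I.prod 𝓘(ℝ, ℍ[ℝ])) ((I.prod 𝓘(ℝ, ℝ)).prod (𝓡 3)) (torusProj ψ) (p, x) (v, w)

end HKT
end

/-!
The left structure on `ℍ ∖ {0}`, with the metric `⟨w, w'⟩ / |x|²`, commutes with right
multiplications. The connection for which all the fields `x ↦ x q` are parallel therefore preserves
left multiplication by `i, j, k`, and it preserves the metric because `|x q| = |x| |q|`. Its
Christoffel symbol is `Γ(v, w) = -w x⁻¹ v`, so its torsion is `u x⁻¹ v - v x⁻¹ u`, which paired with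
`w / |x|²` gives the `3`-form `2 |x|⁻⁴ ι_x vol` (`flatTorsion_apply`). In particular the torsion is
totally skew, and it is closed because the vector field `|x|⁻⁴ x` is divergence free away from `0`
(`extDeriv_flatTorsion`). For the right structure the fields `x ↦ q x` are parallel, the Christoffel
symbol is `-v x⁻¹ w`, and the torsion changes sign. On `N × (ℍ ∖ {0})` the Bismut connection of
either structure is the sum of the Levi-Civita connection of `N`, for which the complex structures
of `N` are parallel, and of this flat connection.

All these tensors are invariant under `(p, x) ↦ (ψ^k p, 2^k x)`: the powers of `ψ` are
hyperkähler isometries, and the flat tensors are homogeneous of the right degree. The fibres of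
`torusProj` are the orbits of this action (`exists_zpow_of_torusProj_eq`), so the tensors descend,
pointwise, to `N_ψ × S³` (`IsHyperkahlerIsometry.exists_deck`). The projection `torusProj` is a
local diffeomorphism (`isLocalDiffeomorph_torusProj`), so a chart `φ` of `N` yields charts
`(p, x) ↦ (φ p, x)` of `N_ψ × S³` (`exists_isAdaptedChart`) in which the descended tensors are
given by the expected formulas; smoothness, integrability and closedness are read there.

Connections are not descended: a connection is obtained by prescribing, at each point separately, a
Christoffel symbol in a chart around this point (`exists_connection_of_christoffel`), since the
Leibniz rule is a pointwise condition. That a connection preserves a metric or an endomorphism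
field, and the value of its torsion, are pointwise identities on its Christoffel symbols, and these
identities hold for the sum of two Christoffel symbols as soon as they hold for both
(`exists_isBismutConnection`).
-/

noncomputable section

open scoped Topology
open VectorField

namespace HKT

/-! ### Smooth charts with values in a normed space -/

section Charts

variable {E : Type*} [NormedAddCommGroup E] [NormedSpace ℝ E]
  {H : Type*} [TopologicalSpace H] {I : ModelWithCorners ℝ E H}
  {M : Type*} [TopologicalSpace M] [ChartedSpace H M]
  {F : Type*} [NormedAddCommGroup F] [NormedSpace ℝ F]

/-- A local homeomorphism from `M` to a normed space `F` which is smooth in both directions. -/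
structure IsSmoothChart (I : ModelWithCorners ℝ E H) (φ : OpenPartialHomeomorph M F) : Prop where
  contMDiffOn : ContMDiffOn I 𝓘(ℝ, F) ∞ φ φ.source
  contMDiffOn_symm : ContMDiffOn 𝓘(ℝ, F) I ∞ φ.symm φ.target

/-- The differential of a chart at a point of `M`. -/
abbrev dChart (I : ModelWithCorners ℝ E H) (φ : OpenPartialHomeomorph M F) (y : M) :
    TangentSpace I y →L[ℝ] F :=
  mfderiv I 𝓘(ℝ, F) φ y

/-- The differential of the inverse of a chart at a point of the model space. -/
abbrev dChartSymm (I : ModelWithCorners ℝ E H) (φ : OpenPartialHomeomorph M F) (z : F) :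
    F →L[ℝ] TangentSpace I (φ.symm z) :=
  mfderiv 𝓘(ℝ, F) I φ.symm z

namespace IsSmoothChart

variable {φ : OpenPartialHomeomorph M F} (hφ : IsSmoothChart I φ)
include hφ

theorem contMDiffAt {y : M} (hy : y ∈ φ.source) : ContMDiffAt I 𝓘(ℝ, F) ∞ φ y :=
  hφ.contMDiffOn.contMDiffAt (φ.open_source.mem_nhds hy)

theorem contMDiffAt_symm {z : F} (hz : z ∈ φ.target) : ContMDiffAt 𝓘(ℝ, F) I ∞ φ.symm z :=
  hφ.contMDiffOn_symm.contMDiffAt (φ.open_target.mem_nhds hz)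

theorem mdifferentiableAt {y : M} (hy : y ∈ φ.source) : MDifferentiableAt I 𝓘(ℝ, F) φ y :=
  (hφ.contMDiffAt hy).mdifferentiableAt (by simp)

theorem mdifferentiableAt_symm {z : F} (hz : z ∈ φ.target) :
    MDifferentiableAt 𝓘(ℝ, F) I φ.symm z :=
  (hφ.contMDiffAt_symm hz).mdifferentiableAt (by simp)

theorem dChart_dChartSymm {z : F} (hz : z ∈ φ.target) (a : F) :
    dChart I φ (φ.symm z) (dChartSymm I φ z a) = a := by
  have h1 := mfderiv_comp z (hφ.mdifferentiableAt (φ.map_target hz)) (hφ.mdifferentiableAt_symm hz)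
  have h2 : mfderiv 𝓘(ℝ, F) 𝓘(ℝ, F) (φ ∘ φ.symm) z = ContinuousLinearMap.id ℝ _ := by
    rw [← mfderiv_id (I := 𝓘(ℝ, F)) (x := z)]
    apply Filter.EventuallyEq.mfderiv_eq
    filter_upwards [φ.open_target.mem_nhds hz] with w hw using φ.right_inv hw
  rw [h2] at h1
  exact (DFunLike.congr_fun h1 a).symm

theorem dChartSymm_dChart {y : M} (hy : y ∈ φ.source) (v : TangentSpace I y) :
    (dChartSymm I φ (φ y) (dChart I φ y v) : E) = v := by
  have h0 : MDifferentiableAt 𝓘(ℝ, F) I φ.symm (φ y) :=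
    hφ.mdifferentiableAt_symm (φ.map_source hy)
  have h1 := mfderiv_comp y h0 (hφ.mdifferentiableAt hy)
  have h2 : mfderiv I I (φ.symm ∘ φ) y = ContinuousLinearMap.id ℝ _ := by
    rw [← mfderiv_id (I := I) (x := y)]
    apply Filter.EventuallyEq.mfderiv_eq
    filter_upwards [φ.open_source.mem_nhds hy] with w hw using φ.left_inv hw
  rw [h2] at h1
  exact (DFunLike.congr_fun h1 v).symm

theorem dChart_injective {y : M} (hy : y ∈ φ.source) {u v : TangentSpace I y}
    (h : dChart I φ y u = dChart I φ y v) : u = v := by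
  have h1 := hφ.dChartSymm_dChart hy u
  rw [h] at h1
  exact h1.symm.trans (hφ.dChartSymm_dChart hy v)

theorem dChart_surjective {y : M} (hy : y ∈ φ.source) (a : F) :
    ∃ v : TangentSpace I y, dChart I φ y v = a := by
  have h := hφ.dChart_dChartSymm (φ.map_source hy) a
  rw [φ.left_inv hy] at h
  exact ⟨_, h⟩

end IsSmoothChart

/-- The differential of a chart, as a continuous linear equivalence. -/
def dChartEquiv {φ : OpenPartialHomeomorph M F} (hφ : IsSmoothChart I φ) {y : M}
    (hy : y ∈ φ.source) : TangentSpace I y ≃L[ℝ] F :=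
  ContinuousLinearEquiv.equivOfInverse (dChart I φ y) (dChartSymm I φ (φ y))
    (hφ.dChartSymm_dChart hy) (fun a ↦ by
      have h := hφ.dChart_dChartSymm (φ.map_source hy) a
      rwa [φ.left_inv hy] at h)

end Charts

/-! ### Vector fields in a chart -/

section Charts

variable {E : Type*} [NormedAddCommGroup E] [NormedSpace ℝ E]
  {H : Type*} [TopologicalSpace H] {I : ModelWithCorners ℝ E H}
  {M : Type*} [TopologicalSpace M] [ChartedSpace H M]
  {F : Type*} [NormedAddCommGroup F] [NormedSpace ℝ F]

/-- A vector field on `M` read in a chart, as a map of the model space into itself. -/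
def fieldInChart (I : ModelWithCorners ℝ E H) (φ : OpenPartialHomeomorph M F)
    (Y : (y : M) → TangentSpace I y) (z : F) : F :=
  dChart I φ (φ.symm z) (Y (φ.symm z))

/-- The vector field whose expression in the chart `φ` is `W`. It has this meaning on the source of
`φ` only. -/
def fieldOfChart (I : ModelWithCorners ℝ E H) (φ : OpenPartialHomeomorph M F) (W : F → F)
    (y : M) : TangentSpace I y :=
  mpullback I 𝓘(ℝ, F) φ (W : (z : F) → TangentSpace 𝓘(ℝ, F) z) y

namespace IsSmoothChart

variable {φ : OpenPartialHomeomorph M F} (hφ : IsSmoothChart I φ)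
include hφ

theorem isInvertible_dChart {y : M} (hy : y ∈ φ.source) :
    (mfderiv I 𝓘(ℝ, F) φ y).IsInvertible := ⟨dChartEquiv hφ hy, rfl⟩

theorem inverse_dChart_apply {y : M} (hy : y ∈ φ.source) (a : F) :
    dChart I φ y ((mfderiv I 𝓘(ℝ, F) φ y).inverse a) = a :=
  (hφ.isInvertible_dChart hy).self_apply_inverse a

theorem inverse_dChartSymm {z : F} (hz : z ∈ φ.target) :
    (mfderiv 𝓘(ℝ, F) I φ.symm z).IsInvertible ∧
      ∀ v, (mfderiv 𝓘(ℝ, F) I φ.symm z).inverse v = dChart I φ (φ.symm z) v := by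
  have h1 : ∀ v : TangentSpace I (φ.symm z),
      dChartSymm I φ z (dChart I φ (φ.symm z) v) = v := fun v ↦ by
    apply hφ.dChart_injective (φ.map_target hz)
    rw [hφ.dChart_dChartSymm hz]
  let e : F ≃L[ℝ] TangentSpace I (φ.symm z) :=
    ContinuousLinearEquiv.equivOfInverse (dChartSymm I φ z) (dChart I φ (φ.symm z))
      (hφ.dChart_dChartSymm hz) h1
  have he : (mfderiv 𝓘(ℝ, F) I φ.symm z) = (e : F →L[ℝ] TangentSpace I (φ.symm z)) := rfl
  refine ⟨⟨e, rfl⟩, fun v ↦ ?_⟩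
  rw [he]
  exact DFunLike.congr_fun (ContinuousLinearMap.inverse_equiv e) v

theorem fieldInChart_fieldOfChart (W : F → F) {z : F} (hz : z ∈ φ.target) :
    fieldInChart I φ (fieldOfChart I φ W) z = W z := by
  exact (hφ.inverse_dChart_apply (φ.map_target hz) _).trans (congrArg W (φ.right_inv hz))

theorem dChart_fieldOfChart (W : F → F) {y : M} (hy : y ∈ φ.source) :
    dChart I φ y (fieldOfChart I φ W y) = W (φ y) :=
  hφ.inverse_dChart_apply hy _

/-- The expression of a field in a chart is its pullback by the inverse of the chart. -/
theorem fieldInChart_eq_mpullback (Y : (y : M) → TangentSpace I y) {z : F} (hz : z ∈ φ.target) :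
    fieldInChart I φ Y z = mpullback 𝓘(ℝ, F) I φ.symm Y z :=
  ((hφ.inverse_dChartSymm hz).2 _).symm

end IsSmoothChart

theorem two_le_infty : (2 : WithTop ℕ∞) ≤ ∞ := ENat.LEInfty.out

theorem mdifferentiableAt_vectorSpace_iff {W : F → F} {z : F} :
    MDifferentiableAt 𝓘(ℝ, F) 𝓘(ℝ, F).tangent
      (fun y ↦ (⟨y, W y⟩ : TangentBundle 𝓘(ℝ, F) F)) z ↔ DifferentiableAt ℝ W z := by
  rw [mdifferentiableAt_totalSpace]
  constructor
  · intro h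
    have := h.2.differentiableAt
    simpa using! this
  · intro h
    refine ⟨mdifferentiableAt_id, ?_⟩
    have := h.mdifferentiableAt
    convert! this using 1
    ext y
    simp

namespace IsSmoothChart
variable [IsManifold I ∞ M]
variable {φ : OpenPartialHomeomorph M F} (hφ : IsSmoothChart I φ)
include hφ

theorem differentiableAt_fieldInChart [CompleteSpace F] {Y : (y : M) → TangentSpace I y} {x : M}
    (hx : x ∈ φ.source)
    (hY : MDifferentiableAt I I.tangent (fun y ↦ (Y y : TangentBundle I M)) x) :
    DifferentiableAt ℝ (fieldInChart I φ Y) (φ x) := by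
  have hz := φ.map_source hx
  have h1 := MDifferentiableAt.mpullback_vectorField (f := φ.symm) (x₀ := φ x) (V := Y) (n := ∞)
    (by rw [φ.left_inv hx]; exact hY) (hφ.contMDiffAt_symm hz) (hφ.inverse_dChartSymm hz).1
    two_le_infty
  refine (mdifferentiableAt_vectorSpace_iff.1 h1).congr_of_eventuallyEq ?_
  filter_upwards [φ.open_target.mem_nhds hz] with w hw using hφ.fieldInChart_eq_mpullback Y hw

theorem mdifferentiableAt_fieldOfChart [CompleteSpace E] {W : F → F} {x : M} (hx : x ∈ φ.source)
    (hW : DifferentiableAt ℝ W (φ x)) :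
    MDifferentiableAt I I.tangent
      (fun y ↦ (fieldOfChart I φ W y : TangentBundle I M)) x := by
  exact MDifferentiableAt.mpullback_vectorField (f := φ) (x₀ := x) (n := ∞)
    (mdifferentiableAt_vectorSpace_iff.2 hW) (hφ.contMDiffAt hx) (hφ.isInvertible_dChart hx)
    two_le_infty

theorem mlieBracket_fieldOfChart_const [CompleteSpace E] [CompleteSpace F] {x : M}
    (hx : x ∈ φ.source) (a b : F) :
    mlieBracket I (fieldOfChart I φ fun _ ↦ a) (fieldOfChart I φ fun _ ↦ b) x = 0 := by
  have : IsManifold I (minSmoothness ℝ 2) M := by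
    rw [minSmoothness_of_isRCLikeNormedField]; infer_instance
  have h := mpullback_mlieBracket (I := I) (I' := 𝓘(ℝ, F)) (f := φ) (x₀ := x) (n := ∞)
    (V := fun _ ↦ a) (W := fun _ ↦ b)
    (mdifferentiableAt_vectorSpace_iff.2 (differentiableAt_const a))
    (mdifferentiableAt_vectorSpace_iff.2 (differentiableAt_const b)) (hφ.contMDiffAt hx)
    (by rw [minSmoothness_of_isRCLikeNormedField]; exact two_le_infty)
  refine h.symm.trans ?_
  have h0 : mlieBracket 𝓘(ℝ, F) (fun _ : F ↦ a) (fun _ ↦ b) (φ x) = 0 := by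
    have h1 : ∀ V W : (z : F) → TangentSpace 𝓘(ℝ, F) z,
        mlieBracket 𝓘(ℝ, F) V W (φ x) = lieBracket ℝ (V : F → F) (W : F → F) (φ x) := by
      intro V W
      rw [← mlieBracketWithin_univ, mlieBracketWithin_eq_lieBracketWithin]
      exact congrFun lieBracketWithin_univ (φ x)
    have h2 : lieBracket ℝ (fun _ : F ↦ a) (fun _ ↦ b) (φ x) = 0 := by simp [lieBracket]
    exact (h1 _ _).trans h2
  refine (congrArg (mfderiv I 𝓘(ℝ, F) φ x).inverse h0).trans (map_zero _)

end IsSmoothChart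

end Charts

/-! ### Connections with prescribed Christoffel symbols -/

section Connections

variable {E : Type*} [NormedAddCommGroup E] [NormedSpace ℝ E]
  {H : Type*} [TopologicalSpace H] {I : ModelWithCorners ℝ E H}
  {M : Type*} [TopologicalSpace M] [ChartedSpace H M]
  {F : Type*} [NormedAddCommGroup F] [NormedSpace ℝ F]

/-- The operator on vector fields whose value at each point `x` is, in the chart `φ x`, the
covariant derivative with Christoffel symbol `Γ x`. No relation between the symbols at distinct
points is required. -/
def chartDerivative {φ : M → OpenPartialHomeomorph M F} (hφ : ∀ x, IsSmoothChart I (φ x))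
    (hx : ∀ x, x ∈ (φ x).source) (Γ : M → F →L[ℝ] F →L[ℝ] F)
    (Y : (y : M) → TangentSpace I y) (x : M) : TangentSpace I x →L[ℝ] TangentSpace I x :=
  ((dChartEquiv (hφ x) (hx x)).symm : F →L[ℝ] TangentSpace I x) ∘L
    (fderiv ℝ (fieldInChart I (φ x) Y) (φ x x) + (Γ x).flip (dChart I (φ x) x (Y x))) ∘L
      dChart I (φ x) x

theorem dChart_chartDerivative {φ : M → OpenPartialHomeomorph M F}
    (hφ : ∀ x, IsSmoothChart I (φ x)) (hx : ∀ x, x ∈ (φ x).source) (Γ : M → F →L[ℝ] F →L[ℝ] F)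
    (Y : (y : M) → TangentSpace I y) (x : M) (v : TangentSpace I x) :
    dChart I (φ x) x (chartDerivative hφ hx Γ Y x v) =
      fderiv ℝ (fieldInChart I (φ x) Y) (φ x x) (dChart I (φ x) x v) +
        Γ x (dChart I (φ x) x v) (dChart I (φ x) x (Y x)) :=
  (dChartEquiv (hφ x) (hx x)).apply_symm_apply _

variable [IsManifold I ∞ M]

/-- The connection `D` has the Christoffel symbol `Γ` at the point `x` in the chart `φ`, that is,
`∇_v Y` is represented at `x` by `dY(v) + Γ(v, Y)`. -/
def HasChristoffelAt (D : Connection I M) (φ : OpenPartialHomeomorph M F) (x : M)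
    (Γ : F →L[ℝ] F →L[ℝ] F) : Prop :=
  ∀ Y : (y : M) → TangentSpace I y,
    MDifferentiableAt I I.tangent (fun y ↦ (Y y : TangentBundle I M)) x →
    ∀ v : TangentSpace I x, dChart I φ x (D Y x v) =
      fderiv ℝ (fieldInChart I φ Y) (φ x) (dChart I φ x v) +
        Γ (dChart I φ x v) (dChart I φ x (Y x))

theorem isCovariantDerivativeOn_chartDerivative [CompleteSpace F]
    {φ : M → OpenPartialHomeomorph M F}
    (hφ : ∀ x, IsSmoothChart I (φ x)) (hx : ∀ x, x ∈ (φ x).source) (Γ : M → F →L[ℝ] F →L[ℝ] F) :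
    IsCovariantDerivativeOn E (chartDerivative hφ hx Γ) := by
  constructor
  · intro Y Z x hY hZ _
    ext v
    apply (hφ x).dChart_injective (hx x)
    rw [dChart_chartDerivative, add_apply, map_add (dChart I (φ x) x),
      dChart_chartDerivative, dChart_chartDerivative]
    have h1 : fieldInChart I (φ x) (Y + Z) =
        fun z ↦ fieldInChart I (φ x) Y z + fieldInChart I (φ x) Z z := by
      funext z
      exact map_add (dChart I (φ x) ((φ x).symm z)) _ _
    have h2 : dChart I (φ x) x ((Y + Z) x) = dChart I (φ x) x (Y x) + dChart I (φ x) x (Z x) :=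
      map_add (dChart I (φ x) x) _ _
    rw [h1, h2, fderiv_fun_add ((hφ x).differentiableAt_fieldInChart (hx x) hY)
      ((hφ x).differentiableAt_fieldInChart (hx x) hZ), map_add, add_apply]
    abel
  · intro Y f x hY hf _
    ext v
    apply (hφ x).dChart_injective (hx x)
    set f' : F → ℝ := f ∘ (φ x).symm with hf'
    have hz := (φ x).map_source (hx x)
    have hs := (hφ x).mdifferentiableAt_symm hz
    have hfx : MDifferentiableAt I 𝓘(ℝ, ℝ) f ((φ x).symm (φ x x)) := by
      rw [(φ x).left_inv (hx x)]; exact hf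
    have hf'd : DifferentiableAt ℝ f' (φ x x) := (hfx.comp _ hs).differentiableAt
    have h1 : fieldInChart I (φ x) (f • Y) =
        fun z ↦ f' z • fieldInChart I (φ x) Y z := by
      funext z
      exact map_smul (dChart I (φ x) ((φ x).symm z)) _ _
    have h2 : dChart I (φ x) x ((f • Y) x) = f x • dChart I (φ x) x (Y x) :=
      map_smul (dChart I (φ x) x) _ _
    have h3 : f' (φ x x) = f x := by simp [hf', (φ x).left_inv (hx x)]
    have h4 : fieldInChart I (φ x) Y (φ x x) = dChart I (φ x) x (Y x) := by
      unfold fieldInChart; rw [(φ x).left_inv (hx x)]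
    have h5 : fderiv ℝ f' (φ x x) (dChart I (φ x) x v) = mfderiv I 𝓘(ℝ, ℝ) f x v := by
      have e : MDifferentiableAt 𝓘(ℝ, F) 𝓘(ℝ, ℝ) f' (φ x x) := hf'd.mdifferentiableAt
      have h := mfderiv_comp x e ((hφ x).mdifferentiableAt (hx x))
      have h' : mfderiv I 𝓘(ℝ, ℝ) (f' ∘ φ x) x = mfderiv I 𝓘(ℝ, ℝ) f x := by
        apply Filter.EventuallyEq.mfderiv_eq
        filter_upwards [(φ x).open_source.mem_nhds (hx x)] with w hw
        simp [hf', (φ x).left_inv hw]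
      rw [mfderiv_eq_fderiv] at h
      exact (DFunLike.congr_fun h v).symm.trans (DFunLike.congr_fun h' v)
    rw [dChart_chartDerivative, h1, h2, fderiv_fun_smul hf'd
      ((hφ x).differentiableAt_fieldInChart (hx x) hY), h3, h4]
    have h6 : dChart I (φ x) x
        ((f x • chartDerivative hφ hx Γ Y x + (d% f x).smulRight (Y x)) v) =
        f x • dChart I (φ x) x (chartDerivative hφ hx Γ Y x v) +
          (d% f x v) • dChart I (φ x) x (Y x) := by
      rw [add_apply, map_add (dChart I (φ x) x)]
      congr 1
      · exact map_smul (dChart I (φ x) x) _ _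
      · exact map_smul (dChart I (φ x) x) _ _
    rw [h6, dChart_chartDerivative]
    have h7 : (d% f x v) = fderiv ℝ f' (φ x x) (dChart I (φ x) x v) := h5.symm
    rw [h7]
    simp only [add_apply, smul_apply, ContinuousLinearMap.smulRight_apply, map_smul]
    module

/-- A connection may be prescribed by its Christoffel symbols in a chart around each point, chosen
independently at the different points, since additivity and the Leibniz rule are pointwise. -/
theorem exists_connection_of_christoffel [CompleteSpace F] {φ : M → OpenPartialHomeomorph M F}
    (hφ : ∀ x, IsSmoothChart I (φ x)) (hx : ∀ x, x ∈ (φ x).source) (Γ : M → F →L[ℝ] F →L[ℝ] F) :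
    ∃ D : Connection I M, ∀ x, HasChristoffelAt D (φ x) x (Γ x) :=
  ⟨⟨chartDerivative hφ hx Γ, isCovariantDerivativeOn_chartDerivative hφ hx Γ⟩,
    fun x Y _ v ↦ dChart_chartDerivative hφ hx Γ Y x v⟩

/-- Transport of a bilinear map along `e`, with its arguments swapped. -/
theorem exists_conj_bilinear (e : E ≃L[ℝ] F) (Δ : E →L[ℝ] E →L[ℝ] E) :
    ∃ Γ : F →L[ℝ] F →L[ℝ] F, ∀ v w, Γ (e v) (e w) = e (Δ w v) := by
  refine ⟨(((ContinuousLinearMap.compL ℝ F E F).flip (e.symm : F →L[ℝ] E)) ∘L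
    (ContinuousLinearMap.compL ℝ E E F (e : E →L[ℝ] F)) ∘L Δ ∘L (e.symm : F →L[ℝ] E)).flip, ?_⟩
  intro v w
  simp

/-- Every connection has Christoffel symbols: it differs from the derivative in the chart by a
tensor. -/
theorem exists_christoffel [FiniteDimensional ℝ E] [CompleteSpace F] (D : Connection I M)
    {φ : M → OpenPartialHomeomorph M F}
    (hφ : ∀ x, IsSmoothChart I (φ x)) (hx : ∀ x, x ∈ (φ x).source) (x : M) :
    ∃ Γ : F →L[ℝ] F →L[ℝ] F, HasChristoffelAt D (φ x) x Γ := by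
  -- `D'` is the derivative in the charts.
  set D' := chartDerivative hφ hx (fun _ ↦ (0 : F →L[ℝ] F →L[ℝ] F)) with hD'
  have h1 := isCovariantDerivativeOn_chartDerivative hφ hx (fun _ ↦ (0 : F →L[ℝ] F →L[ℝ] F))
  obtain ⟨Γ, hΓ⟩ := exists_conj_bilinear (E := E) (F := F) (dChartEquiv (hφ x) (hx x))
    (D.isCovariantDerivativeOnUniv.difference h1 x)
  refine ⟨Γ, fun Y hY v ↦ ?_⟩
  have h2 : D.isCovariantDerivativeOnUniv.difference h1 x (Y x) = D Y x - D' Y x :=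
    IsCovariantDerivativeOn.difference_apply D.isCovariantDerivativeOnUniv h1 (hσ := hY)
  have h3 : D Y x v = D' Y x v + D.isCovariantDerivativeOnUniv.difference h1 x (Y x) v := by
    rw [h2]; simp
  rw [h3, map_add (dChart I (φ x) x), hD', dChart_chartDerivative]
  exact congrArg₂ (· + ·) (by simp) (hΓ v (Y x)).symm

end Connections

/-! ### Parallel tensors and torsion in terms of Christoffel symbols -/

section Reps

variable {E : Type*} [NormedAddCommGroup E] [NormedSpace ℝ E]
  {H : Type*} [TopologicalSpace H] {I : ModelWithCorners ℝ E H}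
  {M : Type*} [TopologicalSpace M] [ChartedSpace H M]
  {F : Type*} [NormedAddCommGroup F] [NormedSpace ℝ F]

/-- Near `x`, the field of endomorphisms `A` is given by `Aφ` in the chart `φ`. -/
def EndRepAt (A : EndField I M) (φ : OpenPartialHomeomorph M F) (x : M) (Aφ : F → F →L[ℝ] F) :
    Prop :=
  ∀ᶠ y in 𝓝 x, ∀ u : TangentSpace I y, dChart I φ y (A y u) = Aφ (φ y) (dChart I φ y u)

/-- Near `x`, the field of bilinear forms `g` is given by `gφ` in the chart `φ`. -/
def BilinRepAt (g : (y : M) → TangentSpace I y →L[ℝ] TangentSpace I y →L[ℝ] ℝ)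
    (φ : OpenPartialHomeomorph M F) (x : M) (gφ : F → F →L[ℝ] F →L[ℝ] ℝ) : Prop :=
  ∀ᶠ y in 𝓝 x, ∀ u v : TangentSpace I y,
    g y u v = gφ (φ y) (dChart I φ y u) (dChart I φ y v)

variable [IsManifold I ∞ M]

namespace IsSmoothChart

variable [CompleteSpace F] {φ : OpenPartialHomeomorph M F} (hφ : IsSmoothChart I φ)
include hφ

omit hφ [IsManifold I ∞ M] [CompleteSpace F] in
theorem fieldInChart_apply_self {x : M} (hx : x ∈ φ.source) (Y : (y : M) → TangentSpace I y) :
    fieldInChart I φ Y (φ x) = dChart I φ x (Y x) := by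
  unfold fieldInChart; rw [φ.left_inv hx]

/-- The derivative of `g(Y, Z)` in a chart. The terms other than the first one combine with the
Christoffel symbol to give the compatibility with the metric. -/
theorem mfderiv_metric_apply {x : M} (hx : x ∈ φ.source) {g : SmoothMetric I M}
    {gφ : F → F →L[ℝ] F →L[ℝ] ℝ} (hg : BilinRepAt g.inner φ x gφ)
    (hgd : DifferentiableAt ℝ gφ (φ x))
    {Y Z : (y : M) → TangentSpace I y}
    (hY : MDifferentiableAt I I.tangent (fun y ↦ (Y y : TangentBundle I M)) x)
    (hZ : MDifferentiableAt I I.tangent (fun y ↦ (Z y : TangentBundle I M)) x)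
    (v : TangentSpace I x) :
    (mfderiv I 𝓘(ℝ, ℝ) (fun y ↦ g.inner y (Y y) (Z y)) x v : ℝ) =
      fderiv ℝ gφ (φ x) (dChart I φ x v) (dChart I φ x (Y x)) (dChart I φ x (Z x)) +
      gφ (φ x) (fderiv ℝ (fieldInChart I φ Y) (φ x) (dChart I φ x v)) (dChart I φ x (Z x)) +
      gφ (φ x) (dChart I φ x (Y x)) (fderiv ℝ (fieldInChart I φ Z) (φ x) (dChart I φ x v)) := by
  have hYd := hφ.differentiableAt_fieldInChart hx hY
  have hZd := hφ.differentiableAt_fieldInChart hx hZ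
  have h1 : HasFDerivAt (fun z ↦ gφ z (fieldInChart I φ Y z) (fieldInChart I φ Z z)) _ (φ x) :=
    (hgd.hasFDerivAt.clm_apply hYd.hasFDerivAt).clm_apply hZd.hasFDerivAt
  have h2 : MDifferentiableAt 𝓘(ℝ, F) 𝓘(ℝ, ℝ)
      (fun z ↦ gφ z (fieldInChart I φ Y z) (fieldInChart I φ Z z)) (φ x) :=
    h1.differentiableAt.mdifferentiableAt
  have h3 := mfderiv_comp x h2 (hφ.mdifferentiableAt hx)
  have h4 : (fun y ↦ g.inner y (Y y) (Z y)) =ᶠ[𝓝 x]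
      (fun z ↦ gφ z (fieldInChart I φ Y z) (fieldInChart I φ Z z)) ∘ φ := by
    filter_upwards [hg, φ.open_source.mem_nhds hx] with y hy hys
    simp only [Function.comp_apply, fieldInChart_apply_self hys]
    exact hy _ _
  rw [mfderiv_eq_fderiv, h1.fderiv] at h3
  have h5 := DFunLike.congr_fun (h4.mfderiv_eq.trans h3) v
  refine h5.trans ?_
  have h6 := fieldInChart_apply_self hx Y
  have h7 := fieldInChart_apply_self hx Z
  rw [← h6, ← h7]
  change gφ (φ x) (fieldInChart I φ Y (φ x)) (fderiv ℝ (fieldInChart I φ Z) (φ x) (dChart I φ x v))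
    + (gφ (φ x) (fderiv ℝ (fieldInChart I φ Y) (φ x) (dChart I φ x v))
      (fieldInChart I φ Z (φ x)) +
    fderiv ℝ gφ (φ x) (dChart I φ x v) (fieldInChart I φ Y (φ x)) (fieldInChart I φ Z (φ x))) = _
  ring

omit [IsManifold I ∞ M] [CompleteSpace F] in
theorem fieldInChart_fieldOfChart_eventuallyEq {x : M} (hx : x ∈ φ.source) (W : F → F) :
    fieldInChart I φ (fieldOfChart I φ W) =ᶠ[𝓝 (φ x)] W := by
  filter_upwards [φ.open_target.mem_nhds (φ.map_source hx)] with z hz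
  exact hφ.fieldInChart_fieldOfChart W hz

omit [CompleteSpace F] in
theorem christoffel_const [CompleteSpace E] {x : M} (hx : x ∈ φ.source) {D : Connection I M}
    {Γ : F →L[ℝ] F →L[ℝ] F} (hD : HasChristoffelAt D φ x Γ) (a : F) (v : TangentSpace I x) :
    dChart I φ x (D (fieldOfChart I φ fun _ ↦ a) x v) = Γ (dChart I φ x v) a := by
  rw [hD _ (hφ.mdifferentiableAt_fieldOfChart hx (differentiableAt_const a)),
    (hφ.fieldInChart_fieldOfChart_eventuallyEq hx _).fderiv_eq, hφ.dChart_fieldOfChart _ hx]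
  simp

/-- For a metric connection, the derivatives of the coefficients of the metric are determined by the
Christoffel symbol. -/
theorem christoffel_metric [CompleteSpace E] {x : M} (hx : x ∈ φ.source) {g : SmoothMetric I M}
    {gφ : F → F →L[ℝ] F →L[ℝ] ℝ} (hg : BilinRepAt g.inner φ x gφ)
    (hgd : DifferentiableAt ℝ gφ (φ x))
    {D : Connection I M} {Γ : F →L[ℝ] F →L[ℝ] F} (hD : HasChristoffelAt D φ x Γ)
    (hDg : IsMetricConnection g D) (c a b : F) :
    fderiv ℝ gφ (φ x) c a b = gφ (φ x) (Γ c a) b + gφ (φ x) a (Γ c b) := by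
  obtain ⟨v, rfl⟩ := hφ.dChart_surjective hx c
  have hY := hφ.mdifferentiableAt_fieldOfChart hx (differentiableAt_const a)
  have hZ := hφ.mdifferentiableAt_fieldOfChart hx (differentiableAt_const b)
  have hgx := hg.self_of_nhds
  have h1 : @Eq ℝ _ _ := (hDg x _ _ hY hZ v).symm.trans
    (hφ.mfderiv_metric_apply hx hg hgd hY hZ v)
  rw [(hφ.fieldInChart_fieldOfChart_eventuallyEq hx _).fderiv_eq,
    (hφ.fieldInChart_fieldOfChart_eventuallyEq hx _).fderiv_eq, hφ.dChart_fieldOfChart _ hx,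
    hφ.dChart_fieldOfChart _ hx, hgx (D _ x v), hgx _ (D _ x v), hφ.christoffel_const hx hD,
    hφ.christoffel_const hx hD, hφ.dChart_fieldOfChart _ hx, hφ.dChart_fieldOfChart _ hx] at h1
  simpa using h1.symm

/-- Converse of `christoffel_metric`, at a single point: the identity on the Christoffel symbol at
`x` implies the product rule for `g` at `x`. -/
theorem metric_of_christoffel {x : M} (hx : x ∈ φ.source) {g : SmoothMetric I M}
    {gφ : F → F →L[ℝ] F →L[ℝ] ℝ} (hg : BilinRepAt g.inner φ x gφ)
    (hgd : DifferentiableAt ℝ gφ (φ x))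
    {D : Connection I M} {Γ : F →L[ℝ] F →L[ℝ] F} (hD : HasChristoffelAt D φ x Γ)
    (h : ∀ c a b, fderiv ℝ gφ (φ x) c a b = gφ (φ x) (Γ c a) b + gφ (φ x) a (Γ c b))
    {Y Z : (y : M) → TangentSpace I y}
    (hY : MDifferentiableAt I I.tangent (fun y ↦ (Y y : TangentBundle I M)) x)
    (hZ : MDifferentiableAt I I.tangent (fun y ↦ (Z y : TangentBundle I M)) x)
    (v : TangentSpace I x) :
    (mfderiv I 𝓘(ℝ, ℝ) (fun y ↦ g.inner y (Y y) (Z y)) x v : ℝ) =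
      g.inner x (D Y x v) (Z x) + g.inner x (Y x) (D Z x v) := by
  have hgx := hg.self_of_nhds
  refine (hφ.mfderiv_metric_apply hx hg hgd hY hZ v).trans ?_
  change @Eq ℝ _ _
  rw [h, hgx (D Y x v), hgx _ (D Z x v), hD Y hY,
    hD Z hZ]
  simp only [map_add, add_apply]
  ring

theorem fderiv_end_apply {x : M} (hx : x ∈ φ.source) {A : EndField I M}
    {Aφ : F → F →L[ℝ] F} (hA : EndRepAt A φ x Aφ) (hAd : DifferentiableAt ℝ Aφ (φ x))
    {Y : (y : M) → TangentSpace I y}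
    (hY : MDifferentiableAt I I.tangent (fun y ↦ (Y y : TangentBundle I M)) x) (c : F) :
    fderiv ℝ (fieldInChart I φ fun y ↦ A y (Y y)) (φ x) c =
      fderiv ℝ Aφ (φ x) c (dChart I φ x (Y x)) +
        Aφ (φ x) (fderiv ℝ (fieldInChart I φ Y) (φ x) c) := by
  have hYd := hφ.differentiableAt_fieldInChart hx hY
  have h1 : HasFDerivAt (fun z ↦ Aφ z (fieldInChart I φ Y z)) _ (φ x) :=
    hAd.hasFDerivAt.clm_apply hYd.hasFDerivAt
  have h2 : (fieldInChart I φ fun y ↦ A y (Y y)) =ᶠ[𝓝 (φ x)]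
      fun z ↦ Aφ z (fieldInChart I φ Y z) := by
    have hc := φ.continuousAt_symm (φ.map_source hx)
    rw [ContinuousAt, φ.left_inv hx] at hc
    filter_upwards [hc.eventually hA, φ.open_target.mem_nhds (φ.map_source hx)] with z hz hzt
    unfold fieldInChart
    rw [hz, φ.right_inv hzt]
  rw [h2.fderiv_eq, h1.fderiv, ← fieldInChart_apply_self hx Y]
  simp [add_comm]

theorem mdifferentiableAt_end_apply [CompleteSpace E] {x : M} (hx : x ∈ φ.source)
    {A : EndField I M} {Aφ : F → F →L[ℝ] F} (hA : EndRepAt A φ x Aφ)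
    (hAd : DifferentiableAt ℝ Aφ (φ x)) {Y : (y : M) → TangentSpace I y}
    (hY : MDifferentiableAt I I.tangent (fun y ↦ (Y y : TangentBundle I M)) x) :
    MDifferentiableAt I I.tangent (fun y ↦ (A y (Y y) : TangentBundle I M)) x := by
  have hYd := hφ.differentiableAt_fieldInChart hx hY
  have h1 : DifferentiableAt ℝ (fun z ↦ Aφ z (fieldInChart I φ Y z)) (φ x) :=
    hAd.clm_apply hYd
  refine (hφ.mdifferentiableAt_fieldOfChart hx h1).congr_of_eventuallyEq ?_
  filter_upwards [hA, φ.open_source.mem_nhds hx] with y hy hys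
  congr 1
  apply hφ.dChart_injective hys
  rw [hφ.dChart_fieldOfChart _ hys, hy, fieldInChart_apply_self hys]

/-- An endomorphism field is parallel only if the Christoffel symbol satisfies
`dA(c) + [Γ(c, ·), A] = 0`. -/
theorem christoffel_parallel [CompleteSpace E] {x : M} (hx : x ∈ φ.source) {A : EndField I M}
    {Aφ : F → F →L[ℝ] F} (hA : EndRepAt A φ x Aφ) (hAd : DifferentiableAt ℝ Aφ (φ x))
    {D : Connection I M} {Γ : F →L[ℝ] F →L[ℝ] F} (hD : HasChristoffelAt D φ x Γ)
    (hDA : IsParallelEnd A D) (c a : F) :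
    fderiv ℝ Aφ (φ x) c a + Γ c (Aφ (φ x) a) = Aφ (φ x) (Γ c a) := by
  obtain ⟨v, rfl⟩ := hφ.dChart_surjective hx c
  have hY := hφ.mdifferentiableAt_fieldOfChart hx (differentiableAt_const a)
  have h1 := hD _ (hφ.mdifferentiableAt_end_apply hx hA hAd hY) v
  rw [hDA x _ hY, hφ.fderiv_end_apply hx hA hAd hY, hA.self_of_nhds, hA.self_of_nhds,
    hφ.christoffel_const hx hD, hφ.dChart_fieldOfChart _ hx,
    (hφ.fieldInChart_fieldOfChart_eventuallyEq hx _).fderiv_eq] at h1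
  simpa using h1.symm

/-- Converse of `christoffel_parallel`, at a single point. -/
theorem parallel_of_christoffel [CompleteSpace E] {x : M} (hx : x ∈ φ.source) {A : EndField I M}
    {Aφ : F → F →L[ℝ] F} (hA : EndRepAt A φ x Aφ) (hAd : DifferentiableAt ℝ Aφ (φ x))
    {D : Connection I M} {Γ : F →L[ℝ] F →L[ℝ] F} (hD : HasChristoffelAt D φ x Γ)
    (h : ∀ c a, fderiv ℝ Aφ (φ x) c a + Γ c (Aφ (φ x) a) = Aφ (φ x) (Γ c a))
    {Y : (y : M) → TangentSpace I y}
    (hY : MDifferentiableAt I I.tangent (fun y ↦ (Y y : TangentBundle I M)) x)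
    (v : TangentSpace I x) : D (fun y ↦ A y (Y y)) x v = A x (D Y x v) := by
  apply hφ.dChart_injective hx
  rw [hD _ (hφ.mdifferentiableAt_end_apply hx hA hAd hY) v, hφ.fderiv_end_apply hx hA hAd hY,
    hA.self_of_nhds, hA.self_of_nhds, hD Y hY, map_add, ← h]
  abel

/-- The torsion is the antisymmetrization of the Christoffel symbol, because constant fields in a
chart commute. -/
theorem torsion_christoffel [FiniteDimensional ℝ E] {x : M} (hx : x ∈ φ.source)
    {D : Connection I M} {Γ : F →L[ℝ] F →L[ℝ] F} (hD : HasChristoffelAt D φ x Γ)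
    (u v : TangentSpace I x) :
    haveI := FiniteDimensional.complete ℝ E
    dChart I φ x (D.torsion x u v) =
      Γ (dChart I φ x u) (dChart I φ x v) - Γ (dChart I φ x v) (dChart I φ x u) := by
  have := FiniteDimensional.complete ℝ E
  set a := dChart I φ x u with ha
  set b := dChart I φ x v with hb
  have hY := hφ.mdifferentiableAt_fieldOfChart hx (differentiableAt_const a)
  have hZ := hφ.mdifferentiableAt_fieldOfChart hx (differentiableAt_const b)
  have h1 := D.torsion_apply hY hZ
  have hu : fieldOfChart I φ (fun _ ↦ a) x = u :=
    hφ.dChart_injective hx (hφ.dChart_fieldOfChart _ hx)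
  have hv : fieldOfChart I φ (fun _ ↦ b) x = v :=
    hφ.dChart_injective hx (hφ.dChart_fieldOfChart _ hx)
  rw [hφ.mlieBracket_fieldOfChart_const hx, hu, hv, sub_zero] at h1
  rw [h1, map_sub, hφ.christoffel_const hx hD, hφ.christoffel_const hx hD]

end IsSmoothChart
end Reps

/-! ### Smoothness of tensor fields in terms of charts -/

section Smoothness

variable {E : Type*} [NormedAddCommGroup E] [NormedSpace ℝ E]
  {H : Type*} [TopologicalSpace H] {I : ModelWithCorners ℝ E H}
  {M : Type*} [TopologicalSpace M] [ChartedSpace H M] [IsManifold I ∞ M]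
  {F : Type*} [NormedAddCommGroup F] [NormedSpace ℝ F]

theorem contDiff_clm_flip {V W : Type*} [NormedAddCommGroup V] [NormedSpace ℝ V]
    [NormedAddCommGroup W] [NormedSpace ℝ W] :
    ContDiff ℝ ∞ (fun B : V →L[ℝ] W →L[ℝ] ℝ ↦ B.flip) :=
  IsBoundedLinearMap.contDiff (f := fun B : V →L[ℝ] W →L[ℝ] ℝ ↦ B.flip)
    ⟨⟨fun a b ↦ a.flip_add b, fun c a ↦ a.flip_smul c⟩, 1, one_pos, fun a ↦ by simp⟩

theorem contDiff_bilinearComp {V W : Type*} [NormedAddCommGroup V] [NormedSpace ℝ V]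
    [NormedAddCommGroup W] [NormedSpace ℝ W] : ContDiff ℝ ∞
      (fun p : (W →L[ℝ] W →L[ℝ] ℝ) × (V →L[ℝ] W) ↦ p.1.bilinearComp p.2 p.2) :=
  contDiff_clm_flip.comp ((contDiff_clm_flip.comp
    (contDiff_fst.clm_comp contDiff_snd)).clm_comp contDiff_snd)

/-- The differential of the chart `φ` at points near `x`, read in the preferred trivialization of
the tangent bundle at `x`. -/
def frameOfChart (I : ModelWithCorners ℝ E H) [IsManifold I ∞ M] (φ : OpenPartialHomeomorph M F)
    (x y : M) : E →L[ℝ] F :=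
  dChart I φ y ∘L (trivializationAt E (TangentSpace I : M → Type _) x).symmL ℝ y

namespace IsSmoothChart

variable {φ : OpenPartialHomeomorph M F} (hφ : IsSmoothChart I φ) {x : M} (hx : x ∈ φ.source)
include hφ hx

theorem contMDiffAt_frameOfChart : ContMDiffAt I 𝓘(ℝ, E →L[ℝ] F) ∞ (frameOfChart I φ x) x := by
  have h := (hφ.contMDiffAt hx).mfderiv_const (m := ∞) (by simp)
  refine h.congr_of_eventuallyEq (Filter.Eventually.of_forall fun y ↦ ?_)
  unfold inTangentCoordinates ContinuousLinearMap.inCoordinates frameOfChart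
  ext v
  simp
  rfl

/-- Near `x` the frame is invertible, and together with the chart it determines the preferred
trivialization. -/
theorem frameOfChart_eventually : ∀ᶠ y in 𝓝 x, ∃ e : E ≃L[ℝ] F,
    frameOfChart I φ x y = e ∧ (∀ a, dChart I φ y
      ((trivializationAt E (TangentSpace I : M → Type _) x).symmL ℝ y a) = e a) ∧
      (∀ v : TangentSpace I y,
      (trivializationAt E (TangentSpace I : M → Type _) x).continuousLinearMapAt ℝ y v =
        e.symm (dChart I φ y v)) := by
  set T := trivializationAt E (TangentSpace I : M → Type _) x with hT
  filter_upwards [φ.open_source.mem_nhds hx, T.open_baseSet.mem_nhds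
    (FiberBundle.mem_baseSet_trivializationAt' x)] with y hy hyT
  have h1 : ∀ a, (T.continuousLinearEquivAt ℝ y hyT).symm a = T.symmL ℝ y a :=
    fun a ↦ congrFun (T.symm_continuousLinearEquivAt_eq hyT) a
  have h2 : ∀ v, T.continuousLinearEquivAt ℝ y hyT v = T.continuousLinearMapAt ℝ y v :=
    fun v ↦ congrFun (T.coe_continuousLinearEquivAt_eq hyT) v
  have h3 : ∀ a, dChart I φ y (T.symmL ℝ y a) =
      dChartEquiv hφ hy ((T.continuousLinearEquivAt ℝ y hyT).symm a) := fun a ↦ by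
    rw [h1]; rfl
  refine ⟨((T.continuousLinearEquivAt ℝ y hyT).symm.trans (dChartEquiv hφ hy) : E ≃L[ℝ] F),
    ContinuousLinearMap.ext h3, h3, fun v ↦ ?_⟩
  rw [← h2]
  exact congrArg (T.continuousLinearEquivAt ℝ y hyT)
    ((dChartEquiv hφ hy).symm_apply_apply v).symm

theorem contMDiffAt_inverse_frameOfChart [CompleteSpace E] :
    ContMDiffAt I 𝓘(ℝ, F →L[ℝ] E) ∞ (fun y ↦ (frameOfChart I φ x y).inverse) x := by
  obtain ⟨e, he, -⟩ := (hφ.frameOfChart_eventually hx).self_of_nhds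
  have h := contDiffAt_map_inverse (𝕜 := ℝ) (n := ∞) e
  rw [← he] at h
  exact h.contMDiffAt.comp x (hφ.contMDiffAt_frameOfChart hx)

/-- An endomorphism field with smooth coefficients in a chart is smooth. -/
theorem contMDiffAt_end [CompleteSpace E] {A : EndField I M} {Aφ : F → F →L[ℝ] F}
    (hA : EndRepAt A φ x Aφ) (hAs : ContDiffAt ℝ ∞ Aφ (φ x)) :
    ContMDiffAt I (I.prod 𝓘(ℝ, E →L[ℝ] E)) ∞
    (fun x ↦ TotalSpace.mk' (E →L[ℝ] E)
      (E := fun y : M ↦ TangentSpace I y →L[ℝ] TangentSpace I y) x (A x)) x := by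
  rw [contMDiffAt_hom_bundle]
  refine ⟨contMDiffAt_id, ?_⟩
  have h1 : ContMDiffAt I 𝓘(ℝ, F →L[ℝ] F) ∞ (fun y ↦ Aφ (φ y)) x :=
    hAs.contMDiffAt.comp x (hφ.contMDiffAt hx)
  have h2 := (hφ.contMDiffAt_inverse_frameOfChart hx).clm_comp
    (h1.clm_comp (hφ.contMDiffAt_frameOfChart hx))
  refine h2.congr_of_eventuallyEq ?_
  filter_upwards [hφ.frameOfChart_eventually hx, hA] with y ⟨e, he, he1, he2⟩ hAy
  ext a
  have h3 : ContinuousLinearMap.inverse (frameOfChart I φ x y) = e.symm := by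
    rw [he, ContinuousLinearMap.inverse_equiv]
  have h4 : frameOfChart I φ x y a = e a := by rw [he]; rfl
  refine (he2 _).trans ?_
  rw [ContinuousLinearMap.comp_apply, h3, ContinuousLinearMap.comp_apply, h4]
  exact congrArg e.symm ((hAy _).trans (congrArg (Aφ (φ y)) (he1 a)))

/-- A smooth endomorphism field has smooth coefficients in every chart. -/
theorem exists_endRep [CompleteSpace E] {A : EndField I M} (hA : IsSmoothEndField A) :
    ∃ Aφ : F → F →L[ℝ] F, ContDiffAt ℝ ∞ Aφ (φ x) ∧ EndRepAt A φ x Aφ := by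
  have h0 := hA x
  rw [contMDiffAt_hom_bundle] at h0
  have h2 := (hφ.contMDiffAt_frameOfChart hx).clm_comp
    (h0.2.clm_comp (hφ.contMDiffAt_inverse_frameOfChart hx))
  have hs : ContMDiffAt 𝓘(ℝ, F) I ∞ φ.symm (φ x) := hφ.contMDiffAt_symm (φ.map_source hx)
  rw [← φ.left_inv hx] at h2
  have h3 := h2.comp (φ x) hs
  rw [φ.left_inv hx] at h3
  refine ⟨_, h3.contDiffAt, ?_⟩
  filter_upwards [hφ.frameOfChart_eventually hx, φ.open_source.mem_nhds hx]
    with y ⟨e, he, he1, he2⟩ hy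
  intro u
  have h3 : ContinuousLinearMap.inverse (frameOfChart I φ x y) = e.symm := by
    rw [he, ContinuousLinearMap.inverse_equiv]
  rw [Function.comp_apply, φ.left_inv hy, ContinuousLinearMap.comp_apply,
    ContinuousLinearMap.comp_apply, h3, he]
  have h5 : (trivializationAt E (TangentSpace I : M → Type _) x).symmL ℝ y
      (e.symm (dChart I φ y u)) = u := by
    apply hφ.dChart_injective hy
    rw [he1]
    exact e.apply_symm_apply _
  have h6 := (congrArg (fun w ↦ (trivializationAt E (TangentSpace I : M → Type _)
    x).continuousLinearMapAt ℝ y (A y w)) h5).trans (he2 (A y u))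
  exact (e.apply_symm_apply _).symm.trans (congrArg e h6.symm)

/-- A field of bilinear forms with smooth coefficients in a chart is smooth. -/
theorem contMDiffAt_bilin
    {g : (y : M) → TangentSpace I y →L[ℝ] TangentSpace I y →L[ℝ] ℝ} {gφ : F → F →L[ℝ] F →L[ℝ] ℝ}
    (hg : BilinRepAt g φ x gφ) (hgs : ContDiffAt ℝ ∞ gφ (φ x)) :
    ContMDiffAt I (I.prod 𝓘(ℝ, E →L[ℝ] E →L[ℝ] ℝ)) ∞
    (fun x ↦ TotalSpace.mk' (E →L[ℝ] E →L[ℝ] ℝ)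
      (E := fun y : M ↦ TangentSpace I y →L[ℝ] TangentSpace I y →L[ℝ] ℝ) x (g x)) x := by
  rw [contMDiffAt_hom_bundle]
  refine ⟨contMDiffAt_id, ?_⟩
  have h1 : ContMDiffAt I 𝓘(ℝ, F →L[ℝ] F →L[ℝ] ℝ) ∞ (fun y ↦ gφ (φ y)) x :=
    hgs.contMDiffAt.comp x (hφ.contMDiffAt hx)
  have hP := hφ.contMDiffAt_frameOfChart hx
  have h2 := contDiff_bilinearComp.contMDiff.contMDiffAt.comp x (h1.prodMk_space hP)
  refine h2.congr_of_eventuallyEq ?_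
  filter_upwards [hφ.frameOfChart_eventually hx, hg, (trivializationAt E
    (TangentSpace I : M → Type _) x).open_baseSet.mem_nhds
    (FiberBundle.mem_baseSet_trivializationAt' x)] with y ⟨e, he, he1, he2⟩ hgy hyT
  ext a b
  refine (inCoordinates_apply_eq₂ hyT hyT (Set.mem_univ _)).trans ?_
  rw [← Trivialization.symmL_apply (R := ℝ) _ hyT, ← Trivialization.symmL_apply (R := ℝ) _ hyT,
    hgy, he1, he1]
  simp [he]

/-- A smooth field of bilinear forms has smooth coefficients in every chart. -/
theorem exists_bilinRep [CompleteSpace E]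
    {g : (y : M) → TangentSpace I y →L[ℝ] TangentSpace I y →L[ℝ] ℝ}
    (hg : ContMDiffAt I (I.prod 𝓘(ℝ, E →L[ℝ] E →L[ℝ] ℝ)) ∞
    (fun x ↦ TotalSpace.mk' (E →L[ℝ] E →L[ℝ] ℝ)
      (E := fun y : M ↦ TangentSpace I y →L[ℝ] TangentSpace I y →L[ℝ] ℝ) x (g x)) x) :
    ∃ gφ : F → F →L[ℝ] F →L[ℝ] ℝ, ContDiffAt ℝ ∞ gφ (φ x) ∧ BilinRepAt g φ x gφ := by
  rw [contMDiffAt_hom_bundle] at hg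
  have h2 := contDiff_bilinearComp.contMDiff.contMDiffAt.comp x
    (hg.2.prodMk_space (hφ.contMDiffAt_inverse_frameOfChart hx))
  have hs : ContMDiffAt 𝓘(ℝ, F) I ∞ φ.symm (φ x) := hφ.contMDiffAt_symm (φ.map_source hx)
  rw [← φ.left_inv hx] at h2
  have h3 := h2.comp (φ x) hs
  rw [φ.left_inv hx] at h3
  refine ⟨_, h3.contDiffAt, ?_⟩
  filter_upwards [hφ.frameOfChart_eventually hx, φ.open_source.mem_nhds hx, (trivializationAt E
    (TangentSpace I : M → Type _) x).open_baseSet.mem_nhds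
    (FiberBundle.mem_baseSet_trivializationAt' x)]
    with y ⟨e, he, he1, he2⟩ hy hyT
  intro u v
  have h3 : ContinuousLinearMap.inverse (frameOfChart I φ x y) = e.symm := by
    rw [he, ContinuousLinearMap.inverse_equiv]
  have h5 : ∀ u, (trivializationAt E (TangentSpace I : M → Type _) x).symm y
      (e.symm (dChart I φ y u)) = u := fun u ↦ by
    apply hφ.dChart_injective hy
    rw [← Trivialization.symmL_apply (R := ℝ) _ hyT, he1]
    exact e.apply_symm_apply _
  simp only [Function.comp_apply, φ.left_inv hy, h3]
  refine Eq.symm ((inCoordinates_apply_eq₂ hyT hyT (Set.mem_univ _)).trans ?_)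
  simp only [Trivial.fiberBundle_trivializationAt', Trivial.linearMapAt_trivialization]
  exact congrArg₂ (fun u v ↦ g y u v) (h5 u) (h5 v)

end IsSmoothChart
end Smoothness

/-! ### Closed forms -/

section Forms

variable {E : Type*} [NormedAddCommGroup E] [NormedSpace ℝ E]
  {H : Type*} [TopologicalSpace H] {I : ModelWithCorners ℝ E H}
  {M : Type*} [TopologicalSpace M] [ChartedSpace H M]
  {V : Type*} [NormedAddCommGroup V] [NormedSpace ℝ V]

theorem finiteDimensional_continuousMultilinearMap [FiniteDimensional ℝ E] (k : ℕ) :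
    FiniteDimensional ℝ (ContinuousMultilinearMap ℝ (fun _ : Fin k ↦ E) ℝ) :=
  Module.Finite.of_injective
    (ContinuousMultilinearMap.toMultilinearMapLinear :
      ContinuousMultilinearMap ℝ (fun _ : Fin k ↦ E) ℝ →ₗ[ℝ] _)
    ContinuousMultilinearMap.toMultilinearMap_injective

/-- The pullback of an alternating form by a linear map is smooth in both. The corresponding fact
for multilinear maps is transferred along a left inverse of the inclusion of the alternating forms
on `E` into the multilinear ones, which is continuous as `E` is finite-dimensional. -/
theorem contDiff_compContinuousLinearMap [FiniteDimensional ℝ E] (k : ℕ) :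
    ContDiff ℝ ∞ (fun p : (V [⋀^Fin k]→L[ℝ] ℝ) × (E →L[ℝ] V) ↦
      p.1.compContinuousLinearMap p.2) := by
  have := finiteDimensional_continuousMultilinearMap (E := E) k
  obtain ⟨r, hr⟩ := LinearMap.exists_leftInverse_of_injective
    (ContinuousAlternatingMap.toContinuousMultilinearMapCLM ℝ :
      (E [⋀^Fin k]→L[ℝ] ℝ) →L[ℝ] _).toLinearMap
    (LinearMap.ker_eq_bot.2 ContinuousAlternatingMap.toContinuousMultilinearMap_injective)
  have h1 : ContDiff ℝ ∞ (fun p : (V [⋀^Fin k]→L[ℝ] ℝ) × (E →L[ℝ] V) ↦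
      (ContinuousMultilinearMap.compContinuousLinearMapContinuousMultilinear ℝ
        (fun _ : Fin k ↦ E) (fun _ : Fin k ↦ V) ℝ (fun _ ↦ p.2))
        (ContinuousAlternatingMap.toContinuousMultilinearMapCLM ℝ p.1)) := by
    refine ContDiff.clm_apply ?_ ?_
    · exact (ContinuousMultilinearMap.contDiff _).comp (contDiff_pi.2 fun _ ↦ contDiff_snd)
    · exact (ContinuousLinearMap.contDiff _).comp contDiff_fst
  have h2 := (LinearMap.toContinuousLinearMap r).contDiff.comp h1
  convert! h2 using 1
  funext p
  exact (DFunLike.congr_fun hr (p.1.compContinuousLinearMap p.2)).symm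

/-- A form which is near every point the pullback, by a map into a vector space, of a smooth form
closed at the image of this point is smooth and closed. -/
theorem isClosedForm_of_locally_pullback [FiniteDimensional ℝ E] [IsManifold I ∞ M]
    [I.Boundaryless]
    {k : ℕ} {T : FormField I M k}
    (hT : ∀ x : M, ∃ (f : M → V) (β : V → V [⋀^Fin k]→L[ℝ] ℝ), ContMDiffAt I 𝓘(ℝ, V) ∞ f x ∧
      ContDiffAt ℝ ∞ β (f x) ∧ extDeriv β (f x) = 0 ∧
      ∀ᶠ y in 𝓝 x, T y = (β (f y)).compContinuousLinearMap (mfderiv I 𝓘(ℝ, V) f y)) :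
    IsClosedForm T := by
  have key : ∀ x₀ : M, ∀ z ∈ (extChartAt I x₀).target, ∃ (f : E → V)
      (β : V → V [⋀^Fin k]→L[ℝ] ℝ), ContDiffAt ℝ ∞ f z ∧ ContDiffAt ℝ ∞ β (f z) ∧
      extDeriv β (f z) = 0 ∧ formInChart T x₀ =ᶠ[𝓝 z] fun w ↦
        (β (f w)).compContinuousLinearMap (fderiv ℝ f w) := by
    intro x₀ z hz
    have ht : (extChartAt I x₀).target ∈ 𝓝 z := (isOpen_extChartAt_target x₀).mem_nhds hz
    have hs : ContMDiffAt 𝓘(ℝ, E) I ∞ (extChartAt I x₀).symm z :=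
      (contMDiffOn_extChartAt_symm x₀).contMDiffAt ht
    obtain ⟨f, β, hf, hβ, hd, hTf⟩ := hT ((extChartAt I x₀).symm z)
    refine ⟨f ∘ (extChartAt I x₀).symm, β, (hf.comp z hs).contDiffAt, hβ, hd, ?_⟩
    have hfn : ∀ᶠ y in 𝓝 ((extChartAt I x₀).symm z), MDifferentiableAt I 𝓘(ℝ, V) f y := by
      have h1 : ContMDiffAt I 𝓘(ℝ, V) 1 f ((extChartAt I x₀).symm z) := hf.of_le (by simp)
      filter_upwards [(contMDiffAt_iff_contMDiffAt_nhds (by simp)).1 h1] with y hy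
      exact hy.mdifferentiableAt (by simp)
    filter_upwards [hs.continuousAt.eventually hTf, hs.continuousAt.eventually hfn,
      eventually_mem_nhds_iff.2 ht] with w hw hwf hwt
    have hsw : MDifferentiableAt 𝓘(ℝ, E) I (extChartAt I x₀).symm w :=
      ((contMDiffOn_extChartAt_symm x₀).contMDiffAt (n := ∞) hwt).mdifferentiableAt (by simp)
    unfold formInChart
    rw [hw, ← mfderiv_eq_fderiv, mfderiv_comp w hwf hsw]
    rfl
  refine ⟨fun x₀ z hz ↦ ContDiffAt.contDiffWithinAt ?_, fun x ↦ ?_⟩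
  · obtain ⟨f, β, hf, hβ, -, he⟩ := key x₀ z hz
    refine ContDiffAt.congr_of_eventuallyEq ?_ he
    exact (contDiff_compContinuousLinearMap k).contDiffAt.comp z
      ((hβ.comp z hf).prodMk (hf.fderiv_right (by simp)))
  · obtain ⟨f, β, hf, hβ, hd, he⟩ := key x _ (mem_extChartAt_target x)
    unfold extD
    rw [he.extDeriv_eq, extDeriv_pullback (hβ.differentiableAt (by simp)) hf
      (by rw [minSmoothness_of_isRCLikeNormedField]; exact two_le_infty), hd]
    rfl

end Forms

/-! ### The flat model on the punctured quaternions -/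

section Flat

set_option maxSynthPendingDepth 3

theorem inner_eq_coords (a b : ℍ[ℝ]) :
    inner ℝ a b = a.re * b.re + a.imI * b.imI + a.imJ * b.imJ + a.imK * b.imK := by
  rw [Quaternion.inner_def]
  simp

theorem norm_sq_eq_coords (a : ℍ[ℝ]) :
    ‖a‖ ^ 2 = a.re ^ 2 + a.imI ^ 2 + a.imJ ^ 2 + a.imK ^ 2 := by
  rw [sq, ← Quaternion.normSq_eq_norm_mul_self, Quaternion.normSq_def']

theorem inv_eq_smul_star (a : ℍ[ℝ]) : a⁻¹ = (‖a‖ ^ 2)⁻¹ • star a := by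
  rw [Quaternion.inv_def, Quaternion.normSq_eq_norm_mul_self, sq]

/-- The coordinates of a quaternion in the basis `1, i, j, k`. -/
def quaternionCoords : ℍ[ℝ] →ₗ[ℝ] Fin 4 → ℝ where
  toFun a := ![a.re, a.imI, a.imJ, a.imK]
  map_add' a b := by ext i; fin_cases i <;> simp
  map_smul' r a := by ext i; fin_cases i <;> simp

/-- The volume form of `ℍ`, for which `1, i, j, k` is a positive orthonormal basis. -/
def quaternionVolume : ℍ[ℝ] [⋀^Fin 4]→L[ℝ] ℝ :=
  { (Matrix.detRowAlternating : (Fin 4 → ℝ) [⋀^Fin 4]→ₗ[ℝ] ℝ).compLinearMap quaternionCoords with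
    cont := by
      have h : Continuous quaternionCoords := quaternionCoords.continuous_of_finiteDimensional
      have h' : Continuous fun v : Fin 4 → ℍ[ℝ] ↦
          (Matrix.of fun i ↦ quaternionCoords (v i) : Matrix (Fin 4) (Fin 4) ℝ) :=
        continuous_pi fun i ↦ h.comp (continuous_apply i)
      exact h'.matrix_det }

theorem quaternionVolume_apply (a b c d : ℍ[ℝ]) :
    quaternionVolume ![a, b, c, d] =
      Matrix.det !![a.re, a.imI, a.imJ, a.imK; b.re, b.imI, b.imJ, b.imK;
        c.re, c.imI, c.imJ, c.imK; d.re, d.imI, d.imJ, d.imK] := by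
  change Matrix.det (Matrix.of fun i ↦ quaternionCoords (![a, b, c, d] i)) = _
  congr 1
  ext i j
  fin_cases i <;> fin_cases j <;> rfl

/-- Cramer's rule for five vectors of a four-dimensional space, paired with one of them. -/
theorem quaternionVolume_cramer (x : ℍ[ℝ]) (t : Fin 4 → ℍ[ℝ]) :
    ∑ i : Fin 4, (-1 : ℝ) ^ (i : ℕ) * (inner ℝ x (t i) *
      quaternionVolume (Matrix.vecCons x (i.removeNth t))) = ‖x‖ ^ 2 * quaternionVolume t := by
  have ht : t = ![t 0, t 1, t 2, t 3] := by ext i <;> fin_cases i <;> rfl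
  generalize t 0 = a at ht
  generalize t 1 = b at ht
  generalize t 2 = c at ht
  generalize t 3 = d at ht
  subst ht
  have h0 : Fin.removeNth 0 ![a, b, c, d] = ![b, c, d] := by
    ext i <;> fin_cases i <;> rfl
  have h1 : Fin.removeNth 1 ![a, b, c, d] = ![a, c, d] := by
    ext i <;> fin_cases i <;> rfl
  have h2 : Fin.removeNth 2 ![a, b, c, d] = ![a, b, d] := by
    ext i <;> fin_cases i <;> rfl
  have h3 : Fin.removeNth 3 ![a, b, c, d] = ![a, b, c] := by
    ext i <;> fin_cases i <;> rfl
  simp only [Fin.sum_univ_four, h0, h1, h2, h3]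
  change (-1 : ℝ) ^ 0 * (inner ℝ x a * quaternionVolume ![x, b, c, d]) +
    (-1 : ℝ) ^ 1 * (inner ℝ x b * quaternionVolume ![x, a, c, d]) +
    (-1 : ℝ) ^ 2 * (inner ℝ x c * quaternionVolume ![x, a, b, d]) +
    (-1 : ℝ) ^ 3 * (inner ℝ x d * quaternionVolume ![x, a, b, c]) = _
  simp only [quaternionVolume_apply, inner_eq_coords, norm_sq_eq_coords]
  simp [Matrix.det_succ_row_zero, Fin.sum_univ_succ, Fin.succAbove]
  ring

/-- The torsion form of the left structure on `ℍ ∖ {0}`, see `flatTorsion_apply`, written as a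
multiple of the contraction of the volume form with `x`. -/
def flatTorsion (x : ℍ[ℝ]) : ℍ[ℝ] [⋀^Fin 3]→L[ℝ] ℝ :=
  (2 * (‖x‖ ^ 2)⁻¹ ^ 2) • quaternionVolume.curryLeft x

/-- The flat torsion is `⟨u x⁻¹ v - v x⁻¹ u, w⟩ / |x|²`. -/
theorem flatTorsion_apply (x u v w : ℍ[ℝ]) :
    flatTorsion x ![u, v, w] = inner ℝ (u * (x⁻¹ * v) - v * (x⁻¹ * u)) w / ‖x‖ ^ 2 := by
  rw [flatTorsion, ContinuousAlternatingMap.smul_apply,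
    ContinuousAlternatingMap.curryLeft_apply_apply]
  change _ • quaternionVolume ![x, u, v, w] = _
  rw [inv_eq_smul_star, smul_mul_assoc, smul_mul_assoc, mul_smul_comm, mul_smul_comm, ← smul_sub,
    real_inner_smul_left, quaternionVolume_apply, inner_eq_coords, div_eq_mul_inv, smul_eq_mul]
  generalize (‖x‖ ^ 2)⁻¹ = r
  simp [Matrix.det_succ_row_zero, Fin.sum_univ_succ, Fin.succAbove]
  ring

/-- The flat torsion is invariant under homotheties. -/
theorem flatTorsion_smul {c : ℝ} (hc : c ≠ 0) (x : ℍ[ℝ]) (t : Fin 3 → ℍ[ℝ]) :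
    flatTorsion (c • x) (fun i ↦ c • t i) = flatTorsion x t := by
  have h := quaternionVolume.map_smul_univ (fun _ ↦ c) (Matrix.vecCons x t)
  have h' : (fun i ↦ c • Matrix.vecCons x t i) = Matrix.vecCons (c • x) (fun i ↦ c • t i) := by
    ext i <;> refine Fin.cases ?_ (fun j ↦ ?_) i <;> rfl
  rw [h'] at h
  simp only [flatTorsion, ContinuousAlternatingMap.smul_apply,
    ContinuousAlternatingMap.curryLeft_apply_apply, h, norm_smul, mul_pow, Real.norm_eq_abs,
    sq_abs]
  simp only [Finset.prod_const, Finset.card_univ, Fintype.card_fin, smul_eq_mul]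
  field_simp

theorem contDiffAt_inv_norm_sq {x : ℍ[ℝ]} (hx : x ≠ 0) :
    ContDiffAt ℝ ∞ (fun y : ℍ[ℝ] ↦ (‖y‖ ^ 2)⁻¹) x :=
  (contDiff_norm_sq ℝ).contDiffAt.inv (by simpa using hx)

theorem contDiffAt_flatTorsion {x : ℍ[ℝ]} (hx : x ≠ 0) : ContDiffAt ℝ ∞ flatTorsion x := by
  exact (contDiffAt_const.mul ((contDiffAt_inv_norm_sq hx).pow 2)).smul
    (ContinuousLinearMap.contDiff quaternionVolume.curryLeft).contDiffAt

theorem hasFDerivAt_inv_norm_sq {x : ℍ[ℝ]} (hx : x ≠ 0) :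
    HasFDerivAt (fun y : ℍ[ℝ] ↦ (‖y‖ ^ 2)⁻¹)
      ((-(2 * (‖x‖ ^ 2)⁻¹ ^ 2)) • innerSL ℝ x) x := by
  have h1 := (hasStrictFDerivAt_norm_sq x).hasFDerivAt
  have h2 := (hasDerivAt_inv (x := ‖x‖ ^ 2) (by simpa using hx)).comp_hasFDerivAt x h1
  refine h2.congr_fderiv ?_
  ext v
  simp
  ring

/-- The form is closed because `|x|⁻⁴` times the Euler vector field is divergence free. -/
theorem extDeriv_flatTorsion {x : ℍ[ℝ]} (hx : x ≠ 0) : extDeriv flatTorsion x = 0 := by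
  ext t
  rw [extDeriv_apply ((contDiffAt_flatTorsion hx).differentiableAt (by simp))]
  have hd : ∀ i : Fin 4, fderiv ℝ (fun y ↦ flatTorsion y (i.removeNth t)) x (t i) =
      2 * (‖x‖ ^ 2)⁻¹ ^ 2 * quaternionVolume (Matrix.vecCons (t i) (i.removeNth t)) -
      8 * (‖x‖ ^ 2)⁻¹ ^ 3 *
        (inner ℝ x (t i) * quaternionVolume (Matrix.vecCons x (i.removeNth t))) := by
    intro i
    have h1 : HasFDerivAt (fun y ↦ quaternionVolume.curryLeft y (i.removeNth t)) _ x :=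
      ((ContinuousAlternatingMap.apply ℝ _ ℝ (i.removeNth t)).comp
        quaternionVolume.curryLeft).hasFDerivAt
    have h2 := (((hasFDerivAt_inv_norm_sq hx).pow 2).const_mul 2).mul h1
    have h3 : (fun y ↦ flatTorsion y (i.removeNth t)) = fun y ↦ 2 * (‖y‖ ^ 2)⁻¹ ^ 2 *
      quaternionVolume.curryLeft y (i.removeNth t) := rfl
    rw [h3]
    refine (DFunLike.congr_fun h2.fderiv (t i)).trans ?_
    simp
    ring
  have hs : ∀ i : Fin 4, (-1 : ℝ) ^ (i : ℕ) *
      quaternionVolume (Matrix.vecCons (t i) (i.removeNth t)) = quaternionVolume t := by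
    intro i
    have h := quaternionVolume.map_insertNth i (t i) (i.removeNth t)
    rw [Fin.insertNth_self_removeNth] at h
    rw [h, zsmul_eq_mul]
    push_cast
    rfl
  -- Summing the first terms of `hd` gives `8 |x|⁻⁴ vol`, and the second ones give its opposite by
  -- Cramer's rule: this is where the exponent `-4` matters.
  have hc := quaternionVolume_cramer x t
  have hsum : ∀ i : Fin 4, (-1 : ℤ) ^ (i : ℕ) •
      fderiv ℝ (fun y ↦ flatTorsion y (i.removeNth t)) x (t i) =
      2 * (‖x‖ ^ 2)⁻¹ ^ 2 * quaternionVolume t - 8 * (‖x‖ ^ 2)⁻¹ ^ 3 * ((-1 : ℝ) ^ (i : ℕ) *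
        (inner ℝ x (t i) * quaternionVolume (Matrix.vecCons x (i.removeNth t)))) := by
    intro i
    rw [hd, ← hs i, zsmul_eq_mul]
    push_cast
    ring
  refine (Finset.sum_congr rfl fun i _ ↦ hsum i).trans ?_
  rw [Finset.sum_sub_distrib, ← Finset.mul_sum (a := 8 * (‖x‖ ^ 2)⁻¹ ^ 3), hc]
  have hx' : ‖x‖ ^ 2 ≠ 0 := by simpa using hx
  simp
  field_simp
  ring

/-- The inner product of `ℍ` as a continuous bilinear map over `ℝ`. -/
def realInner : ℍ[ℝ] →L[ℝ] ℍ[ℝ] →L[ℝ] ℝ := innerSL ℝ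

theorem realInner_apply (a b : ℍ[ℝ]) : realInner a b = inner ℝ a b := rfl

/-- The metric `⟨a, b⟩ / |x|²` on `ℍ ∖ {0}`. -/
def flatMetric (x : ℍ[ℝ]) : ℍ[ℝ] →L[ℝ] ℍ[ℝ] →L[ℝ] ℝ :=
  (‖x‖ ^ 2)⁻¹ • realInner

theorem flatMetric_apply (x a b : ℍ[ℝ]) : flatMetric x a b = inner ℝ a b / ‖x‖ ^ 2 := by
  simp [flatMetric, realInner_apply, div_eq_inv_mul]

theorem contDiffAt_flatMetric {x : ℍ[ℝ]} (hx : x ≠ 0) : ContDiffAt ℝ ∞ flatMetric x :=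
  (contDiffAt_inv_norm_sq hx).smul contDiffAt_const

theorem fderiv_flatMetric {x : ℍ[ℝ]} (hx : x ≠ 0) (c a b : ℍ[ℝ]) :
    fderiv ℝ flatMetric x c a b = -(2 * (‖x‖ ^ 2)⁻¹ ^ 2) * inner ℝ x c * inner ℝ a b := by
  have h := (hasFDerivAt_inv_norm_sq hx).smul_const realInner
  have h' : fderiv ℝ flatMetric x = _ := h.fderiv
  rw [h']
  simp [realInner_apply]

/-- The Christoffel symbol at `x` of the flat connection on `ℍ ∖ {0}` for which the fields
`x ↦ x q` are parallel. It is the Bismut connection of left multiplication by `i, j, k`. -/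
def leftChristoffel (x : ℍ[ℝ]) : ℍ[ℝ] →L[ℝ] ℍ[ℝ] →L[ℝ] ℍ[ℝ] :=
  -((ContinuousLinearMap.mul ℝ ℍ[ℝ]).bilinearComp (.id ℝ _) (.mul ℝ ℍ[ℝ] x⁻¹)).flip

theorem leftChristoffel_apply (x v w : ℍ[ℝ]) : leftChristoffel x v w = -(w * (x⁻¹ * v)) := rfl

/-- The Christoffel symbol at `x` of the flat connection on `ℍ ∖ {0}` for which the fields
`x ↦ q x` are parallel. It is the Bismut connection of right multiplication by `-i, -j, -k`. -/
def rightChristoffel (x : ℍ[ℝ]) : ℍ[ℝ] →L[ℝ] ℍ[ℝ] →L[ℝ] ℍ[ℝ] :=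
  -(ContinuousLinearMap.mul ℝ ℍ[ℝ]).bilinearComp (.id ℝ _) (.mul ℝ ℍ[ℝ] x⁻¹)

theorem rightChristoffel_apply (x v w : ℍ[ℝ]) : rightChristoffel x v w = -(v * (x⁻¹ * w)) := rfl

theorem leftChristoffel_metric {x : ℍ[ℝ]} (hx : x ≠ 0) (c a b : ℍ[ℝ]) :
    fderiv ℝ flatMetric x c a b =
      flatMetric x (leftChristoffel x c a) b + flatMetric x a (leftChristoffel x c b) := by
  rw [fderiv_flatMetric hx, flatMetric_apply, flatMetric_apply, leftChristoffel_apply,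
    leftChristoffel_apply, inv_eq_smul_star]
  simp only [smul_mul_assoc, mul_smul_comm, inner_neg_left, inner_neg_right, real_inner_smul_left,
    real_inner_smul_right, inner_eq_coords, div_eq_mul_inv]
  generalize (‖x‖ ^ 2)⁻¹ = r
  simp
  ring

theorem rightChristoffel_metric {x : ℍ[ℝ]} (hx : x ≠ 0) (c a b : ℍ[ℝ]) :
    fderiv ℝ flatMetric x c a b =
      flatMetric x (rightChristoffel x c a) b + flatMetric x a (rightChristoffel x c b) := by
  rw [fderiv_flatMetric hx, flatMetric_apply, flatMetric_apply, rightChristoffel_apply,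
    rightChristoffel_apply, inv_eq_smul_star]
  simp only [smul_mul_assoc, mul_smul_comm, inner_neg_left, inner_neg_right, real_inner_smul_left,
    real_inner_smul_right, inner_eq_coords, div_eq_mul_inv]
  generalize (‖x‖ ^ 2)⁻¹ = r
  simp
  ring

/-- Left multiplication by `e`. -/
def leftMul (e : ℍ[ℝ]) : ℍ[ℝ] →L[ℝ] ℍ[ℝ] := .mul ℝ ℍ[ℝ] e

/-- Right multiplication by the conjugate of `e`. -/
def rightMul (e : ℍ[ℝ]) : ℍ[ℝ] →L[ℝ] ℍ[ℝ] := (ContinuousLinearMap.mul ℝ ℍ[ℝ]).flip (star e)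

theorem leftMul_apply (e w : ℍ[ℝ]) : leftMul e w = e * w := rfl

theorem rightMul_apply (e w : ℍ[ℝ]) : rightMul e w = w * star e := rfl

theorem leftChristoffel_leftMul (e x v w : ℍ[ℝ]) :
    leftChristoffel x v (leftMul e w) = leftMul e (leftChristoffel x v w) := by
  simp only [leftChristoffel_apply, leftMul_apply, mul_neg, mul_assoc]

theorem rightChristoffel_rightMul (e x v w : ℍ[ℝ]) :
    rightChristoffel x v (rightMul e w) = rightMul e (rightChristoffel x v w) := by
  simp only [rightChristoffel_apply, rightMul_apply, neg_mul, mul_assoc]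

theorem imUnit_re (a : Fin 3) : (imUnit a).re = 0 := by fin_cases a <;> rfl

theorem imUnit_imI (a : Fin 3) : (imUnit a).imI = (![1, 0, 0] : Fin 3 → ℝ) a := by
  fin_cases a <;> rfl

theorem imUnit_imJ (a : Fin 3) : (imUnit a).imJ = (![0, 1, 0] : Fin 3 → ℝ) a := by
  fin_cases a <;> rfl

theorem imUnit_imK (a : Fin 3) : (imUnit a).imK = (![0, 0, 1] : Fin 3 → ℝ) a := by
  fin_cases a <;> rfl

theorem imUnit_mul_self (a : Fin 3) : imUnit a * imUnit a = -1 := by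
  fin_cases a <;> ext <;> simp [imUnit_re, imUnit_imI, imUnit_imJ, imUnit_imK]

theorem star_imUnit (a : Fin 3) : star (imUnit a) = -imUnit a := by
  fin_cases a <;> ext <;> simp [imUnit_re, imUnit_imI, imUnit_imJ, imUnit_imK]

theorem imUnit_zero_mul_one : imUnit 0 * imUnit 1 = imUnit 2 := by
  ext <;> simp [imUnit_re, imUnit_imI, imUnit_imJ, imUnit_imK]

theorem imUnit_one_mul_zero : imUnit 1 * imUnit 0 = -imUnit 2 := by
  ext <;> simp [imUnit_re, imUnit_imI, imUnit_imJ, imUnit_imK]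

theorem leftMul_leftMul_imUnit (a : Fin 3) (w : ℍ[ℝ]) :
    leftMul (imUnit a) (leftMul (imUnit a) w) = -w := by
  rw [leftMul_apply, leftMul_apply, ← mul_assoc, imUnit_mul_self, neg_one_mul]

theorem rightMul_rightMul_imUnit (a : Fin 3) (w : ℍ[ℝ]) :
    rightMul (imUnit a) (rightMul (imUnit a) w) = -w := by
  rw [rightMul_apply, rightMul_apply, star_imUnit, mul_assoc, neg_mul_neg, imUnit_mul_self,
    mul_neg_one]

theorem inner_leftMul_imUnit (a : Fin 3) (v w : ℍ[ℝ]) :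
    inner ℝ (leftMul (imUnit a) v) w = -inner ℝ v (leftMul (imUnit a) w) := by
  fin_cases a <;>
    simp [leftMul_apply, inner_eq_coords, imUnit_re, imUnit_imI, imUnit_imJ, imUnit_imK] <;> ring

theorem inner_rightMul_imUnit (a : Fin 3) (v w : ℍ[ℝ]) :
    inner ℝ (rightMul (imUnit a) v) w = -inner ℝ v (rightMul (imUnit a) w) := by
  fin_cases a <;>
    simp [rightMul_apply, inner_eq_coords, imUnit_re, imUnit_imI, imUnit_imJ, imUnit_imK] <;> ring

end Flat

/-! ### The mapping torus as a quotient manifold -/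

section Torus

variable {E : Type*} [NormedAddCommGroup E] [NormedSpace ℝ E]
  {H : Type*} [TopologicalSpace H] {I : ModelWithCorners ℝ E H}
  {N : Type*} [TopologicalSpace N] [ChartedSpace H N] (ψ : N ≃ₘ^∞⟮I, I⟯ N)
  [T2Space N] [LocallyCompactSpace N] [IsManifold I ∞ N]

/-- The projection `N × ℝ → N_ψ` as a map on the cover. -/
def coverProj : TorusCover ψ → MappingTorus ψ := Quotient.mk _

omit [T2Space N] [LocallyCompactSpace N] [IsManifold I ∞ N] in
theorem coverProj_eq_iff {z w : TorusCover ψ} :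
    coverProj ψ z = coverProj ψ w ↔ ∃ k : ℤ, k +ᵥ w = z :=
  Quotient.eq.trans AddAction.orbitRel_apply

omit [IsManifold I ∞ N] in
/-- The chart of the mapping torus at `q` is the chart of the cover at some lift of `q`, composed
with the inverse of the projection near this lift. -/
theorem exists_chartAt_mappingTorus (q : MappingTorus ψ) : ∃ z : TorusCover ψ, coverProj ψ z = q ∧
    chartAt (ModelProd H ℝ) q =
      ((isLocalHomeomorph_mk ψ).localInverseAt z).trans (chartAt (ModelProd H ℝ) z) := by
  refine ⟨_, ?_, rfl⟩
  exact Quotient.mk_surjective.hasRightInverse.choose_spec q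

theorem contMDiffAt_localInverse_basepoint (q : MappingTorus ψ) : ∃ z : TorusCover ψ,
    coverProj ψ z = q ∧ ContMDiffAt (I.prod 𝓘(ℝ, ℝ)) (I.prod 𝓘(ℝ, ℝ)) ∞
      ((isLocalHomeomorph_mk ψ).localInverseAt z) q ∧
      ContMDiffAt (I.prod 𝓘(ℝ, ℝ)) (I.prod 𝓘(ℝ, ℝ)) ∞ (coverProj ψ) z := by
  obtain ⟨z, hz, he⟩ := exists_chartAt_mappingTorus ψ q
  set L := (isLocalHomeomorph_mk ψ).localInverseAt z with hL
  have hqL : q ∈ L.source := by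
    rw [← hz]; exact IsLocalHomeomorph.apply_self_mem_localInverseAt_source _
  have hLz : L q = z := by
    rw [← hz]; exact IsLocalHomeomorph.localInverseAt_apply_self _
  have hzs : z ∈ (chartAt (ModelProd H ℝ) z).source := mem_chart_source _ z
  have hqc : q ∈ (chartAt (ModelProd H ℝ) q).source := mem_chart_source _ q
  have hct : chartAt (ModelProd H ℝ) z z ∈ (chartAt (ModelProd H ℝ) z).target :=
    mem_chart_target _ z
  have hcq : chartAt (ModelProd H ℝ) q q = chartAt (ModelProd H ℝ) z z := by
    rw [he, OpenPartialHomeomorph.trans_apply, hLz]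
  refine ⟨z, hz, ?_, ?_⟩
  · have h1 : ContMDiffAt (I.prod 𝓘(ℝ, ℝ)) (I.prod 𝓘(ℝ, ℝ)) ∞ (chartAt (ModelProd H ℝ) q) q :=
      contMDiffOn_chart.contMDiffAt ((chartAt _ q).open_source.mem_nhds hqc)
    have h2 : ContMDiffAt (I.prod 𝓘(ℝ, ℝ)) (I.prod 𝓘(ℝ, ℝ)) ∞ (chartAt (ModelProd H ℝ) z).symm
        (chartAt (ModelProd H ℝ) q q) := by
      rw [hcq]
      exact contMDiffOn_chart_symm.contMDiffAt ((chartAt _ z).open_target.mem_nhds hct)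
    refine (h2.comp q h1).congr_of_eventuallyEq ?_
    filter_upwards [(chartAt (ModelProd H ℝ) q).open_source.mem_nhds hqc] with y hy
    rw [he] at hy ⊢
    exact ((chartAt (ModelProd H ℝ) z).left_inv hy.2).symm
  · have h1 : ContMDiffAt (I.prod 𝓘(ℝ, ℝ)) (I.prod 𝓘(ℝ, ℝ)) ∞ (chartAt (ModelProd H ℝ) z) z :=
      contMDiffOn_chart.contMDiffAt ((chartAt _ z).open_source.mem_nhds hzs)
    have h2 : ContMDiffAt (I.prod 𝓘(ℝ, ℝ)) (I.prod 𝓘(ℝ, ℝ)) ∞ (chartAt (ModelProd H ℝ) q).symm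
        (chartAt (ModelProd H ℝ) z z) := by
      rw [← hcq]
      exact contMDiffOn_chart_symm.contMDiffAt
        ((chartAt _ q).open_target.mem_nhds (mem_chart_target _ q))
    refine (h2.comp z h1).congr_of_eventuallyEq ?_
    filter_upwards [(chartAt (ModelProd H ℝ) z).open_source.mem_nhds hzs] with y hy
    have h3 : (chartAt (ModelProd H ℝ) q).symm (chartAt (ModelProd H ℝ) z y) =
        L.symm ((chartAt (ModelProd H ℝ) z).symm (chartAt (ModelProd H ℝ) z y)) := by rw [he]; rfl
    rw [Function.comp_apply, h3, (chartAt (ModelProd H ℝ) z).left_inv hy, hL,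
      IsLocalHomeomorph.localInverseAt_symm]
    rfl

omit [T2Space N] [LocallyCompactSpace N] [IsManifold I ∞ N] in
theorem coverProj_vadd (k : ℤ) (z : TorusCover ψ) : coverProj ψ (k +ᵥ z) = coverProj ψ z :=
  (coverProj_eq_iff ψ).2 ⟨k, rfl⟩

theorem contMDiff_coverProj :
    ContMDiff (I.prod 𝓘(ℝ, ℝ)) (I.prod 𝓘(ℝ, ℝ)) ∞ (coverProj ψ) := by
  intro w
  obtain ⟨z, hz, -, hs⟩ := contMDiffAt_localInverse_basepoint ψ (coverProj ψ w)
  obtain ⟨k, rfl⟩ := (coverProj_eq_iff ψ).1 hz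
  have h := hs.comp w (contMDiff_vadd ψ k w)
  exact h.congr_of_eventuallyEq (Filter.Eventually.of_forall fun y ↦ (coverProj_vadd ψ k y).symm)

/-- Continuous local sections of the projection are smooth. -/
theorem contMDiffAt_of_section {s : MappingTorus ψ → TorusCover ψ} {q : MappingTorus ψ}
    (hc : ContinuousAt s q) (hs : ∀ᶠ y in 𝓝 q, coverProj ψ (s y) = y) :
    ContMDiffAt (I.prod 𝓘(ℝ, ℝ)) (I.prod 𝓘(ℝ, ℝ)) ∞ s q := by
  obtain ⟨z, hz, hL, -⟩ := contMDiffAt_localInverse_basepoint ψ q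
  obtain ⟨k, hk⟩ := (coverProj_eq_iff ψ).1 (hz.trans hs.self_of_nhds.symm)
  refine ((contMDiff_vadd ψ (-k) _).comp q hL).congr_of_eventuallyEq ?_
  set L := (isLocalHomeomorph_mk ψ).localInverseAt z with hLdef
  have hd : ContinuousAt (fun y ↦ k +ᵥ s y) q :=
    ((contMDiff_vadd ψ k).continuous.continuousAt).comp hc
  have hzt : z ∈ L.target := IsLocalHomeomorph.self_mem_localInverseAt_target _
  have hmem : ∀ᶠ y in 𝓝 q, k +ᵥ s y ∈ L.target :=
    hd.eventually_mem (L.open_target.mem_nhds (by rw [hk]; exact hzt))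
  filter_upwards [hs, hmem] with y hy hyt
  have h1 := L.right_inv hyt
  rw [hLdef, IsLocalHomeomorph.localInverseAt_symm] at h1
  have h2 : Quotient.mk _ (k +ᵥ s y) = y := (coverProj_vadd ψ k (s y)).trans hy
  rw [h2] at h1
  rw [Function.comp_apply, hLdef, h1, neg_vadd_vadd]

/-- The projection `N × ℝ → N_ψ` as a diffeomorphism near a point. -/
def coverPartialDiffeomorph (z : TorusCover ψ) :
    PartialDiffeomorph (I.prod 𝓘(ℝ, ℝ)) (I.prod 𝓘(ℝ, ℝ)) (TorusCover ψ) (MappingTorus ψ) ∞ where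
  toPartialEquiv := ((isLocalHomeomorph_mk ψ).localInverseAt z).symm.toPartialEquiv
  open_source := ((isLocalHomeomorph_mk ψ).localInverseAt z).open_target
  open_target := ((isLocalHomeomorph_mk ψ).localInverseAt z).open_source
  contMDiffOn_toFun := by
    have h := (contMDiff_coverProj ψ).contMDiffOn
      (s := ((isLocalHomeomorph_mk ψ).localInverseAt z).target)
    refine h.congr fun y _ ↦ ?_
    exact congrFun ((isLocalHomeomorph_mk ψ).localInverseAt_symm z) y
  contMDiffOn_invFun := by
    intro q hq
    have hn := ((isLocalHomeomorph_mk ψ).localInverseAt z).open_source.mem_nhds hq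
    refine (contMDiffAt_of_section ψ
      (((isLocalHomeomorph_mk ψ).localInverseAt z).continuousAt hq) ?_).contMDiffWithinAt
    filter_upwards [hn] with y hy
    exact (isLocalHomeomorph_mk ψ).apply_localInverseAt_of_mem hy

theorem isLocalDiffeomorph_coverProj :
    IsLocalDiffeomorph (I.prod 𝓘(ℝ, ℝ)) (I.prod 𝓘(ℝ, ℝ)) ∞ (coverProj ψ) := by
  intro z
  refine ⟨coverPartialDiffeomorph ψ z, ?_, ?_⟩
  · exact IsLocalHomeomorph.self_mem_localInverseAt_target _
  · intro y _
    exact (congrFun ((isLocalHomeomorph_mk ψ).localInverseAt_symm z) y).symm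

end Torus

/-! ### Polar coordinates -/

section Polar

set_option maxSynthPendingDepth 3

theorem contMDiff_logb_norm : ContMDiff 𝓘(ℝ, ℍ[ℝ]) 𝓘(ℝ, ℝ) ∞
    (fun x : puncturedQuaternions ↦ Real.logb 2 ‖(x : ℍ[ℝ])‖) := by
  intro x
  have hx : (x : ℍ[ℝ]) ≠ 0 := x.2
  have h1 : ContDiffAt ℝ ∞ (fun y : ℍ[ℝ] ↦ Real.logb 2 ‖y‖) (x : ℍ[ℝ]) :=
    ((contDiffAt_norm ℝ hx).log (by simpa using hx)).div_const _
  exact h1.contMDiffAt.comp x contMDiff_subtype_val.contMDiffAt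

theorem contMDiff_radialProj : ContMDiff 𝓘(ℝ, ℍ[ℝ]) (𝓡 3) ∞ radialProj := by
  have h : ContMDiff 𝓘(ℝ, ℍ[ℝ]) 𝓘(ℝ, ℍ[ℝ]) ∞
      (fun x : puncturedQuaternions ↦ ‖(x : ℍ[ℝ])‖⁻¹ • (x : ℍ[ℝ])) := by
    intro x
    have hx : (x : ℍ[ℝ]) ≠ 0 := x.2
    have h1 : ContDiffAt ℝ ∞ (fun y : ℍ[ℝ] ↦ ‖y‖⁻¹ • y) (x : ℍ[ℝ]) :=
      ((contDiffAt_norm ℝ hx).inv (by simpa using hx)).smul contDiffAt_id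
    exact h1.contMDiffAt.comp x contMDiff_subtype_val.contMDiffAt
  exact h.codRestrict_sphere fun x ↦ (radialProj x).2

/-- The point `2^t s` of `ℍ ∖ {0}` with polar coordinates `(t, s)`. -/
def ofPolar (z : ℝ × S3) : puncturedQuaternions :=
  ⟨(2 : ℝ) ^ z.1 • (z.2 : ℍ[ℝ]), by
    have h2 : (0 : ℝ) < 2 ^ z.1 := Real.rpow_pos_of_pos two_pos _
    have hs : (z.2 : ℍ[ℝ]) ≠ 0 := ne_zero_of_mem_unit_sphere z.2
    exact smul_ne_zero h2.ne' hs⟩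

theorem contMDiff_ofPolar : ContMDiff (𝓘(ℝ, ℝ).prod (𝓡 3)) 𝓘(ℝ, ℍ[ℝ]) ∞ ofPolar := by
  intro z
  rw [← ContMDiffAt.subtypeVal_comp_iff]
  have h1 : ContMDiff 𝓘(ℝ, ℝ) 𝓘(ℝ, ℝ) ∞ (fun t : ℝ ↦ (2 : ℝ) ^ t) :=
    (contDiff_const.rpow contDiff_id fun _ ↦ two_ne_zero).contMDiff
  exact ((h1.comp contMDiff_fst).smul (contMDiff_coe_sphere.comp contMDiff_snd)).contMDiffAt

theorem ofPolar_logb_radialProj (x : puncturedQuaternions) :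
    ofPolar (Real.logb 2 ‖(x : ℍ[ℝ])‖, radialProj x) = x := by
  have hx : 0 < ‖(x : ℍ[ℝ])‖ := norm_pos_iff.2 x.2
  apply Subtype.ext
  change (2 : ℝ) ^ Real.logb 2 ‖(x : ℍ[ℝ])‖ • ‖(x : ℍ[ℝ])‖⁻¹ • (x : ℍ[ℝ]) = x
  rw [Real.rpow_logb two_pos (by norm_num) hx, smul_inv_smul₀ hx.ne']

theorem norm_ofPolar (z : ℝ × S3) : ‖(ofPolar z : ℍ[ℝ])‖ = 2 ^ z.1 := by
  change ‖(2 : ℝ) ^ z.1 • (z.2 : ℍ[ℝ])‖ = _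
  rw [norm_smul, norm_eq_of_mem_sphere, mul_one, Real.norm_of_nonneg (by positivity)]

theorem logb_norm_ofPolar (z : ℝ × S3) : Real.logb 2 ‖(ofPolar z : ℍ[ℝ])‖ = z.1 := by
  rw [norm_ofPolar, Real.logb_rpow two_pos (by norm_num)]

theorem radialProj_ofPolar (z : ℝ × S3) : radialProj (ofPolar z) = z.2 := by
  apply Subtype.ext
  change ‖(ofPolar z : ℍ[ℝ])‖⁻¹ • (2 : ℝ) ^ z.1 • (z.2 : ℍ[ℝ]) = _
  rw [norm_ofPolar, inv_smul_smul₀ (by positivity)]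

/-- The differential of the inclusion of `ℍ ∖ {0}` in `ℍ` is the identity. -/
theorem hasMFDerivAt_subtypeVal (x : puncturedQuaternions) :
    HasMFDerivAt 𝓘(ℝ, ℍ[ℝ]) 𝓘(ℝ, ℍ[ℝ]) (Subtype.val : puncturedQuaternions → ℍ[ℝ]) x
      (ContinuousLinearMap.id ℝ ℍ[ℝ]) := by
  refine ⟨continuous_subtype_val.continuousAt, ?_⟩
  have h : writtenInExtChartAt 𝓘(ℝ, ℍ[ℝ]) 𝓘(ℝ, ℍ[ℝ]) x
      (Subtype.val : puncturedQuaternions → ℍ[ℝ]) =ᶠ[𝓝 (extChartAt 𝓘(ℝ, ℍ[ℝ]) x x)] id := by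
    filter_upwards [extChartAt_target_mem_nhds x] with y hy
    exact (extChartAt 𝓘(ℝ, ℍ[ℝ]) x).right_inv hy
  exact ((hasFDerivAt_id _).congr_of_eventuallyEq h).hasFDerivWithinAt

end Polar

/-! ### The projection onto the product of the mapping torus and the sphere -/

section Projection

variable {E : Type*} [NormedAddCommGroup E] [NormedSpace ℝ E]
  {H : Type*} [TopologicalSpace H] {I : ModelWithCorners ℝ E H}
  {N : Type*} [TopologicalSpace N] [ChartedSpace H N] (ψ : N ≃ₘ^∞⟮I, I⟯ N)

/-- Polar coordinates on the second factor, as a diffeomorphism. -/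
def polarDiffeomorph : (N × puncturedQuaternions) ≃ₘ^∞⟮I.prod 𝓘(ℝ, ℍ[ℝ]),
    (I.prod 𝓘(ℝ, ℝ)).prod (𝓡 3)⟯ (TorusCover ψ × S3) where
  toFun z := (((z.1, Real.logb 2 ‖(z.2 : ℍ[ℝ])‖) : N × ℝ), radialProj z.2)
  invFun z := ((z.1 : N × ℝ).1, ofPolar ((z.1 : N × ℝ).2, z.2))
  left_inv z := Prod.ext rfl (ofPolar_logb_radialProj z.2)
  right_inv z := Prod.ext (Prod.ext rfl (logb_norm_ofPolar ((z.1 : N × ℝ).2, z.2)))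
    (radialProj_ofPolar ((z.1 : N × ℝ).2, z.2))
  contMDiff_toFun := by
    have h1 : ContMDiff (I.prod 𝓘(ℝ, ℍ[ℝ])) (I.prod 𝓘(ℝ, ℝ)) ∞
        (fun z : N × puncturedQuaternions ↦ ((z.1, Real.logb 2 ‖(z.2 : ℍ[ℝ])‖) : N × ℝ)) :=
      contMDiff_fst.prodMk (contMDiff_logb_norm.comp contMDiff_snd)
    have h2 : ContMDiff (I.prod 𝓘(ℝ, ℍ[ℝ])) (𝓡 3) ∞
        (fun z : N × puncturedQuaternions ↦ radialProj z.2) :=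
      contMDiff_radialProj.comp contMDiff_snd
    exact h1.prodMk h2
  contMDiff_invFun := by
    have h1 : ContMDiff ((I.prod 𝓘(ℝ, ℝ)).prod (𝓡 3)) (I.prod 𝓘(ℝ, ℍ[ℝ])) ∞
        (fun z : (N × ℝ) × S3 ↦ (z.1.1, ofPolar (z.1.2, z.2))) :=
      (contMDiff_fst.comp contMDiff_fst).prodMk (contMDiff_ofPolar.comp
        ((contMDiff_snd.comp contMDiff_fst).prodMk contMDiff_snd))
    exact h1

/-- The product of a partial diffeomorphism with the identity of `M₃`. -/
def partialDiffeomorphProdRefl {E₁ E₂ E₃ : Type*} [NormedAddCommGroup E₁] [NormedSpace ℝ E₁]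
    [NormedAddCommGroup E₂] [NormedSpace ℝ E₂] [NormedAddCommGroup E₃] [NormedSpace ℝ E₃]
    {H₁ H₂ H₃ : Type*} [TopologicalSpace H₁] [TopologicalSpace H₂] [TopologicalSpace H₃]
    {I₁ : ModelWithCorners ℝ E₁ H₁} {I₂ : ModelWithCorners ℝ E₂ H₂}
    {M₁ M₂ : Type*} [TopologicalSpace M₁] [TopologicalSpace M₂]
    [ChartedSpace H₁ M₁] [ChartedSpace H₂ M₂]
    (I₃ : ModelWithCorners ℝ E₃ H₃) (M₃ : Type*) [TopologicalSpace M₃] [ChartedSpace H₃ M₃]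
    (Φ : PartialDiffeomorph I₁ I₂ M₁ M₂ ∞) :
    PartialDiffeomorph (I₁.prod I₃) (I₂.prod I₃) (M₁ × M₃) (M₂ × M₃) ∞ where
  toPartialEquiv := Φ.toPartialEquiv.prod (PartialEquiv.refl M₃)
  open_source := Φ.open_source.prod isOpen_univ
  open_target := Φ.open_target.prod isOpen_univ
  contMDiffOn_toFun := Φ.contMDiffOn_toFun.prodMap (contMDiffOn_id (s := Set.univ))
  contMDiffOn_invFun := Φ.contMDiffOn_invFun.prodMap (contMDiffOn_id (s := Set.univ))

variable [T2Space N] [LocallyCompactSpace N] [IsManifold I ∞ N]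

/-- In polar coordinates `ℍ ∖ {0} ≃ ℝ × S³` the map is the product of the projection of the cover
onto the mapping torus and of the identity of `S³`. -/
theorem isLocalDiffeomorph_torusProj : IsLocalDiffeomorph (I.prod 𝓘(ℝ, ℍ[ℝ]))
    ((I.prod 𝓘(ℝ, ℝ)).prod (𝓡 3)) ∞ (torusProj ψ) := by
  intro z
  have h1 := (polarDiffeomorph ψ).isLocalDiffeomorph z
  obtain ⟨Φ, hz, hΦ⟩ := isLocalDiffeomorph_coverProj ψ (polarDiffeomorph ψ z).1
  have h2 : IsLocalDiffeomorphAt ((I.prod 𝓘(ℝ, ℝ)).prod (𝓡 3)) ((I.prod 𝓘(ℝ, ℝ)).prod (𝓡 3)) ∞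
      (Prod.map (coverProj ψ) (id : S3 → S3)) (polarDiffeomorph ψ z) := by
    refine ⟨partialDiffeomorphProdRefl (𝓡 3) S3 Φ, ⟨hz, trivial⟩, ?_⟩
    rintro ⟨a, b⟩ ⟨ha, -⟩
    exact Prod.ext (hΦ ha) rfl
  exact h1.comp _ _ h2

omit [T2Space N] [LocallyCompactSpace N] [IsManifold I ∞ N] in
theorem surjective_torusProj : Function.Surjective (torusProj ψ) := by
  rintro ⟨q, s⟩
  obtain ⟨w, rfl⟩ := Quotient.mk_surjective q
  obtain ⟨z, hz⟩ := (polarDiffeomorph ψ).surjective (w, s)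
  refine ⟨z, ?_⟩
  have h : torusProj ψ z = Prod.map (coverProj ψ) id (polarDiffeomorph ψ z) := rfl
  exact h.trans (congrArg (Prod.map (coverProj ψ) id) hz)

omit [T2Space N] [LocallyCompactSpace N] [IsManifold I ∞ N] in
/-- Two points with the same image differ by the action `k · (p, x) = (ψ^k p, 2^k x)`. -/
theorem exists_zpow_of_torusProj_eq {p p' : N} {x x' : puncturedQuaternions}
    (h : torusProj ψ (p', x') = torusProj ψ (p, x)) : ∃ k : ℤ,
      p' = (ψ.toEquiv ^ k : Equiv.Perm N) p ∧ (x' : ℍ[ℝ]) = (2 : ℝ) ^ k • (x : ℍ[ℝ]) := by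
  obtain ⟨k, hk⟩ := (coverProj_eq_iff ψ).1 (congrArg Prod.fst h)
  have hk' : (((ψ.toEquiv ^ k : Equiv.Perm N) p, Real.logb 2 ‖(x : ℍ[ℝ])‖ + k) : N × ℝ) =
    (p', Real.logb 2 ‖(x' : ℍ[ℝ])‖) := hk
  rw [Prod.mk.injEq] at hk'
  have hr : radialProj x' = radialProj x := congrArg Prod.snd h
  refine ⟨k, hk'.1.symm, ?_⟩
  rw [← ofPolar_logb_radialProj x', hr, ← hk'.2]
  conv_rhs => rw [← ofPolar_logb_radialProj x]
  change (2 : ℝ) ^ (_ + (k : ℝ)) • _ = (2 : ℝ) ^ k • (2 : ℝ) ^ _ • _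
  rw [Real.rpow_add two_pos, smul_smul, mul_comm, Real.rpow_intCast]

end Projection

/-! ### Charts of the quotient -/

section AdaptedCharts

variable {E : Type*} [NormedAddCommGroup E] [NormedSpace ℝ E]
  {H : Type*} [TopologicalSpace H] {I : ModelWithCorners ℝ E H}
  {N : Type*} [TopologicalSpace N] [ChartedSpace H N] (ψ : N ≃ₘ^∞⟮I, I⟯ N)
  [T2Space N] [LocallyCompactSpace N]
  {F : Type*} [NormedAddCommGroup F] [NormedSpace ℝ F]

/-- The chart `Φ` of `N_ψ × S³` is adapted to the chart `φ` of `N`: in terms of local lifts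
`(p, x)` to `N × (ℍ ∖ {0})`, it is given by `(p, x) ↦ (φ p, x)`. -/
structure IsAdaptedChart (φ : OpenPartialHomeomorph N F)
    (Φ : OpenPartialHomeomorph (MappingTorus ψ × S3) (F × ℍ[ℝ])) : Prop where
  isSmoothChart : IsSmoothChart ((I.prod 𝓘(ℝ, ℝ)).prod (𝓡 3)) Φ
  exists_lift : ∀ y ∈ Φ.source, ∃ (p : N) (x : puncturedQuaternions), torusProj ψ (p, x) = y ∧
    p ∈ φ.source ∧ Φ y = (φ p, (x : ℍ[ℝ])) ∧ ∀ (v : TangentSpace I p) (w : ℍ[ℝ]),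
      dChart ((I.prod 𝓘(ℝ, ℝ)).prod (𝓡 3)) Φ (torusProj ψ (p, x)) (dTorusProj ψ p x v w) =
        (dChart I φ p v, w)

variable [IsManifold I ∞ N]

/-- Every chart of `N` at `p` and every `x` give an adapted chart at the image of `(p, x)`. -/
theorem exists_isAdaptedChart {φ : OpenPartialHomeomorph N F} (hφ : IsSmoothChart I φ) {p : N}
    (hp : p ∈ φ.source) (x : puncturedQuaternions) :
    ∃ Φ : OpenPartialHomeomorph (MappingTorus ψ × S3) (F × ℍ[ℝ]), IsAdaptedChart ψ φ Φ ∧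
      torusProj ψ (p, x) ∈ Φ.source ∧ Φ (torusProj ψ (p, x)) = (φ p, (x : ℍ[ℝ])) := by
  obtain ⟨Ψ, hz, hΨ⟩ := isLocalDiffeomorph_torusProj ψ (p, x)
  set e := φ.prod (chartAt ℍ[ℝ] x) with he
  set Φ := Ψ.toOpenPartialHomeomorph.symm.trans e with hΦ
  have hsrc : ∀ y, y ∈ Φ.source ↔ y ∈ Ψ.target ∧ Ψ.invFun y ∈ e.source := fun y ↦ by
    rw [hΦ, OpenPartialHomeomorph.trans_source]; rfl
  have hval : ∀ y, Φ y = (φ (Ψ.invFun y).1, ((Ψ.invFun y).2 : ℍ[ℝ])) := fun y ↦ rfl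
  have hleft : ∀ z ∈ Ψ.source, Ψ.invFun (torusProj ψ z) = z := fun z hzs ↦ by
    rw [hΨ hzs]; exact Ψ.left_inv hzs
  have hmap : ∀ z ∈ Ψ.source, torusProj ψ z ∈ Ψ.target := fun z hzs ↦ by
    rw [hΨ hzs]; exact Ψ.map_source hzs
  have hes : (p, x) ∈ e.source := ⟨hp, mem_chart_source _ x⟩
  have hs : IsSmoothChart ((I.prod 𝓘(ℝ, ℝ)).prod (𝓡 3)) Φ := by
    constructor
    · have h1 : ContMDiffOn (I.prod 𝓘(ℝ, ℍ[ℝ])) 𝓘(ℝ, F × ℍ[ℝ]) ∞ e e.source := by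
        have h2 : ContMDiffOn (I.prod 𝓘(ℝ, ℍ[ℝ])) 𝓘(ℝ, F) ∞
            (fun z : N × puncturedQuaternions ↦ φ z.1) e.source :=
          hφ.contMDiffOn.comp contMDiff_fst.contMDiffOn fun z hz ↦ hz.1
        exact h2.prodMk_space (contMDiff_subtype_val.comp contMDiff_snd).contMDiffOn
      exact h1.comp (Ψ.contMDiffOn_invFun.mono fun y hy ↦ ((hsrc y).1 hy).1)
        fun y hy ↦ ((hsrc y).1 hy).2
    · have h1 : ContMDiffOn 𝓘(ℝ, F × ℍ[ℝ]) (I.prod 𝓘(ℝ, ℍ[ℝ])) ∞ e.symm e.target := by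
        have h2 : ContMDiffOn 𝓘(ℝ, F × ℍ[ℝ]) I ∞ (fun z : F × ℍ[ℝ] ↦ φ.symm z.1) e.target :=
          hφ.contMDiffOn_symm.comp contDiff_fst.contMDiff.contMDiffOn fun z hz ↦ hz.1
        have h3 : ContMDiffOn 𝓘(ℝ, F × ℍ[ℝ]) 𝓘(ℝ, ℍ[ℝ]) ∞
            (fun z : F × ℍ[ℝ] ↦ (chartAt ℍ[ℝ] x).symm z.2) e.target :=
          (contMDiffOn_chart_symm (I := 𝓘(ℝ, ℍ[ℝ])) (x := x)).comp
            contDiff_snd.contMDiff.contMDiffOn fun z hz ↦ hz.2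
        exact h2.prodMk h3
      have h4 : ∀ y ∈ Φ.target, y ∈ e.target ∧ e.symm y ∈ Ψ.source := fun y hy ↦ by
        rw [hΦ, OpenPartialHomeomorph.trans_target] at hy; exact hy
      exact Ψ.contMDiffOn_toFun.comp (h1.mono fun y hy ↦ (h4 y hy).1) fun y hy ↦ (h4 y hy).2
  refine ⟨Φ, ⟨hs, fun y hy ↦ ?_⟩, (hsrc _).2 ⟨hmap _ hz, ?_⟩, ?_⟩
  · obtain ⟨hyt, hye⟩ := (hsrc y).1 hy
    set z := Ψ.invFun y with hzy
    have hzs : z ∈ Ψ.source := Ψ.map_target hyt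
    have hyz : torusProj ψ z = y := (hΨ hzs).trans (Ψ.right_inv hyt)
    refine ⟨z.1, z.2, hyz, hye.1, hval y, fun v w ↦ ?_⟩
    have h1 : HasMFDerivAt (I.prod 𝓘(ℝ, ℍ[ℝ])) 𝓘(ℝ, F × ℍ[ℝ])
        (fun z : N × puncturedQuaternions ↦ (φ z.1, (z.2 : ℍ[ℝ]))) z
        ((dChart I φ z.1 ∘L .fst ℝ E ℍ[ℝ]).prod
          (.id ℝ ℍ[ℝ] ∘L .snd ℝ E ℍ[ℝ])) := by
      have h2 : HasMFDerivAt (I.prod 𝓘(ℝ, ℍ[ℝ])) 𝓘(ℝ, F)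
          (fun z : N × puncturedQuaternions ↦ φ z.1) z (dChart I φ z.1 ∘L .fst ℝ E ℍ[ℝ]) :=
        (hφ.mdifferentiableAt hye.1).hasMFDerivAt.comp z (hasMFDerivAt_fst z)
      have h3 : HasMFDerivAt (I.prod 𝓘(ℝ, ℍ[ℝ])) 𝓘(ℝ, ℍ[ℝ])
          (fun z : N × puncturedQuaternions ↦ (z.2 : ℍ[ℝ])) z (.id ℝ ℍ[ℝ] ∘L .snd ℝ E ℍ[ℝ]) :=
        (hasMFDerivAt_subtypeVal z.2).comp z (hasMFDerivAt_snd z)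
      exact ⟨h2.1.prodMk h3.1, h2.2.prodMk h3.2⟩
    have h2 : MDifferentiableAt (I.prod 𝓘(ℝ, ℍ[ℝ])) ((I.prod 𝓘(ℝ, ℝ)).prod (𝓡 3))
        (torusProj ψ) z := (isLocalDiffeomorph_torusProj ψ z).mdifferentiableAt (by simp)
    have h3 : MDifferentiableAt ((I.prod 𝓘(ℝ, ℝ)).prod (𝓡 3)) 𝓘(ℝ, F × ℍ[ℝ]) Φ
        (torusProj ψ z) := hs.mdifferentiableAt (by rwa [hyz])
    have h4 := h3.hasMFDerivAt.comp z h2.hasMFDerivAt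
    have h5 : Φ ∘ torusProj ψ =ᶠ[𝓝 z]
        (fun z : N × puncturedQuaternions ↦ (φ z.1, (z.2 : ℍ[ℝ]))) := by
      filter_upwards [Ψ.open_source.mem_nhds hzs] with z' hz'
      rw [Function.comp_apply, hval, hleft z' hz']
    have h6 := hasMFDerivAt_unique h4 (h1.congr_of_eventuallyEq h5)
    exact DFunLike.congr_fun h6 (v, w)
  · rw [hleft _ hz]; exact hes
  · rw [hval, hleft _ hz]

variable {ψ} in
omit [IsManifold I ∞ N] in
/-- Since a chart is injective, the lift in the definition of an adapted chart is the one with the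
given coordinates. -/
theorem IsAdaptedChart.dChart_dTorusProj {φ : OpenPartialHomeomorph N F}
    {Φ : OpenPartialHomeomorph (MappingTorus ψ × S3) (F × ℍ[ℝ])} (hΦ : IsAdaptedChart ψ φ Φ)
    {p : N} (hp : p ∈ φ.source) {x : puncturedQuaternions} (hx : torusProj ψ (p, x) ∈ Φ.source)
    (h : Φ (torusProj ψ (p, x)) = (φ p, (x : ℍ[ℝ]))) (v : TangentSpace I p) (w : ℍ[ℝ]) :
      dChart ((I.prod 𝓘(ℝ, ℝ)).prod (𝓡 3)) Φ (torusProj ψ (p, x)) (dTorusProj ψ p x v w) =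
        (dChart I φ p v, w) := by
  obtain ⟨p', x', -, hp', h', hd⟩ := hΦ.exists_lift _ hx
  rw [h, Prod.mk.injEq] at h'
  obtain rfl := φ.injOn hp hp' h'.1
  obtain rfl := Subtype.ext h'.2
  exact hd v w

end AdaptedCharts

/-! ### The deck transformations -/

section Deck

/-- Multiplication by a nonzero real number on `ℍ ∖ {0}`. -/
def scalePunctured (c : ℝ) (hc : c ≠ 0) (x : puncturedQuaternions) : puncturedQuaternions :=
  ⟨c • (x : ℍ[ℝ]), smul_ne_zero hc x.2⟩

theorem hasMFDerivAt_scalePunctured {c : ℝ} (hc : c ≠ 0) (x : puncturedQuaternions) :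
    HasMFDerivAt 𝓘(ℝ, ℍ[ℝ]) 𝓘(ℝ, ℍ[ℝ]) (scalePunctured c hc) x
      (c • ContinuousLinearMap.id ℝ ℍ[ℝ]) := by
  have h1 : ContMDiffAt 𝓘(ℝ, ℍ[ℝ]) 𝓘(ℝ, ℍ[ℝ]) ∞ (scalePunctured c hc) x := by
    rw [← ContMDiffAt.subtypeVal_comp_iff]
    exact (contDiff_const_smul c).contMDiff.contMDiffAt.comp x contMDiff_subtype_val.contMDiffAt
  have h2 := (h1.mdifferentiableAt (by simp)).hasMFDerivAt
  have h3 := (hasMFDerivAt_subtypeVal (scalePunctured c hc x)).comp x h2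
  have h4 : HasMFDerivAt 𝓘(ℝ, ℍ[ℝ]) 𝓘(ℝ, ℍ[ℝ]) (Subtype.val ∘ scalePunctured c hc) x
      (c • ContinuousLinearMap.id ℝ ℍ[ℝ]) :=
    (hasMFDerivAt_subtypeVal x).const_smul c
  have h5 := hasMFDerivAt_unique h3 h4
  rw [← h5]
  exact h2

variable {E : Type*} [NormedAddCommGroup E] [NormedSpace ℝ E]
  {H : Type*} [TopologicalSpace H] {I : ModelWithCorners ℝ E H}
  {N : Type*} [TopologicalSpace N] [ChartedSpace H N] (ψ : N ≃ₘ^∞⟮I, I⟯ N)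

/-- The projection is invariant under `(p, x) ↦ (ψ^k p, 2^k x)`. -/
theorem torusProj_deck (k : ℤ) (p : N) (x : puncturedQuaternions) :
    torusProj ψ ((ψ.toEquiv ^ k : Equiv.Perm N) p,
      scalePunctured (2 ^ k) (zpow_ne_zero k two_ne_zero) x) = torusProj ψ (p, x) := by
  have h2 : (0 : ℝ) < 2 ^ k := zpow_pos two_pos k
  have hx : 0 < ‖(x : ℍ[ℝ])‖ := norm_pos_iff.2 x.2
  have hn : ‖((scalePunctured (2 ^ k) (zpow_ne_zero k two_ne_zero) x : puncturedQuaternions) :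
      ℍ[ℝ])‖ = 2 ^ k * ‖(x : ℍ[ℝ])‖ := by
    change ‖(2 : ℝ) ^ k • (x : ℍ[ℝ])‖ = _
    rw [norm_smul, Real.norm_of_nonneg h2.le]
  refine Prod.ext ?_ (Subtype.ext ?_)
  · refine (coverProj_eq_iff ψ).2 ⟨k, ?_⟩
    refine Prod.ext rfl ?_
    change Real.logb 2 ‖(x : ℍ[ℝ])‖ + k = Real.logb 2 _
    rw [hn, Real.logb_mul h2.ne' hx.ne', ← Real.rpow_intCast, Real.logb_rpow two_pos (by norm_num),
      add_comm]
  · change ‖_‖⁻¹ • (2 : ℝ) ^ k • (x : ℍ[ℝ]) = ‖(x : ℍ[ℝ])‖⁻¹ • (x : ℍ[ℝ])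
    rw [hn, smul_smul]
    congr 1
    field_simp

variable [T2Space N] [LocallyCompactSpace N] [IsManifold I ∞ N]

theorem dTorusProj_deck (k : ℤ) (p : N) (x : puncturedQuaternions) (v : TangentSpace I p)
    (w : ℍ[ℝ]) :
    (dTorusProj ψ ((ψ.toEquiv ^ k : Equiv.Perm N) p)
      (scalePunctured (2 ^ k) (zpow_ne_zero k two_ne_zero) x)
      (mfderiv I I (ψ.toEquiv ^ k : Equiv.Perm N) p v) ((2 : ℝ) ^ k • w) :
        (E × ℝ) × EuclideanSpace ℝ (Fin 3)) = dTorusProj ψ p x v w := by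
  have hs := hasMFDerivAt_scalePunctured (zpow_ne_zero (G₀ := ℝ) k two_ne_zero) x
  have h1 := HasMFDerivAt.prodMap (p := (p, x))
      (((contMDiff_zpow ψ k).mdifferentiable (by simp)) p).hasMFDerivAt hs
  have h2 := ((isLocalDiffeomorph_torusProj ψ _).mdifferentiableAt (by simp)).hasMFDerivAt.comp
    (p, x) h1
  have h3 := h2.congr_of_eventuallyEq (f₁ := torusProj ψ)
    (Filter.Eventually.of_forall fun z ↦ (torusProj_deck ψ k z.1 z.2).symm)
  have h4 := (DFunLike.congr_fun h3.mfderiv (v, w)).symm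
  refine Eq.trans ?_ h4
  exact congrArg (fun w' : ℍ[ℝ] ↦ (dTorusProj ψ ((ψ.toEquiv ^ k : Equiv.Perm N) p)
      (scalePunctured (2 ^ k) (zpow_ne_zero k two_ne_zero) x)
      (mfderiv I I (ψ.toEquiv ^ k : Equiv.Perm N) p v) w' :
        (E × ℝ) × EuclideanSpace ℝ (Fin 3))) (DFunLike.congr_fun hs.mfderiv w).symm

end Deck

/-! ### Powers of a hyperkähler isometry -/

section Isometry

variable {E : Type*} [NormedAddCommGroup E] [NormedSpace ℝ E]
  {H : Type*} [TopologicalSpace H] {I : ModelWithCorners ℝ E H}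
  {N : Type*} [TopologicalSpace N] [ChartedSpace H N] [IsManifold I ∞ N]
  {g : SmoothMetric I N} {A : Fin 3 → EndField I N} {ψ : N ≃ₘ^∞⟮I, I⟯ N}

/-- The map `f` preserves the metric `g` and the complex structures `A`. -/
def PreservesHyperkahler (g : SmoothMetric I N) (A : Fin 3 → EndField I N) (f : N → N) : Prop :=
  (∀ (p : N) (u v : TangentSpace I p),
    g.inner (f p) (mfderiv I I f p u) (mfderiv I I f p v) = g.inner p u v) ∧
  ∀ (a : Fin 3) (p : N) (u : TangentSpace I p),
    mfderiv I I f p (A a p u) = A a (f p) (mfderiv I I f p u)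

/-- Composition with `ψ` neither creates nor destroys compatibility with the hyperkähler structure;
the equivalence allows for induction in both directions on the powers of `ψ`. -/
theorem IsHyperkahlerIsometry.comp_iff (hψ : IsHyperkahlerIsometry g A ψ) {f : N → N}
    (hf : MDifferentiable I I f) :
    PreservesHyperkahler g A (ψ ∘ f) ↔ PreservesHyperkahler g A f := by
  have hψd := ψ.contMDiff.mdifferentiable (n := ∞) (by simp)
  have hd : ∀ (p : N) (u : TangentSpace I p),
      mfderiv I I (ψ ∘ f) p u = mfderiv I I ψ (f p) (mfderiv I I f p u) := fun p u ↦
    DFunLike.congr_fun (((hψd _).hasMFDerivAt.comp p (hf p).hasMFDerivAt).mfderiv) u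
  have hinj : ∀ p : N, Function.Injective (mfderiv I I ψ p) := fun p ↦
    (ψ.mfderivToContinuousLinearEquiv (by simp) p).injective
  unfold PreservesHyperkahler
  refine and_congr ?_ ?_
  · refine forall_congr' fun p ↦ forall₂_congr fun u v ↦ ?_
    rw [hd p u, hd p v]
    exact (hψ.isometry (f p) _ _).congr_left
  · refine forall_congr' fun a ↦ forall₂_congr fun p u ↦ ?_
    rw [hd p u, hd p (A a p u)]
    refine Iff.trans ?_ (hinj (f p)).eq_iff
    exact (hψ.holomorphic a (f p) (mfderiv I I f p u)).symm.congr_right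

theorem IsHyperkahlerIsometry.zpow (hψ : IsHyperkahlerIsometry g A ψ) (k : ℤ) :
    PreservesHyperkahler g A (ψ.toEquiv ^ k : Equiv.Perm N) := by
  have hd : ∀ (k : ℤ), MDifferentiable I I (ψ.toEquiv ^ k : Equiv.Perm N) := fun k ↦
    (contMDiff_zpow ψ k).mdifferentiable (by simp)
  have hs : ∀ k : ℤ, PreservesHyperkahler g A (ψ.toEquiv ^ (k + 1) : Equiv.Perm N) ↔
      PreservesHyperkahler g A (ψ.toEquiv ^ k : Equiv.Perm N) := by
    intro k
    rw [← hψ.comp_iff (hd k), add_comm, zpow_add, zpow_one]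
    rfl
  induction k using Int.induction_on with
  | zero =>
    have h : ((ψ.toEquiv ^ (0 : ℤ) : Equiv.Perm N) : N → N) = id := by rw [zpow_zero]; rfl
    rw [h]
    have h' : ∀ (p : N) (u : TangentSpace I p), mfderiv I I id p u = u := fun p u ↦ by
      rw [mfderiv_id]; rfl
    exact ⟨fun p u v ↦ congrArg₂ (fun u v : E ↦ g.inner p u v) (h' p u) (h' p v),
      fun a p u ↦ (h' p _).trans (congrArg (fun u : E ↦ (A a p u : E)) (h' p u).symm)⟩
  | succ n ih => exact (hs n).2 ih
  | pred n ih => exact (hs (-n - 1)).1 (by rwa [sub_add_cancel])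

end Isometry

/-! ### Descent of tensors to the quotient -/

section Descent

set_option maxSynthPendingDepth 3

/-- The orthogonal sum of two bilinear forms. -/
def sumBilin {V W : Type*} [NormedAddCommGroup V] [NormedSpace ℝ V] [NormedAddCommGroup W]
    [NormedSpace ℝ W] (B₁ : V →L[ℝ] V →L[ℝ] ℝ) (B₂ : W →L[ℝ] W →L[ℝ] ℝ) :
    V × W →L[ℝ] V × W →L[ℝ] ℝ :=
  B₁.bilinearComp (.fst ℝ V W) (.fst ℝ V W) + B₂.bilinearComp (.snd ℝ V W) (.snd ℝ V W)

theorem sumBilin_apply {V W : Type*} [NormedAddCommGroup V] [NormedSpace ℝ V]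
    [NormedAddCommGroup W] [NormedSpace ℝ W] (B₁ : V →L[ℝ] V →L[ℝ] ℝ) (B₂ : W →L[ℝ] W →L[ℝ] ℝ)
    (a b : V × W) : sumBilin B₁ B₂ a b = B₁ a.1 b.1 + B₂ a.2 b.2 := rfl

variable {E : Type*} [NormedAddCommGroup E] [NormedSpace ℝ E]
  {H : Type*} [TopologicalSpace H] {I : ModelWithCorners ℝ E H}
  {N : Type*} [TopologicalSpace N] [ChartedSpace H N] (ψ : N ≃ₘ^∞⟮I, I⟯ N)

/-- The value at `p` of a field of endomorphisms, as an endomorphism of the model space. The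
tangent spaces at two points `p`, `p'` are thereby the same type. -/
def endAt (A : EndField I N) (p : N) : E →L[ℝ] E := A p

/-- The value at `p` of a metric, as a bilinear form on the model space. -/
def metricAt [IsManifold I ∞ N] (g : SmoothMetric I N) (p : N) : E →L[ℝ] E →L[ℝ] ℝ := g.inner p

variable [T2Space N] [LocallyCompactSpace N] [IsManifold I ∞ N]

/-- The differential of `torusProj` as an isomorphism of the model spaces. -/
def dTorusProjEquiv (p : N) (x : puncturedQuaternions) :
    (E × ℍ[ℝ]) ≃L[ℝ] (E × ℝ) × EuclideanSpace ℝ (Fin 3) :=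
  (isLocalDiffeomorph_torusProj ψ (p, x)).mfderivToContinuousLinearEquiv (by simp)

theorem dTorusProjEquiv_apply (p : N) (x : puncturedQuaternions) (v : TangentSpace I p)
    (w : ℍ[ℝ]) :
    dTorusProjEquiv ψ p x ((v, w) : E × ℍ[ℝ]) = dTorusProj ψ p x v w :=
  DFunLike.congr_fun ((isLocalDiffeomorph_torusProj ψ
    (p, x)).mfderivToContinuousLinearEquiv_coe (by simp)) (v, w)

theorem exists_dTorusProj_eq (p : N) (x : puncturedQuaternions)
    (u : TangentSpace ((I.prod 𝓘(ℝ, ℝ)).prod (𝓡 3)) (torusProj ψ (p, x))) :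
    ∃ (v : TangentSpace I p) (w : ℍ[ℝ]), dTorusProj ψ p x v w = u := by
  obtain ⟨⟨v, w⟩, h⟩ := (dTorusProjEquiv ψ p x).surjective u
  exact ⟨v, w, (dTorusProjEquiv_apply ψ p x v w).symm.trans h⟩

variable {ψ} {g : SmoothMetric I N} {A : Fin 3 → EndField I N}

/-- The deck transformation between two points of the same fibre of `torusProj` acts on tangent
vectors by `(v, w) ↦ (P v, c w)`, where `P` is an isometry commuting with the complex structures. -/
theorem IsHyperkahlerIsometry.exists_deck (hψ : IsHyperkahlerIsometry g A ψ) {p p' : N}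
    {x x' : puncturedQuaternions} (h : torusProj ψ (p', x') = torusProj ψ (p, x)) :
    ∃ (P : E →L[ℝ] E) (c : ℝ), c ≠ 0 ∧ Function.Surjective P ∧ (x' : ℍ[ℝ]) = c • (x : ℍ[ℝ]) ∧
      (∀ v w, dTorusProjEquiv ψ p' x' (P v, c • w) = dTorusProjEquiv ψ p x (v, w)) ∧
      (∀ u v : E, metricAt g p' (P u) (P v) = metricAt g p u v) ∧
      ∀ (a : Fin 3) (u : E), endAt (A a) p' (P u) = P (endAt (A a) p u) := by
  obtain ⟨k, rfl, hx⟩ := exists_zpow_of_torusProj_eq ψ h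
  obtain rfl : x' = scalePunctured (2 ^ k) (zpow_ne_zero k two_ne_zero) x := Subtype.ext hx
  refine ⟨mfderiv I I (ψ.toEquiv ^ k : Equiv.Perm N) p, 2 ^ k, zpow_ne_zero k two_ne_zero, ?_, rfl,
    fun v w ↦ ?_, (hψ.zpow k).1 p, fun a u ↦ ((hψ.zpow k).2 a p u).symm⟩
  · have h1 := ((contMDiff_zpow ψ (-k)).mdifferentiable (by simp))
      ((ψ.toEquiv ^ k : Equiv.Perm N) p)
    have h3 := ((contMDiff_zpow ψ k).mdifferentiable (by simp))
      ((ψ.toEquiv ^ (-k) : Equiv.Perm N) ((ψ.toEquiv ^ k : Equiv.Perm N) p))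
    have h4 : ((ψ.toEquiv ^ k : Equiv.Perm N) ∘ (ψ.toEquiv ^ (-k) : Equiv.Perm N) : N → N) =
        id := by
      funext y
      simp
    have h6 : (ψ.toEquiv ^ (-k) : Equiv.Perm N) ((ψ.toEquiv ^ k : Equiv.Perm N) p) = p := by simp
    have h5 := h3.hasMFDerivAt.comp _ h1.hasMFDerivAt
    rw [h4] at h5
    have h7 := hasMFDerivAt_unique h5 (hasMFDerivAt_id _)
    rw [h6] at h7
    intro v
    exact ⟨_, DFunLike.congr_fun h7 v⟩
  · exact (dTorusProjEquiv_apply ψ _ _ _ _).trans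
      ((dTorusProj_deck ψ k p x v w).trans (dTorusProjEquiv_apply ψ p x v w).symm)

/-- The orthogonal sum of `g` and the flat metric descends to `N_ψ × S³`. -/
theorem IsHyperkahlerIsometry.exists_metric (hψ : IsHyperkahlerIsometry g A ψ) :
    ∃ G : (q : MappingTorus ψ × S3) → TangentSpace ((I.prod 𝓘(ℝ, ℝ)).prod (𝓡 3)) q →L[ℝ]
        TangentSpace ((I.prod 𝓘(ℝ, ℝ)).prod (𝓡 3)) q →L[ℝ] ℝ,
      ∀ (p : N) (x : puncturedQuaternions) (v v' : TangentSpace I p) (w w' : ℍ[ℝ]),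
        G (torusProj ψ (p, x)) (dTorusProj ψ p x v w) (dTorusProj ψ p x v' w') =
          g.inner p v v' + flatMetric x w w' := by
  have h : ∀ q : MappingTorus ψ × S3, ∃ G : (E × ℝ) × EuclideanSpace ℝ (Fin 3) →L[ℝ]
      (E × ℝ) × EuclideanSpace ℝ (Fin 3) →L[ℝ] ℝ, ∀ (p : N) (x : puncturedQuaternions),
      torusProj ψ (p, x) = q → ∀ (v v' : E) (w w' : ℍ[ℝ]),
        G (dTorusProjEquiv ψ p x (v, w)) (dTorusProjEquiv ψ p x (v', w')) =
          metricAt g p v v' + flatMetric x w w' := by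
    intro q
    obtain ⟨⟨p, x⟩, rfl⟩ := surjective_torusProj ψ q
    refine ⟨(sumBilin (metricAt g p) (flatMetric x)).bilinearComp
      ((dTorusProjEquiv ψ p x).symm : _ →L[ℝ] E × ℍ[ℝ])
      ((dTorusProjEquiv ψ p x).symm : _ →L[ℝ] E × ℍ[ℝ]), fun p' x' h v v' w w' ↦ ?_⟩
    obtain ⟨P, c, hc, hP, hx, hd, hg, -⟩ := hψ.exists_deck h
    obtain ⟨v, rfl⟩ := hP v
    obtain ⟨v', rfl⟩ := hP v'
    obtain ⟨w, rfl⟩ : ∃ w₀, c • w₀ = w := ⟨c⁻¹ • w, smul_inv_smul₀ hc w⟩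
    obtain ⟨w', rfl⟩ : ∃ w₀, c • w₀ = w' := ⟨c⁻¹ • w', smul_inv_smul₀ hc w'⟩
    rw [hd, hd, hg, hx]
    simp only [ContinuousLinearMap.bilinearComp_apply, ContinuousLinearEquiv.coe_coe,
      ContinuousLinearEquiv.symm_apply_apply, sumBilin_apply, flatMetric_apply, norm_smul,
      real_inner_smul_left, real_inner_smul_right, Real.norm_eq_abs, mul_pow, sq_abs]
    congr 1
    field_simp
  choose G hG using h
  refine ⟨G, fun p x v v' w w' ↦ ?_⟩
  have h := hG _ p x rfl v v' w w'
  rw [dTorusProjEquiv_apply, dTorusProjEquiv_apply] at h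
  exact h

/-- The sum of `A a` and of a constant endomorphism of `ℍ` descends to `N_ψ × S³`, since homotheties
commute with linear maps. -/
theorem IsHyperkahlerIsometry.exists_endField (hψ : IsHyperkahlerIsometry g A ψ) (a : Fin 3)
    (L : ℍ[ℝ] →L[ℝ] ℍ[ℝ]) :
    ∃ B : EndField ((I.prod 𝓘(ℝ, ℝ)).prod (𝓡 3)) (MappingTorus ψ × S3),
      ∀ (p : N) (x : puncturedQuaternions) (v : TangentSpace I p) (w : ℍ[ℝ]),
        B (torusProj ψ (p, x)) (dTorusProj ψ p x v w) = dTorusProj ψ p x (A a p v) (L w) := by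
  have h : ∀ q : MappingTorus ψ × S3, ∃ B : (E × ℝ) × EuclideanSpace ℝ (Fin 3) →L[ℝ]
      (E × ℝ) × EuclideanSpace ℝ (Fin 3), ∀ (p : N) (x : puncturedQuaternions),
      torusProj ψ (p, x) = q → ∀ (v : E) (w : ℍ[ℝ]),
        B (dTorusProjEquiv ψ p x (v, w)) = dTorusProjEquiv ψ p x (endAt (A a) p v, L w) := by
    intro q
    obtain ⟨⟨p, x⟩, rfl⟩ := surjective_torusProj ψ q
    refine ⟨(dTorusProjEquiv ψ p x : E × ℍ[ℝ] →L[ℝ] _) ∘L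
      ((endAt (A a) p).prodMap L) ∘L
      ((dTorusProjEquiv ψ p x).symm : _ →L[ℝ] E × ℍ[ℝ]), fun p' x' h v w ↦ ?_⟩
    obtain ⟨P, c, hc, hP, hx, hd, -, hA⟩ := hψ.exists_deck h
    obtain ⟨v, rfl⟩ := hP v
    obtain ⟨w, rfl⟩ : ∃ w₀, c • w₀ = w := ⟨c⁻¹ • w, smul_inv_smul₀ hc w⟩
    rw [hd, hA, map_smul, hd]
    simp
  choose B hB using h
  refine ⟨B, fun p x v w ↦ ?_⟩
  have h := hB _ p x rfl v w
  rw [dTorusProjEquiv_apply] at h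
  exact h.trans (dTorusProjEquiv_apply ψ p x _ _)

/-- The pullback of the flat torsion descends to `N_ψ × S³`. -/
theorem IsHyperkahlerIsometry.exists_form (hψ : IsHyperkahlerIsometry g A ψ) :
    ∃ T : FormField ((I.prod 𝓘(ℝ, ℝ)).prod (𝓡 3)) (MappingTorus ψ × S3) 3,
      ∀ (p : N) (x : puncturedQuaternions) (v : Fin 3 → TangentSpace I p) (w : Fin 3 → ℍ[ℝ]),
        T (torusProj ψ (p, x)) (fun i ↦ dTorusProj ψ p x (v i) (w i)) = flatTorsion x w := by
  have h : ∀ q : MappingTorus ψ × S3, ∃ T : ((E × ℝ) × EuclideanSpace ℝ (Fin 3)) [⋀^Fin 3]→L[ℝ] ℝ,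
      ∀ (p : N) (x : puncturedQuaternions), torusProj ψ (p, x) = q →
      ∀ (v : Fin 3 → E) (w : Fin 3 → ℍ[ℝ]),
        T (fun i ↦ dTorusProjEquiv ψ p x (v i, w i)) = flatTorsion x w := by
    intro q
    obtain ⟨⟨p, x⟩, rfl⟩ := surjective_torusProj ψ q
    refine ⟨(flatTorsion x).compContinuousLinearMap (.snd ℝ E ℍ[ℝ] ∘L
      ((dTorusProjEquiv ψ p x).symm : _ →L[ℝ] E × ℍ[ℝ])), fun p' x' h v w ↦ ?_⟩
    obtain ⟨P, c, hc, hP, hx, hd, -, -⟩ := hψ.exists_deck h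
    choose v₀ hv₀ using fun i ↦ hP (v i)
    obtain rfl : (fun i ↦ P (v₀ i)) = v := funext hv₀
    obtain ⟨w, rfl⟩ : ∃ w₀ : Fin 3 → ℍ[ℝ], (fun i ↦ c • w₀ i) = w :=
      ⟨fun i ↦ c⁻¹ • w i, funext fun i ↦ smul_inv_smul₀ hc (w i)⟩
    simp only [hd]
    rw [hx, flatTorsion_smul hc, ContinuousAlternatingMap.compContinuousLinearMap_apply]
    congr 1
    funext i
    simp
  choose T hT using h
  refine ⟨T, fun p x v w ↦ ?_⟩
  have h := hT _ p x rfl v w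
  simp only [dTorusProjEquiv_apply] at h
  exact h

end Descent

/-! ### Tensors and Christoffel symbols on a product -/

section Products

variable {V W : Type*} [NormedAddCommGroup V] [NormedSpace ℝ V] [NormedAddCommGroup W]
  [NormedSpace ℝ W]

theorem contDiffAt_sumBilin {b₁ : V → V →L[ℝ] V →L[ℝ] ℝ} {b₂ : W → W →L[ℝ] W →L[ℝ] ℝ} {y : V × W}
    (h₁ : ContDiffAt ℝ ∞ b₁ y.1) (h₂ : ContDiffAt ℝ ∞ b₂ y.2) :
    ContDiffAt ℝ ∞ (fun z : V × W ↦ sumBilin (b₁ z.1) (b₂ z.2)) y := by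
  have e₁ : ContDiffAt ℝ ∞ (fun z : V × W ↦
      (b₁ z.1).bilinearComp (.fst ℝ V W) (.fst ℝ V W)) y :=
    ContDiff.comp_contDiffAt y (contDiff_bilinearComp (V := V × W) (W := V))
      (f := fun z : V × W ↦ (b₁ z.1, ContinuousLinearMap.fst ℝ V W))
      ((h₁.comp y contDiffAt_fst).prodMk contDiffAt_const)
  have e₂ : ContDiffAt ℝ ∞ (fun z : V × W ↦
      (b₂ z.2).bilinearComp (.snd ℝ V W) (.snd ℝ V W)) y :=
    ContDiff.comp_contDiffAt y (contDiff_bilinearComp (V := V × W) (W := W))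
      (f := fun z : V × W ↦ (b₂ z.2, ContinuousLinearMap.snd ℝ V W))
      ((h₂.comp y contDiffAt_snd).prodMk contDiffAt_const)
  exact e₁.add e₂

theorem fderiv_bilin_apply {F : Type*} [NormedAddCommGroup F] [NormedSpace ℝ F]
    {b : F → V →L[ℝ] V →L[ℝ] ℝ} {y : F}
    (h : DifferentiableAt ℝ b y) (c : F) (u v : V) :
    fderiv ℝ (fun z ↦ b z u v) y c = fderiv ℝ b y c u v := by
  have h1 := ((h.hasFDerivAt.clm_apply (hasFDerivAt_const u y)).clm_apply
    (hasFDerivAt_const v y)).fderiv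
  rw [h1]
  simp

theorem fderiv_sumBilin {b₁ : V → V →L[ℝ] V →L[ℝ] ℝ} {b₂ : W → W →L[ℝ] W →L[ℝ] ℝ} {y : V × W}
    (h₁ : ContDiffAt ℝ ∞ b₁ y.1) (h₂ : ContDiffAt ℝ ∞ b₂ y.2) (c u v : V × W) :
    fderiv ℝ (fun z : V × W ↦ sumBilin (b₁ z.1) (b₂ z.2)) y c u v =
      fderiv ℝ b₁ y.1 c.1 u.1 v.1 + fderiv ℝ b₂ y.2 c.2 u.2 v.2 := by
  have d₁ := h₁.differentiableAt (by simp)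
  have d₂ := h₂.differentiableAt (by simp)
  rw [← fderiv_bilin_apply ((contDiffAt_sumBilin h₁ h₂).differentiableAt (by simp)),
    ← fderiv_bilin_apply d₁, ← fderiv_bilin_apply d₂]
  have e₁ : HasFDerivAt (fun z : V × W ↦ b₁ z.1 u.1 v.1)
      (fderiv ℝ (fun z ↦ b₁ z u.1 v.1) y.1 ∘L .fst ℝ V W) y :=
    ((d₁.clm_apply (differentiableAt_const _)).clm_apply
      (differentiableAt_const _)).hasFDerivAt.comp y hasFDerivAt_fst
  have e₂ : HasFDerivAt (fun z : V × W ↦ b₂ z.2 u.2 v.2)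
      (fderiv ℝ (fun z ↦ b₂ z u.2 v.2) y.2 ∘L .snd ℝ V W) y :=
    ((d₂.clm_apply (differentiableAt_const _)).clm_apply
      (differentiableAt_const _)).hasFDerivAt.comp y hasFDerivAt_snd
  exact DFunLike.congr_fun (e₁.add e₂).fderiv c

theorem contDiffAt_prodMap_const {a : V → V →L[ℝ] V} {y : V × W} (h : ContDiffAt ℝ ∞ a y.1)
    (L : W →L[ℝ] W) : ContDiffAt ℝ ∞ (fun z : V × W ↦ (a z.1).prodMap L) y := by
  have e₁ : ContDiffAt ℝ ∞ (fun z : V × W ↦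
      .inl ℝ V W ∘L a z.1 ∘L .fst ℝ V W + .inr ℝ V W ∘L L ∘L .snd ℝ V W) y :=
    (contDiffAt_const.clm_comp ((h.comp y contDiffAt_fst).clm_comp contDiffAt_const)).add
      contDiffAt_const
  convert! e₁ using 2 with z
  ext <;> simp

theorem fderiv_prodMap_const {a : V → V →L[ℝ] V} {y : V × W} (h : ContDiffAt ℝ ∞ a y.1)
    (L : W →L[ℝ] W) (c u : V × W) :
    fderiv ℝ (fun z : V × W ↦ (a z.1).prodMap L) y c u = (fderiv ℝ a y.1 c.1 u.1, 0) := by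
  have d₁ := h.differentiableAt (by simp)
  have d := ((contDiffAt_prodMap_const h L).differentiableAt (by simp)).hasFDerivAt.clm_apply
    (hasFDerivAt_const u y)
  have e₁ : HasFDerivAt (fun z : V × W ↦ a z.1 u.1) _ y :=
    ((d₁.hasFDerivAt.clm_apply (hasFDerivAt_const u.1 y.1))).comp y hasFDerivAt_fst
  have e := e₁.prodMk (hasFDerivAt_const (L u.2) y)
  have h1 := DFunLike.congr_fun (d.unique e) c
  simpa using h1

/-- The direct sum of two Christoffel symbols. -/
def sumChristoffel (Γ₁ : V →L[ℝ] V →L[ℝ] V) (Γ₂ : W →L[ℝ] W →L[ℝ] W) :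
    V × W →L[ℝ] V × W →L[ℝ] V × W :=
  (ContinuousLinearMap.compL ℝ (V × W) V (V × W) (.inl ℝ V W)) ∘L
    (Γ₁.bilinearComp (.fst ℝ V W) (.fst ℝ V W)) +
  (ContinuousLinearMap.compL ℝ (V × W) W (V × W) (.inr ℝ V W)) ∘L
    (Γ₂.bilinearComp (.snd ℝ V W) (.snd ℝ V W))

theorem sumChristoffel_apply (Γ₁ : V →L[ℝ] V →L[ℝ] V) (Γ₂ : W →L[ℝ] W →L[ℝ] W) (u v : V × W) :
    sumChristoffel Γ₁ Γ₂ u v = (Γ₁ u.1 v.1, Γ₂ u.2 v.2) := by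
  simp [sumChristoffel]

/-- The open unit ball of a positive definite form on a finite-dimensional space is bounded. This is
part of the data of a Riemannian metric. -/
theorem isVonNBounded_of_pos [FiniteDimensional ℝ V] (B : V →L[ℝ] V →L[ℝ] ℝ)
    (hB : ∀ v, v ≠ 0 → 0 < B v v) : Bornology.IsVonNBounded ℝ {v : V | B v v < 1} := by
  rw [NormedSpace.isVonNBounded_iff]
  rcases subsingleton_or_nontrivial V with hV | hV
  · exact (Set.subsingleton_of_subsingleton (s := {v : V | B v v < 1})).finite.isBounded
  have : ProperSpace V := FiniteDimensional.proper ℝ V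
  have hc : Continuous fun v ↦ B v v := by fun_prop
  obtain ⟨v₀, hv₀, hmin⟩ := (isCompact_sphere (0 : V) 1).exists_isMinOn
    (NormedSpace.sphere_nonempty.2 zero_le_one) hc.continuousOn
  have hv₀0 : v₀ ≠ 0 := ne_zero_of_mem_unit_sphere ⟨v₀, hv₀⟩
  have hm := hB v₀ hv₀0
  refine isBounded_iff_forall_norm_le.2 ⟨1 / B v₀ v₀ + 1, fun v hv ↦ ?_⟩
  rcases eq_or_ne v 0 with rfl | hv0
  · rw [norm_zero]; positivity
  have hn : 0 < ‖v‖ := norm_pos_iff.2 hv0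
  have h1 : B v₀ v₀ ≤ B (‖v‖⁻¹ • v) (‖v‖⁻¹ • v) := by
    apply hmin
    rw [mem_sphere_zero_iff_norm, norm_smul, norm_inv, norm_norm, inv_mul_cancel₀ hn.ne']
  have h2 : B (‖v‖⁻¹ • v) (‖v‖⁻¹ • v) = (‖v‖ ^ 2)⁻¹ * B v v := by
    simp only [map_smul, smul_apply, smul_eq_mul]
    field_simp
  have h3 : B v₀ v₀ * ‖v‖ ^ 2 < 1 := by
    rw [h2] at h1
    have h4 := mul_le_mul_of_nonneg_right h1 (sq_nonneg ‖v‖)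
    rw [mul_right_comm, inv_mul_cancel₀ (by positivity), one_mul] at h4
    exact h4.trans_lt hv
  have h5 : ‖v‖ ^ 2 ≤ 1 / B v₀ v₀ := by
    rw [le_div_iff₀ hm]; linarith
  nlinarith [sq_nonneg (‖v‖ - 1)]

end Products

/-! ### Induced tensors in adapted charts -/

section Induced

set_option maxSynthPendingDepth 3

variable {E : Type*} [NormedAddCommGroup E] [NormedSpace ℝ E]
  {H : Type*} [TopologicalSpace H] {I : ModelWithCorners ℝ E H}
  {N : Type*} [TopologicalSpace N] [ChartedSpace H N] {ψ : N ≃ₘ^∞⟮I, I⟯ N}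
  [T2Space N] [LocallyCompactSpace N] [IsManifold I ∞ N]

/-- The bilinear forms `G` on `N_ψ × S³` lift to the sum of `g` and the flat metric. -/
def IsInducedMetric (g : SmoothMetric I N)
    (G : (q : MappingTorus ψ × S3) → TangentSpace ((I.prod 𝓘(ℝ, ℝ)).prod (𝓡 3)) q →L[ℝ]
        TangentSpace ((I.prod 𝓘(ℝ, ℝ)).prod (𝓡 3)) q →L[ℝ] ℝ) : Prop :=
  ∀ (p : N) (x : puncturedQuaternions) (v v' : TangentSpace I p) (w w' : ℍ[ℝ]),
    G (torusProj ψ (p, x)) (dTorusProj ψ p x v w) (dTorusProj ψ p x v' w') =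
      g.inner p v v' + flatMetric x w w'

/-- The endomorphisms `B` on `N_ψ × S³` lift to the sum of `A` and the constant `L`. -/
def IsInducedEnd (A : EndField I N) (L : ℍ[ℝ] →L[ℝ] ℍ[ℝ])
    (B : EndField ((I.prod 𝓘(ℝ, ℝ)).prod (𝓡 3)) (MappingTorus ψ × S3)) : Prop :=
  ∀ (p : N) (x : puncturedQuaternions) (v : TangentSpace I p) (w : ℍ[ℝ]),
    B (torusProj ψ (p, x)) (dTorusProj ψ p x v w) = dTorusProj ψ p x (A p v) (L w)

/-- The form `T` on `N_ψ × S³` lifts to the pullback of the form `τ` on `ℍ ∖ {0}`. -/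
def IsInducedForm (τ : ℍ[ℝ] → ℍ[ℝ] [⋀^Fin 3]→L[ℝ] ℝ)
    (T : FormField ((I.prod 𝓘(ℝ, ℝ)).prod (𝓡 3)) (MappingTorus ψ × S3) 3) : Prop :=
  ∀ (p : N) (x : puncturedQuaternions) (v : Fin 3 → TangentSpace I p) (w : Fin 3 → ℍ[ℝ]),
    T (torusProj ψ (p, x)) (fun i ↦ dTorusProj ψ p x (v i) (w i)) = τ x w

variable {F : Type*} [NormedAddCommGroup F] [NormedSpace ℝ F]
  {φ : OpenPartialHomeomorph N F} {Φ : OpenPartialHomeomorph (MappingTorus ψ × S3) (F × ℍ[ℝ])}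

omit [IsManifold I ∞ N] in
theorem IsAdaptedChart.eventually_lift (hΦ : IsAdaptedChart ψ φ Φ) {p : N} (hp : p ∈ φ.source)
    {x : puncturedQuaternions} (hx : torusProj ψ (p, x) ∈ Φ.source)
    (h : Φ (torusProj ψ (p, x)) = (φ p, (x : ℍ[ℝ]))) {Q : N → Prop} (hQ : ∀ᶠ y in 𝓝 p, Q y) :
    ∀ᶠ y in 𝓝 (torusProj ψ (p, x)), y ∈ Φ.source ∧ ∃ (p' : N) (x' : puncturedQuaternions),
      torusProj ψ (p', x') = y ∧ p' ∈ φ.source ∧ Q p' ∧ Φ y = (φ p', (x' : ℍ[ℝ])) := by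
  have hc : ContinuousAt (fun y ↦ φ.symm (Φ y).1) (torusProj ψ (p, x)) := by
    have h1 : ContinuousAt (fun y ↦ (Φ y).1) (torusProj ψ (p, x)) :=
      continuousAt_fst.comp (Φ.continuousAt hx)
    refine ContinuousAt.comp (g := φ.symm) ?_ h1
    rw [h]
    exact φ.continuousAt_symm (φ.map_source hp)
  have hv : φ.symm (Φ (torusProj ψ (p, x))).1 = p := by rw [h]; exact φ.left_inv hp
  have hc' := hc.tendsto
  rw [hv] at hc'
  filter_upwards [hc'.eventually hQ, Φ.open_source.mem_nhds hx] with y hy hys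
  obtain ⟨p', x', h1, h2, h3, -⟩ := hΦ.exists_lift y hys
  rw [h3, φ.left_inv h2] at hy
  exact ⟨hys, p', x', h1, h2, hy, h3⟩

theorem IsInducedMetric.bilinRepAt {g : SmoothMetric I N}
    {G : (q : MappingTorus ψ × S3) → TangentSpace ((I.prod 𝓘(ℝ, ℝ)).prod (𝓡 3)) q →L[ℝ]
        TangentSpace ((I.prod 𝓘(ℝ, ℝ)).prod (𝓡 3)) q →L[ℝ] ℝ} (hG : IsInducedMetric g G)
    (hΦ : IsAdaptedChart ψ φ Φ) {p : N} (hp : p ∈ φ.source)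
    {x : puncturedQuaternions} (hx : torusProj ψ (p, x) ∈ Φ.source)
    (h : Φ (torusProj ψ (p, x)) = (φ p, (x : ℍ[ℝ]))) {gφ : F → F →L[ℝ] F →L[ℝ] ℝ}
    (hg : BilinRepAt g.inner φ p gφ) :
    BilinRepAt G Φ (torusProj ψ (p, x)) (fun z ↦ sumBilin (gφ z.1) (flatMetric z.2)) := by
  filter_upwards [hΦ.eventually_lift hp hx h hg] with y hy
  obtain ⟨hys, p', x', rfl, hp', hg', hΦy⟩ := hy
  intro u u'
  obtain ⟨v, w, rfl⟩ := exists_dTorusProj_eq ψ p' x' u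
  obtain ⟨v', w', rfl⟩ := exists_dTorusProj_eq ψ p' x' u'
  rw [hG, hΦ.dChart_dTorusProj hp' hys hΦy, hΦ.dChart_dTorusProj hp' hys hΦy, hΦy, sumBilin_apply,
    hg']

theorem IsInducedEnd.endRepAt {A : EndField I N} {L : ℍ[ℝ] →L[ℝ] ℍ[ℝ]}
    {B : EndField ((I.prod 𝓘(ℝ, ℝ)).prod (𝓡 3)) (MappingTorus ψ × S3)} (hB : IsInducedEnd A L B)
    (hΦ : IsAdaptedChart ψ φ Φ) {p : N} (hp : p ∈ φ.source)
    {x : puncturedQuaternions} (hx : torusProj ψ (p, x) ∈ Φ.source)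
    (h : Φ (torusProj ψ (p, x)) = (φ p, (x : ℍ[ℝ]))) {Aφ : F → F →L[ℝ] F}
    (hA : EndRepAt A φ p Aφ) :
    EndRepAt B Φ (torusProj ψ (p, x)) (fun z ↦ (Aφ z.1).prodMap L) := by
  filter_upwards [hΦ.eventually_lift hp hx h hA] with y hy
  obtain ⟨hys, p', x', rfl, hp', hA', hΦy⟩ := hy
  intro u
  obtain ⟨v, w, rfl⟩ := exists_dTorusProj_eq ψ p' x' u
  rw [hB, hΦ.dChart_dTorusProj hp' hys hΦy, hΦ.dChart_dTorusProj hp' hys hΦy, hΦy, hA']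
  rfl

/-- An induced form is locally the pullback of `τ` by the second component of an adapted chart. -/
theorem IsInducedForm.eventually_eq {τ : ℍ[ℝ] → ℍ[ℝ] [⋀^Fin 3]→L[ℝ] ℝ}
    {T : FormField ((I.prod 𝓘(ℝ, ℝ)).prod (𝓡 3)) (MappingTorus ψ × S3) 3} (hT : IsInducedForm τ T)
    (hΦ : IsAdaptedChart ψ φ Φ) {q : MappingTorus ψ × S3} (hq : q ∈ Φ.source) :
    ∀ᶠ y in 𝓝 q, T y = (τ (Φ y).2).compContinuousLinearMap
      (mfderiv ((I.prod 𝓘(ℝ, ℝ)).prod (𝓡 3)) 𝓘(ℝ, ℍ[ℝ]) (fun y ↦ (Φ y).2) y) := by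
  filter_upwards [Φ.open_source.mem_nhds hq] with y hy
  obtain ⟨p, x, rfl, hp, hΦy, hd⟩ := hΦ.exists_lift y hy
  ext t
  choose v w hvw using fun i ↦ exists_dTorusProj_eq ψ p x (t i)
  obtain rfl : (fun i ↦ dTorusProj ψ p x (v i) (w i)) = t := funext hvw
  have h1 : MDifferentiableAt 𝓘(ℝ, F × ℍ[ℝ]) 𝓘(ℝ, ℍ[ℝ]) (Prod.snd : F × ℍ[ℝ] → ℍ[ℝ])
      (Φ (torusProj ψ (p, x))) := differentiableAt_snd.mdifferentiableAt
  have h2 := mfderiv_comp _ h1 (hΦ.isSmoothChart.mdifferentiableAt hy)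
  rw [mfderiv_eq_fderiv, fderiv_snd] at h2
  have h3 : ∀ i, mfderiv ((I.prod 𝓘(ℝ, ℝ)).prod (𝓡 3)) 𝓘(ℝ, ℍ[ℝ]) (fun y ↦ (Φ y).2)
      (torusProj ψ (p, x)) (dTorusProj ψ p x (v i) (w i)) = w i := fun i ↦
    (DFunLike.congr_fun h2 _).trans (congrArg Prod.snd (hd (v i) (w i)))
  refine (hT p x v w).trans ?_
  rw [hΦy]
  exact congrArg (τ x) (funext fun i ↦ (h3 i).symm)

end Induced

/-! ### The induced hyperhermitian structures -/

section InducedStructures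

set_option maxSynthPendingDepth 3

variable {E : Type*} [NormedAddCommGroup E] [NormedSpace ℝ E] [FiniteDimensional ℝ E]
  {H : Type*} [TopologicalSpace H] {I : ModelWithCorners ℝ E H}
  {N : Type*} [TopologicalSpace N] [ChartedSpace H N] {ψ : N ≃ₘ^∞⟮I, I⟯ N}
  [T2Space N] [LocallyCompactSpace N] [IsManifold I ∞ N]

omit [FiniteDimensional ℝ E] [T2Space N] [LocallyCompactSpace N] in
theorem IsComplexStructure.exists_smoothChart {A : EndField I N} (hA : IsComplexStructure A)
    (p : N) : ∃ φ : OpenPartialHomeomorph N E, IsSmoothChart I φ ∧ p ∈ φ.source := by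
  obtain ⟨J, φ, -, hp, h1, h2, -⟩ := hA.integrable p
  exact ⟨φ, ⟨h1, h2⟩, hp⟩

/-- The descended bilinear forms are a smooth Riemannian metric. -/
theorem IsHyperkahlerIsometry.exists_smoothMetric {g : SmoothMetric I N}
    {A : Fin 3 → EndField I N} (hψ : IsHyperkahlerIsometry g A ψ)
    (hch : ∀ p : N, ∃ φ : OpenPartialHomeomorph N E, IsSmoothChart I φ ∧ p ∈ φ.source) :
    ∃ G : SmoothMetric ((I.prod 𝓘(ℝ, ℝ)).prod (𝓡 3)) (MappingTorus ψ × S3),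
      IsInducedMetric g G.inner := by
  have := FiniteDimensional.complete ℝ E
  obtain ⟨G, hG⟩ := hψ.exists_metric
  have hGi : IsInducedMetric g G := hG
  have hpos : ∀ (q : MappingTorus ψ × S3) (u : TangentSpace ((I.prod 𝓘(ℝ, ℝ)).prod (𝓡 3)) q),
      u ≠ 0 → 0 < G q u u := by
    intro q u hu
    obtain ⟨⟨p, x⟩, rfl⟩ := surjective_torusProj ψ q
    obtain ⟨v, w, rfl⟩ := exists_dTorusProj_eq ψ p x u
    have hx : 0 < ‖(x : ℍ[ℝ])‖ := norm_pos_iff.2 x.2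
    rw [hG, flatMetric_apply, real_inner_self_eq_norm_sq]
    have hw : 0 ≤ ‖w‖ ^ 2 / ‖(x : ℍ[ℝ])‖ ^ 2 := by positivity
    rcases eq_or_ne v 0 with rfl | hv
    · have hw0 : w ≠ 0 := by
        rintro rfl
        exact hu (map_zero (mfderiv (I.prod 𝓘(ℝ, ℍ[ℝ])) ((I.prod 𝓘(ℝ, ℝ)).prod (𝓡 3))
          (torusProj ψ) (p, x)))
      have : 0 < ‖w‖ := norm_pos_iff.2 hw0
      rw [map_zero, zero_add]
      positivity
    · exact add_pos_of_pos_of_nonneg (g.pos p v hv) hw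
  refine ⟨⟨G, ?_, hpos, ?_, ?_⟩, hG⟩
  · intro q u u'
    obtain ⟨⟨p, x⟩, rfl⟩ := surjective_torusProj ψ q
    obtain ⟨v, w, rfl⟩ := exists_dTorusProj_eq ψ p x u
    obtain ⟨v', w', rfl⟩ := exists_dTorusProj_eq ψ p x u'
    rw [hG, hG, g.symm, flatMetric_apply, flatMetric_apply, real_inner_comm]
  · intro q
    exact isVonNBounded_of_pos (V := (E × ℝ) × EuclideanSpace ℝ (Fin 3)) (G q) (hpos q)
  · intro q
    obtain ⟨⟨p, x⟩, rfl⟩ := surjective_torusProj ψ q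
    obtain ⟨φ, hφ, hp⟩ := hch p
    obtain ⟨Φ, hΦ, hs, hv⟩ := exists_isAdaptedChart ψ hφ hp x
    obtain ⟨gφ, hgs, hg⟩ := hφ.exists_bilinRep hp (g.contMDiff p)
    refine hΦ.isSmoothChart.contMDiffAt_bilin hs (hGi.bilinRepAt hΦ hp hs hv hg) ?_
    rw [hv]
    exact contDiffAt_sumBilin hgs (contDiffAt_flatMetric x.2)

theorem IsInducedEnd.isSmoothEndField {A : EndField I N} {L : ℍ[ℝ] →L[ℝ] ℍ[ℝ]}
    {B : EndField ((I.prod 𝓘(ℝ, ℝ)).prod (𝓡 3)) (MappingTorus ψ × S3)} (hB : IsInducedEnd A L B)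
    (hA : IsComplexStructure A) : IsSmoothEndField B := by
  have := FiniteDimensional.complete ℝ E
  intro q
  obtain ⟨⟨p, x⟩, rfl⟩ := surjective_torusProj ψ q
  obtain ⟨φ, hφ, hp⟩ := hA.exists_smoothChart p
  obtain ⟨Φ, hΦ, hs, hv⟩ := exists_isAdaptedChart ψ hφ hp x
  obtain ⟨Aφ, hAs, hAr⟩ := hφ.exists_endRep hp hA.smooth
  refine hΦ.isSmoothChart.contMDiffAt_end hs (hB.endRepAt hΦ hp hs hv hAr) ?_
  rw [hv]
  exact contDiffAt_prodMap_const hAs L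

/-- If `φ` is a holomorphic chart of `N` then an adapted chart `(p, x) ↦ (φ p, x)` is holomorphic
for the induced structure, since the second summand `L` is already constant. -/
theorem IsInducedEnd.isComplexStructure {A : EndField I N} {L : ℍ[ℝ] →L[ℝ] ℍ[ℝ]}
    {B : EndField ((I.prod 𝓘(ℝ, ℝ)).prod (𝓡 3)) (MappingTorus ψ × S3)} (hB : IsInducedEnd A L B)
    (hA : IsComplexStructure A) (hL : ∀ w, L (L w) = -w) : IsComplexStructure B := by
  refine ⟨hB.isSmoothEndField hA, fun q u ↦ ?_, fun q ↦ ?_⟩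
  · obtain ⟨⟨p, x⟩, rfl⟩ := surjective_torusProj ψ q
    obtain ⟨v, w, rfl⟩ := exists_dTorusProj_eq ψ p x u
    rw [hB, hB, hA.sq, hL]
    exact map_neg (mfderiv (I.prod 𝓘(ℝ, ℍ[ℝ])) ((I.prod 𝓘(ℝ, ℝ)).prod (𝓡 3))
          (torusProj ψ) (p, x)) (v, w)
  · obtain ⟨⟨p, x⟩, rfl⟩ := surjective_torusProj ψ q
    obtain ⟨J, φ, hJ, hp, h1, h2, hφA⟩ := hA.integrable p
    obtain ⟨Φ, hΦ, hs, hv⟩ := exists_isAdaptedChart ψ ⟨h1, h2⟩ hp x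
    -- Holomorphic charts have values in the model space, which has the dimension of `E × ℍ`.
    have hdim : Module.finrank ℝ (E × ℍ[ℝ]) =
        Module.finrank ℝ ((E × ℝ) × EuclideanSpace ℝ (Fin 3)) := by
      simp [Module.finrank_prod, Quaternion.finrank_eq_four]
    let e : (E × ℍ[ℝ]) ≃L[ℝ] (E × ℝ) × EuclideanSpace ℝ (Fin 3) :=
      ContinuousLinearEquiv.ofFinrankEq hdim
    have he : ∀ y, y ∈ Φ.source → ∀ u,
        mfderiv ((I.prod 𝓘(ℝ, ℝ)).prod (𝓡 3)) 𝓘(ℝ, (E × ℝ) × EuclideanSpace ℝ (Fin 3))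
          (fun z ↦ e (Φ z)) y u = e (dChart ((I.prod 𝓘(ℝ, ℝ)).prod (𝓡 3)) Φ y u) := by
      intro y hy u
      have h3 := (e.hasFDerivAt (x := Φ y)).hasMFDerivAt.comp y
        (hΦ.isSmoothChart.mdifferentiableAt hy).hasMFDerivAt
      exact DFunLike.congr_fun h3.mfderiv u
    let K : ((E × ℝ) × EuclideanSpace ℝ (Fin 3)) →L[ℝ] (E × ℝ) × EuclideanSpace ℝ (Fin 3) :=
      (e : E × ℍ[ℝ] →L[ℝ] _) ∘L (J.prodMap L) ∘L (e.symm : _ →L[ℝ] E × ℍ[ℝ])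
    have hK : ∀ v w, K (e (v, w)) = e (J v, L w) := fun v w ↦ by simp [K]
    refine ⟨K, Φ.transHomeomorph e.toHomeomorph, fun u ↦ ?_, hs, ?_, ?_, fun y hy u ↦ ?_⟩
    · obtain ⟨⟨v, w⟩, rfl⟩ := e.surjective u
      rw [hK, hK, hJ, hL, ← map_neg]
      rfl
    · exact e.contDiff.contMDiff.comp_contMDiffOn hΦ.isSmoothChart.contMDiffOn
    · exact hΦ.isSmoothChart.contMDiffOn_symm.comp e.symm.contDiff.contMDiff.contMDiffOn
        fun z hz ↦ hz
    · refine (he y hy _).trans (Eq.trans ?_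
        (congrArg (fun z : (E × ℝ) × EuclideanSpace ℝ (Fin 3) ↦ K z) (he y hy u)).symm)
      obtain ⟨p', x', rfl, hp', -, hd⟩ := hΦ.exists_lift y hy
      obtain ⟨v, w, rfl⟩ := exists_dTorusProj_eq ψ p' x' u
      rw [hB, hd, hd]
      have h4 : dChart I φ p' (A p' v) = J (dChart I φ p' v) := hφA p' hp' v
      rw [h4]
      exact (hK _ _).symm

theorem isHyperhermitian_of_induced {g : SmoothMetric I N} {A : Fin 3 → EndField I N}
    (hA : IsHyperhermitian g A) {L : Fin 3 → ℍ[ℝ] →L[ℝ] ℍ[ℝ]} (hL : ∀ a w, L a (L a w) = -w)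
    (hmul : ∀ w, L 0 (L 1 w) = L 2 w) (hmul' : ∀ w, L 1 (L 0 w) = -L 2 w)
    (hskew : ∀ a v w, inner ℝ (L a v) w = -inner ℝ v (L a w))
    {G : SmoothMetric ((I.prod 𝓘(ℝ, ℝ)).prod (𝓡 3)) (MappingTorus ψ × S3)}
    (hG : IsInducedMetric g G.inner)
    {B : Fin 3 → EndField ((I.prod 𝓘(ℝ, ℝ)).prod (𝓡 3)) (MappingTorus ψ × S3)}
    (hB : ∀ a, IsInducedEnd (A a) (L a) (B a)) : IsHyperhermitian G B := by
  refine ⟨⟨fun a ↦ (hB a).isComplexStructure (hA.hypercomplex.complex a) (hL a), ?_, ?_⟩, ?_⟩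
  · intro q u
    obtain ⟨⟨p, x⟩, rfl⟩ := surjective_torusProj ψ q
    obtain ⟨v, w, rfl⟩ := exists_dTorusProj_eq ψ p x u
    rw [hB 1, hB 0, hB 2, hA.hypercomplex.mul, hmul]
  · intro q u
    obtain ⟨⟨p, x⟩, rfl⟩ := surjective_torusProj ψ q
    obtain ⟨v, w, rfl⟩ := exists_dTorusProj_eq ψ p x u
    rw [hB 0, hB 1, hB 2, hA.hypercomplex.mul_swap, hmul']
    exact map_neg (mfderiv (I.prod 𝓘(ℝ, ℍ[ℝ])) ((I.prod 𝓘(ℝ, ℝ)).prod (𝓡 3))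
          (torusProj ψ) (p, x)) (A 2 p v, L 2 w)
  · intro a q u u'
    obtain ⟨⟨p, x⟩, rfl⟩ := surjective_torusProj ψ q
    obtain ⟨v, w, rfl⟩ := exists_dTorusProj_eq ψ p x u
    obtain ⟨v', w', rfl⟩ := exists_dTorusProj_eq ψ p x u'
    rw [hB a, hB a, hG, hG, hA.skew, flatMetric_apply, flatMetric_apply, hskew]
    ring

theorem IsInducedForm.isClosedForm [I.Boundaryless] {τ : ℍ[ℝ] → ℍ[ℝ] [⋀^Fin 3]→L[ℝ] ℝ}
    {T : FormField ((I.prod 𝓘(ℝ, ℝ)).prod (𝓡 3)) (MappingTorus ψ × S3) 3} (hT : IsInducedForm τ T)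
    (hch : ∀ p : N, ∃ φ : OpenPartialHomeomorph N E, IsSmoothChart I φ ∧ p ∈ φ.source)
    (hs : ∀ x, x ≠ 0 → ContDiffAt ℝ ∞ τ x) (hc : ∀ x, x ≠ 0 → extDeriv τ x = 0) :
    IsClosedForm T := by
  apply isClosedForm_of_locally_pullback (V := ℍ[ℝ])
  intro q
  obtain ⟨⟨p, x⟩, rfl⟩ := surjective_torusProj ψ q
  obtain ⟨φ, hφ, hp⟩ := hch p
  obtain ⟨Φ, hΦ, hsrc, hv⟩ := exists_isAdaptedChart ψ hφ hp x
  have hv2 : (Φ (torusProj ψ (p, x))).2 = x := congrArg Prod.snd hv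
  refine ⟨fun y ↦ (Φ y).2, τ, contDiff_snd.contMDiff.contMDiffAt.comp _
    (hΦ.isSmoothChart.contMDiffAt hsrc), ?_, ?_, hT.eventually_eq hΦ hsrc⟩
  · beta_reduce; rw [hv2]; exact hs x x.2
  · beta_reduce; rw [hv2]; exact hc x x.2

end InducedStructures

/-! ### The Bismut connection of an induced structure -/

section Bismut

set_option maxSynthPendingDepth 3

variable {E : Type*} [NormedAddCommGroup E] [NormedSpace ℝ E] [FiniteDimensional ℝ E]
  [CompleteSpace E]
  {H : Type*} [TopologicalSpace H] {I : ModelWithCorners ℝ E H}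
  {N : Type*} [TopologicalSpace N] [ChartedSpace H N] {ψ : N ≃ₘ^∞⟮I, I⟯ N}
  [T2Space N] [LocallyCompactSpace N] [IsManifold I ∞ N]

/-- The sum of the Levi-Civita connection of `N` and of the connection with Christoffel symbol `Γ`
on `ℍ ∖ {0}` is the common Bismut connection of the induced structures. The hypotheses on `Γ` say
that it preserves the flat metric and commutes with `L a`, and that its torsion form is `τ`. -/
theorem exists_isBismutConnection {g : SmoothMetric I N} {A : Fin 3 → EndField I N}
    (hA : IsHyperkahler g A) {L : Fin 3 → ℍ[ℝ] →L[ℝ] ℍ[ℝ]}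
    {Γ : ℍ[ℝ] → ℍ[ℝ] →L[ℝ] ℍ[ℝ] →L[ℝ] ℍ[ℝ]} {τ : ℍ[ℝ] → ℍ[ℝ] [⋀^Fin 3]→L[ℝ] ℝ}
    (hΓm : ∀ x, x ≠ 0 → ∀ c a b,
      fderiv ℝ flatMetric x c a b = flatMetric x (Γ x c a) b + flatMetric x a (Γ x c b))
    (hΓL : ∀ a x v w, Γ x v (L a w) = L a (Γ x v w))
    (hΓτ : ∀ x u v w, τ x ![u, v, w] = flatMetric x (Γ x u v - Γ x v u) w)
    {G : SmoothMetric ((I.prod 𝓘(ℝ, ℝ)).prod (𝓡 3)) (MappingTorus ψ × S3)}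
    (hG : IsInducedMetric g G.inner)
    {B : Fin 3 → EndField ((I.prod 𝓘(ℝ, ℝ)).prod (𝓡 3)) (MappingTorus ψ × S3)}
    (hB : ∀ a, IsInducedEnd (A a) (L a) (B a))
    {T : FormField ((I.prod 𝓘(ℝ, ℝ)).prod (𝓡 3)) (MappingTorus ψ × S3) 3}
    (hT : IsInducedForm τ T) :
    ∃ D : Connection ((I.prod 𝓘(ℝ, ℝ)).prod (𝓡 3)) (MappingTorus ψ × S3),
      ∀ a, IsBismutConnection G (B a) D T := by
  -- The holomorphic charts for the first complex structure serve as smooth charts of `N`.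
  obtain ⟨D₀, hD₀, hD₀g, hD₀A⟩ := hA.parallel
  choose φ hφ hp using fun p ↦ (hA.hyperhermitian.hypercomplex.complex 0).exists_smoothChart p
  choose Γ₀ hΓ₀ using fun p ↦ exists_christoffel D₀ hφ hp p
  choose z hz using fun q ↦ surjective_torusProj ψ q
  choose Φ hΦ hs hv using fun q ↦ exists_isAdaptedChart ψ (hφ (z q).1) (hp (z q).1) (z q).2
  obtain ⟨D, hD⟩ := exists_connection_of_christoffel (fun q ↦ (hΦ q).isSmoothChart)
    (fun q ↦ by have h := hs q; rwa [hz] at h)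
    (fun q ↦ sumChristoffel (Γ₀ (z q).1) (Γ (z q).2))
  -- At each point, `D` is the sum of the two connections in some adapted chart. With the lift
  -- `(p, x)` as variables, the point can be substituted by `torusProj ψ (p, x)` in what follows.
  have key : ∀ q : MappingTorus ψ × S3, ∃ (p : N) (x : puncturedQuaternions),
      q = torusProj ψ (p, x) ∧ ∃ Ψ : OpenPartialHomeomorph (MappingTorus ψ × S3) (E × ℍ[ℝ]),
      IsAdaptedChart ψ (φ p) Ψ ∧ torusProj ψ (p, x) ∈ Ψ.source ∧
      Ψ (torusProj ψ (p, x)) = (φ p p, (x : ℍ[ℝ])) ∧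
      HasChristoffelAt D Ψ (torusProj ψ (p, x)) (sumChristoffel (Γ₀ p) (Γ x)) := by
    intro q
    refine ⟨(z q).1, (z q).2, (hz q).symm, Φ q, hΦ q, hs q, hv q, ?_⟩
    rw [show torusProj ψ ((z q).1, (z q).2) = q from hz q]
    exact hD q
  refine ⟨D, fun a ↦ ⟨fun q Y Z hY hZ u ↦ ?_, fun q Y hY u ↦ ?_, fun q u u' u'' ↦ ?_⟩⟩
  · obtain ⟨p, x, rfl, Ψ, hΨ, hsrc, hval, hDx⟩ := key q
    obtain ⟨gφ, hgs, hg⟩ := (hφ p).exists_bilinRep (hp p) (g.contMDiff p)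
    have hsm := contDiffAt_sumBilin (y := Ψ (torusProj ψ (p, x)))
      (by rw [hval]; exact hgs) (by rw [hval]; exact contDiffAt_flatMetric x.2)
    refine hΨ.isSmoothChart.metric_of_christoffel hsrc (hG.bilinRepAt hΨ (hp p) hsrc hval hg)
      (hsm.differentiableAt (by simp)) hDx (fun c a b ↦ ?_) hY hZ u
    rw [hval, fderiv_sumBilin (y := (φ p p, (x : ℍ[ℝ]))) hgs (contDiffAt_flatMetric x.2),
      sumBilin_apply, sumBilin_apply,
      sumChristoffel_apply, sumChristoffel_apply, hΓm _ x.2,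
      (hφ p).christoffel_metric (hp p) hg (hgs.differentiableAt (by simp)) (hΓ₀ p) hD₀g]
    ring
  · obtain ⟨p, x, rfl, Ψ, hΨ, hsrc, hval, hDx⟩ := key q
    have hAa := hA.hyperhermitian.hypercomplex.complex a
    obtain ⟨Aφ, hAs, hAr⟩ := (hφ p).exists_endRep (hp p) hAa.smooth
    have hsm := contDiffAt_prodMap_const (y := Ψ (torusProj ψ (p, x)))
      (by rw [hval]; exact hAs) (L a)
    refine hΨ.isSmoothChart.parallel_of_christoffel hsrc
      ((hB a).endRepAt hΨ (hp p) hsrc hval hAr) (hsm.differentiableAt (by simp)) hDx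
      (fun c b ↦ ?_) hY u
    rw [hval, fderiv_prodMap_const (y := (φ p p, (x : ℍ[ℝ]))) hAs, sumChristoffel_apply,
      sumChristoffel_apply]
    have h := (hφ p).christoffel_parallel (hp p) hAr (hAs.differentiableAt (by simp)) (hΓ₀ p)
      (hD₀A a) c.1 b.1
    exact Prod.ext h ((zero_add _).trans (hΓL a x c.2 b.2))
  · obtain ⟨p, x, rfl, Ψ, hΨ, hsrc, hval, hDx⟩ := key q
    have hd := hΨ.dChart_dTorusProj (hp p) hsrc hval
    obtain ⟨v, w, rfl⟩ := exists_dTorusProj_eq ψ p x u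
    obtain ⟨v', w', rfl⟩ := exists_dTorusProj_eq ψ p x u'
    obtain ⟨v'', w'', rfl⟩ := exists_dTorusProj_eq ψ p x u''
    obtain ⟨b, c, hbc⟩ := exists_dTorusProj_eq ψ p x
      (D.torsion (torusProj ψ (p, x)) (dTorusProj ψ p x v w) (dTorusProj ψ p x v' w'))
    have h1 := hΨ.isSmoothChart.torsion_christoffel hsrc hDx (dTorusProj ψ p x v w)
      (dTorusProj ψ p x v' w')
    rw [← hbc, hd, hd, hd, sumChristoffel_apply, sumChristoffel_apply, Prod.mk_sub_mk,
      Prod.mk.injEq] at h1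
    have h2 := (hφ p).torsion_christoffel (hp p) (hΓ₀ p) v v'
    rw [← h1.1] at h2
    -- The first component of the torsion is the torsion of the Levi-Civita connection.
    have hb : b = 0 := by
      refine ((hφ p).dChart_injective (hp p) (h2.symm.trans ?_))
      rw [hD₀]
      rfl
    have h3 : (![dTorusProj ψ p x v w, dTorusProj ψ p x v' w', dTorusProj ψ p x v'' w''] :
        Fin 3 → TangentSpace ((I.prod 𝓘(ℝ, ℝ)).prod (𝓡 3)) (torusProj ψ (p, x))) =
        fun i ↦ dTorusProj ψ p x ((![v, v', v''] : Fin 3 → TangentSpace I p) i)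
          ((![w, w', w''] : Fin 3 → ℍ[ℝ]) i) := by
      funext i
      fin_cases i <;> rfl
    rw [h3, hT, ← hbc, hG, hb, map_zero, h1.2, hΓτ]
    simp

/-- A flat hyperhermitian model `(L, Γ, τ)` on `ℍ ∖ {0}` with closed torsion induces a strong HKT
structure on `N_ψ × S³`. -/
theorem isStrongHKT_of_induced [I.Boundaryless] {g : SmoothMetric I N} {A : Fin 3 → EndField I N}
    (hA : IsHyperkahler g A) {L : Fin 3 → ℍ[ℝ] →L[ℝ] ℍ[ℝ]} (hL : ∀ a w, L a (L a w) = -w)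
    (hmul : ∀ w, L 0 (L 1 w) = L 2 w) (hmul' : ∀ w, L 1 (L 0 w) = -L 2 w)
    (hskew : ∀ a v w, inner ℝ (L a v) w = -inner ℝ v (L a w))
    {Γ : ℍ[ℝ] → ℍ[ℝ] →L[ℝ] ℍ[ℝ] →L[ℝ] ℍ[ℝ]} {τ : ℍ[ℝ] → ℍ[ℝ] [⋀^Fin 3]→L[ℝ] ℝ}
    (hΓm : ∀ x, x ≠ 0 → ∀ c a b,
      fderiv ℝ flatMetric x c a b = flatMetric x (Γ x c a) b + flatMetric x a (Γ x c b))
    (hΓL : ∀ a x v w, Γ x v (L a w) = L a (Γ x v w))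
    (hΓτ : ∀ x u v w, τ x ![u, v, w] = flatMetric x (Γ x u v - Γ x v u) w)
    (hτs : ∀ x, x ≠ 0 → ContDiffAt ℝ ∞ τ x) (hτc : ∀ x, x ≠ 0 → extDeriv τ x = 0)
    {G : SmoothMetric ((I.prod 𝓘(ℝ, ℝ)).prod (𝓡 3)) (MappingTorus ψ × S3)}
    (hG : IsInducedMetric g G.inner)
    {B : Fin 3 → EndField ((I.prod 𝓘(ℝ, ℝ)).prod (𝓡 3)) (MappingTorus ψ × S3)}
    (hB : ∀ a, IsInducedEnd (A a) (L a) (B a))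
    {T : FormField ((I.prod 𝓘(ℝ, ℝ)).prod (𝓡 3)) (MappingTorus ψ × S3) 3}
    (hT : IsInducedForm τ T) : IsStrongHKT G B T :=
  ⟨⟨isHyperhermitian_of_induced hA.hyperhermitian hL hmul hmul' hskew hG hB,
    exists_isBismutConnection hA hΓm hΓL hΓτ hG hB hT⟩,
    hT.isClosedForm (hA.hyperhermitian.hypercomplex.complex 0).exists_smoothChart hτs hτc⟩

end Bismut

end HKT

end

theorem proposition4p3 {n : ℕ} {N : Type*} [TopologicalSpace N] [T2Space N] [CompactSpace N]
    [ChartedSpace (EuclideanSpace ℝ (Fin (4 * n))) N] [IsManifold (𝓡 (4 * n)) ∞ N]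
    (g : HKT.SmoothMetric (𝓡 (4 * n)) N) (A : Fin 3 → HKT.EndField (𝓡 (4 * n)) N)
    (hA : HKT.IsHyperkahler g A)
    (ψ : N ≃ₘ^∞⟮𝓡 (4 * n), 𝓡 (4 * n)⟯ N) (hψ : HKT.IsHyperkahlerIsometry g A ψ) :
    ∃ (G : HKT.SmoothMetric (((𝓡 (4 * n)).prod 𝓘(ℝ, ℝ)).prod (𝓡 3))
          (HKT.MappingTorus ψ × HKT.S3))
      (B B' : Fin 3 → HKT.EndField (((𝓡 (4 * n)).prod 𝓘(ℝ, ℝ)).prod (𝓡 3))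
          (HKT.MappingTorus ψ × HKT.S3)),
      HKT.IsGeneralizedHyperkahler G B B' ∧
      ∀ (p : N) (x : HKT.puncturedQuaternions),
        (∀ (v v' : TangentSpace (𝓡 (4 * n)) p) (w w' : ℍ[ℝ]),
          G.inner (HKT.torusProj ψ (p, x)) (HKT.dTorusProj ψ p x v w)
              (HKT.dTorusProj ψ p x v' w') =
            g.inner p v v' + inner ℝ w w' / ‖(x : ℍ[ℝ])‖ ^ 2) ∧
        (∀ (a : Fin 3) (v : TangentSpace (𝓡 (4 * n)) p) (w : ℍ[ℝ]),
          B a (HKT.torusProj ψ (p, x)) (HKT.dTorusProj ψ p x v w) =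
            HKT.dTorusProj ψ p x (A a p v) (HKT.imUnit a * w)) ∧
        (∀ (a : Fin 3) (v : TangentSpace (𝓡 (4 * n)) p) (w : ℍ[ℝ]),
          B' a (HKT.torusProj ψ (p, x)) (HKT.dTorusProj ψ p x v w) =
            HKT.dTorusProj ψ p x (A a p v) (w * star (HKT.imUnit a))) := by
  obtain ⟨G, hG⟩ := hψ.exists_smoothMetric
    (hA.hyperhermitian.hypercomplex.complex 0).exists_smoothChart
  choose B hB using fun a ↦ hψ.exists_endField a (HKT.leftMul (HKT.imUnit a))
  choose B' hB' using fun a ↦ hψ.exists_endField a (HKT.rightMul (HKT.imUnit a))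
  obtain ⟨T, hT⟩ := hψ.exists_form
  have hT' : HKT.IsInducedForm (fun x ↦ -HKT.flatTorsion x) fun q ↦ -T q := fun p x v w ↦
    congrArg Neg.neg (hT p x v w)
  refine ⟨G, B, B', ⟨T, fun q ↦ -T q, ?_, ?_, fun q ↦ (neg_neg _).symm⟩, fun p x ↦
    ⟨fun v v' w w' ↦ (hG p x v v' w w').trans (by rw [HKT.flatMetric_apply]), fun a ↦ hB a p x,
      fun a ↦ hB' a p x⟩⟩
  · refine HKT.isStrongHKT_of_induced (L := fun a ↦ HKT.leftMul (HKT.imUnit a))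
      (Γ := HKT.leftChristoffel) hA HKT.leftMul_leftMul_imUnit
      ?_ ?_ HKT.inner_leftMul_imUnit (fun x hx ↦ HKT.leftChristoffel_metric hx)
      (fun a ↦ HKT.leftChristoffel_leftMul _) ?_ (fun x ↦ HKT.contDiffAt_flatTorsion)
      (fun x ↦ HKT.extDeriv_flatTorsion) hG hB hT
    · intro w
      simp only [HKT.leftMul_apply, ← mul_assoc, HKT.imUnit_zero_mul_one]
    · intro w
      simp only [HKT.leftMul_apply, ← mul_assoc, HKT.imUnit_one_mul_zero, neg_mul]
    · intro x u v w
      rw [HKT.flatTorsion_apply, HKT.flatMetric_apply, HKT.leftChristoffel_apply,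
        HKT.leftChristoffel_apply, neg_sub_neg]
  · refine HKT.isStrongHKT_of_induced (L := fun a ↦ HKT.rightMul (HKT.imUnit a))
      (Γ := HKT.rightChristoffel) hA HKT.rightMul_rightMul_imUnit
      ?_ ?_ HKT.inner_rightMul_imUnit (fun x hx ↦ HKT.rightChristoffel_metric hx)
      (fun a ↦ HKT.rightChristoffel_rightMul _) ?_ (fun x hx ↦ (HKT.contDiffAt_flatTorsion hx).neg)
      ?_ hG hB' hT'
    · intro w
      simp only [HKT.rightMul_apply, HKT.star_imUnit, mul_neg, neg_mul, neg_neg, mul_assoc,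
        HKT.imUnit_one_mul_zero]
    · intro w
      simp only [HKT.rightMul_apply, HKT.star_imUnit, mul_neg, neg_mul, neg_neg, mul_assoc,
        HKT.imUnit_zero_mul_one]
    · intro x u v w
      rw [HKT.flatMetric_apply, HKT.rightChristoffel_apply, HKT.rightChristoffel_apply,
        neg_sub_neg, ← neg_sub, inner_neg_left, neg_div, ← HKT.flatTorsion_apply]
      rfl
    · intro x hx
      have h : extDeriv (-HKT.flatTorsion) x = 0 := by
        simpa [HKT.extDeriv_flatTorsion hx] using extDeriv_smul (-1 : ℝ) HKT.flatTorsion (x := x)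
      exact h
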